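/- Fix $d\in\mathbb N$, $T>0$, a path $z\in C([0,T];\mathbb R^d)$, a weight $w\in L^\infty([0,T])$ (e.g. $w\equiv 1$), an $\mathbb R^d$-valued tempered distribution $b\in\mathcal S'(\mathbb R^d)$ and $u_0\in\mathbb R^d$. Let $$G_{t_1,t_2}(C)=\int_0^{t_2}\!\int_0^{t_1} w_{r_1}w_{r_2}\,\mathbf 1_C(z_{r_2}-z_{r_1})\,dr_1dr_2,\qquad \overline G_{t_1,t_2}(C)=G_{t_1,t_2}(-C),\qquad A^b(t_1,t_2,\cdot)=b*\overline G_{t_1,t_2}.$$ For $\gamma\in(0,1]$, $k\in\mathbb N$, $\kappa\in(0,1)$, let $\mathcal C^{k+\kappa}(\mathbb R^d)$ be the space of $C^k$ functions whose derivatives up to order $k$ are bounded and whose $k$-th derivative is globally $\kappa$-Hölder continuous, with its usual norm. We write $A\in C^\gamma([0,T]^2;\mathcal C^{k+\kappa})$ if each $A(t_1,t_2,\cdot)$ is (given by) a function in $\mathcal C^{k+\kappa}$ and, for some $M$ and all $s_1,s_2,t_1,t_2\in[0,T]$, the $\mathcal C^{k+\kappa}$-norms of $A(s_1,s_2,\cdot)$,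 of $A(t_1,s_2,\cdot)-A(s_1,s_2,\cdot)$, of $A(s_1,t_2,\cdot)-A(s_1,s_2,\cdot)$ and of $\Box_{s,t}A=A(t_1,t_2,\cdot)-A(t_1,s_2,\cdot)-A(s_1,t_2,\cdot)+A(s_1,s_2,\cdot)$ are at most $M$, $M|t_1-s_1|^\gamma$, $M|t_2-s_2|^\gamma$ and $M|t_1-s_1|^\gamma|t_2-s_2|^\gamma$, respectively. The space $C^\gamma([0,T];\mathbb R^d)$ consists of the $\gamma$-Hölder continuous paths (Lipschitz paths if $\gamma=1$). A path $\theta:[0,T]\to\mathbb R^d$ solves the nonlinear Young equation if for every $t\in[0,T]$ $$\theta_t=u_0+\int_0^t\!\int_0^t A^b(dr,\theta_{r_2}-\theta_{r_1}),\qquad (\mathrm{NY})$$ where the integral is the limit, which is required to exist, of the Riemann sums $\sum_{[u,v]}\Box_{u,v}A^b(\cdot,\theta_{u_2}-\theta_{u_1})$ over the rectangles $[u,v]=[u_1,v_1]\times[u_2,v_2]$ of product partitions of $[0,t]\times[0,t]$ as the mesh size tends to zero. Then the following assertions hold. (a) Suppose that $b$ is a bounded continuous function and $A^b\in C^\gamma([0,T]^2;\mathcal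 C^{1+\kappa})$ with $\gamma\in(1/2,1]$, $\kappa\in(0,1)$, $\gamma+\kappa>1$. Then $u\in C([0,T];\mathbb R^d)$ satisfies $$u(t)=u_0+\int_0^t\!\int_0^t w_sw_r\,b(u(s)-u(r))\,dr\,ds+z_t,\qquad t\in[0,T],$$ if and only if $\theta=u-z$ is Lipschitz continuous and solves (NY). (b) Suppose that $A^b\in C^\gamma([0,T]^2;\mathcal C^{2+\kappa})$ with $\gamma\in(1/2,1]$, $\kappa\in(0,1)$, $\gamma(1+\kappa)>1$. Then there is exactly one $u\in C([0,T];\mathbb R^d)$ such that $\theta=u-z$ belongs to $C^\gamma([0,T];\mathbb R^d)$ and solves (NY). -/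

import Mathlib

open MeasureTheory Set
open scoped SchwartzMap

noncomputable section

/-- The Euclidean space `ℝ^d`. -/
abbrev Rd (d : ℕ) : Type := EuclideanSpace ℝ (Fin d)

/-- `ℝ^d`-valued (real) tempered distributions on `ℝ^d`: continuous linear maps from the
Schwartz space of real-valued functions to `ℝ^d`. -/
abbrev TemperedRd (d : ℕ) : Type := 𝓢(Rd d, ℝ) →L[ℝ] Rd d

/-- The distribution `S` is given by the locally integrable function `f`, i.e.
`⟨S, φ⟩ = ∫ φ(x) f(x) dx` for all test functions, the integrals being convergent. -/
def TemperedIsFunction {d : ℕ} (S : 𝓢(Rd d, ℝ) → Rd d) (f : Rd d → Rd d) : Prop :=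
  ∀ φ : 𝓢(Rd d, ℝ), Integrable (fun x => φ x • f x) ∧ S φ = ∫ x, φ x • f x

/-! The weighted two-parameter self-intersection measure
`G_{t₁,t₂}(C) = ∫_0^{t₂} ∫_0^{t₁} w_{r₁} w_{r₂} 1_C(z_{r₂} - z_{r₁}) dr₁ dr₂`.
It is a finite signed measure, represented as the difference of the two finite measures obtained
from the positive part and from the negative part of the density `w_{r₁} w_{r₂}`. -/

/-- For a density `ρ` on `[0,t₁] × [0,t₂]`, the measure
`C ↦ ∫_0^{t₂} ∫_0^{t₁} ρ(r₁, r₂)⁺ 1_C(z_{r₂} - z_{r₁}) dr₁ dr₂`. -/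
def intersectionMeasure {d : ℕ} (ρ : ℝ × ℝ → ℝ) (z : ℝ → Rd d) (t₁ t₂ : ℝ) : Measure (Rd d) :=
  ((volume.restrict (Icc 0 t₁ ×ˢ Icc 0 t₂)).withDensity (fun r => ENNReal.ofReal (ρ r))).map
    (fun r => z r.2 - z r.1)

/-- The part of `G_{t₁,t₂}` coming from the positive part of `w_{r₁} w_{r₂}`. -/
def selfIntersectionPos {d : ℕ} (w : ℝ → ℝ) (z : ℝ → Rd d) (t₁ t₂ : ℝ) : Measure (Rd d) :=
  intersectionMeasure (fun r => w r.1 * w r.2) z t₁ t₂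

/-- The part of `G_{t₁,t₂}` coming from the negative part of `w_{r₁} w_{r₂}`. -/
def selfIntersectionNeg {d : ℕ} (w : ℝ → ℝ) (z : ℝ → Rd d) (t₁ t₂ : ℝ) : Measure (Rd d) :=
  intersectionMeasure (fun r => -(w r.1 * w r.2)) z t₁ t₂

/-- The reflected measure `C ↦ μ(-C)`. -/
def reflectedMeasure {d : ℕ} (μ : Measure (Rd d)) : Measure (Rd d) :=
  μ.map (fun y => -y)

/-- The convolution `b * μ` of a tempered distribution with a compactly supported finite measure:
`⟨b * μ, φ⟩ = ∫ ⟨b, φ(· + y)⟩ μ(dy)`. -/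
def convMeasure {d : ℕ} (b : TemperedRd d) (μ : Measure (Rd d)) (φ : 𝓢(Rd d, ℝ)) : Rd d :=
  ∫ y, b (SchwartzMap.compSubConstCLM ℝ (-y) φ) ∂μ

/-- The distribution `A^b(t₁,t₂,·) = b * Ḡ_{t₁,t₂}`, with `Ḡ` the reflection of the signed
measure `G`. -/
def averagedDrift {d : ℕ} (b : TemperedRd d) (w : ℝ → ℝ) (z : ℝ → Rd d) (t₁ t₂ : ℝ)
    (φ : 𝓢(Rd d, ℝ)) : Rd d :=
  convMeasure b (reflectedMeasure (selfIntersectionPos w z t₁ t₂)) φ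
    - convMeasure b (reflectedMeasure (selfIntersectionNeg w z t₁ t₂)) φ

/-- The norm of `f` in the space `C_b^{k+κ}(ℝ^d)` (`κ ∈ (0,1)`) is at most `M` (up to a factor
depending only on `k`): `f` is `k` times continuously differentiable, the derivatives of order
`0, …, k` are bounded by `M`, and the `k`-th one is `κ`-Hölder continuous with constant `M`. -/
def HolderNormLE {d : ℕ} (k : ℕ) (κ : ℝ) (f : Rd d → Rd d) (M : ℝ) : Prop :=
  ContDiff ℝ k f ∧
  (∀ j ≤ k, ∀ x, ‖iteratedFDeriv ℝ j f x‖ ≤ M) ∧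
  (∀ x y, ‖iteratedFDeriv ℝ k f x - iteratedFDeriv ℝ k f y‖ ≤ M * ‖x - y‖ ^ κ)

/-- The rectangular increment `□_{s,t} A`, evaluated at the space point `x`, for
`s = (s₁,s₂)` and `t = (t₁,t₂)`. -/
def boxIncrement {d : ℕ} (A : ℝ → ℝ → Rd d → Rd d) (s₁ s₂ t₁ t₂ : ℝ) (x : Rd d) : Rd d :=
  A t₁ t₂ x - A t₁ s₂ x - A s₁ t₂ x + A s₁ s₂ x

/-- `A ∈ C^γ([0,T]²; C_b^{k+κ}(ℝ^d))`. -/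
def MemTimeSpaceHolder {d : ℕ} (T γ : ℝ) (k : ℕ) (κ : ℝ) (A : ℝ → ℝ → Rd d → Rd d) : Prop :=
  ∃ M : ℝ, ∀ s₁ ∈ Icc 0 T, ∀ s₂ ∈ Icc 0 T, ∀ t₁ ∈ Icc 0 T, ∀ t₂ ∈ Icc 0 T,
    HolderNormLE k κ (A s₁ s₂) M ∧
    HolderNormLE k κ (fun x => A t₁ s₂ x - A s₁ s₂ x) (M * |t₁ - s₁| ^ γ) ∧
    HolderNormLE k κ (fun x => A s₁ t₂ x - A s₁ s₂ x) (M * |t₂ - s₂| ^ γ) ∧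
    HolderNormLE k κ (boxIncrement A s₁ s₂ t₁ t₂) (M * (|t₁ - s₁| ^ γ * |t₂ - s₂| ^ γ))

/-- `θ ∈ C^γ([0,T]; ℝ^d)` (Lipschitz continuity for `γ = 1`). -/
def MemTimeHolder {d : ℕ} (T γ : ℝ) (θ : ℝ → Rd d) : Prop :=
  ∃ M : ℝ, ∀ s ∈ Icc 0 T, ∀ t ∈ Icc 0 T, ‖θ t - θ s‖ ≤ M * |t - s| ^ γ

/-- A partition `a = p₀ ≤ p₁ ≤ ⋯ ≤ p_n = b` of the interval `[a,b]`. -/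
structure IntervalPartition (a b : ℝ) where
  n : ℕ
  pts : ℕ → ℝ
  mono : Monotone pts
  first : pts 0 = a
  last : pts n = b

/-- All intervals of the partition have length less than `δ`. -/
def IntervalPartition.MeshLT {a b : ℝ} (P : IntervalPartition a b) (δ : ℝ) : Prop :=
  ∀ i < P.n, P.pts (i + 1) - P.pts i < δ

/-- The Riemann sum `∑_{[u,v]} □_{u,v} A(·, θ_{u₂} - θ_{u₁})` over the rectangles `[u,v]` of the
partition of `[0,t₁] × [0,t₂]` generated by `P` and `Q`. -/
def youngRiemannSum {d : ℕ} (A : ℝ → ℝ → Rd d → Rd d) (θ : ℝ → Rd d) {t₁ t₂ : ℝ}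
    (P : IntervalPartition 0 t₁) (Q : IntervalPartition 0 t₂) : Rd d :=
  ∑ i ∈ Finset.range P.n, ∑ j ∈ Finset.range Q.n,
    boxIncrement A (P.pts i) (Q.pts j) (P.pts (i + 1)) (Q.pts (j + 1))
      (θ (Q.pts j) - θ (P.pts i))

/-- The nonlinear Young integral `∫_0^{t₂} ∫_0^{t₁} A(dr, θ_{r₂} - θ_{r₁})` exists and equals `I`:
the Riemann sums converge to `I` as the mesh size tends to zero. -/
def HasNonlinearYoungIntegral {d : ℕ} (A : ℝ → ℝ → Rd d → Rd d) (θ : ℝ → Rd d) (t₁ t₂ : ℝ)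
    (I : Rd d) : Prop :=
  ∀ ε > 0, ∃ δ > 0, ∀ (P : IntervalPartition 0 t₁) (Q : IntervalPartition 0 t₂),
    P.MeshLT δ → Q.MeshLT δ → ‖youngRiemannSum A θ P Q - I‖ < ε

/-- The nonlinear Young equation
`θ_t = u₀ + ∫_0^t ∫_0^t A(dr, θ_{r₂} - θ_{r₁})` on `[0,T]`. -/
def SolvesYoungEquation {d : ℕ} (T : ℝ) (A : ℝ → ℝ → Rd d → Rd d) (u₀ : Rd d)
    (θ : ℝ → Rd d) : Prop :=
  ∀ t ∈ Icc 0 T, ∃ I : Rd d, HasNonlinearYoungIntegral A θ t t I ∧ θ t = u₀ + I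

/-- The classical self-interacting equation
`u(t) = u₀ + ∫_0^t ∫_0^t w_s w_r f(u(s) - u(r)) dr ds + z_t` on `[0,T]`. -/
def SolvesClassical {d : ℕ} (T : ℝ) (f : Rd d → Rd d) (w : ℝ → ℝ) (z : ℝ → Rd d) (u₀ : Rd d)
    (u : ℝ → Rd d) : Prop :=
  ∀ t ∈ Icc 0 T, u t = u₀ + (∫ s in (0 : ℝ)..t, ∫ r in (0 : ℝ)..t,
    (w s * w r) • f (u s - u r)) + z t

/-- The function `A` represents `A^b`: for all `t ∈ [0,T]²`, the distribution `b * Ḡ_t` is given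
by the function `A t₁ t₂`. -/
def RepresentsAveragedDrift {d : ℕ} (T : ℝ) (b : TemperedRd d) (w : ℝ → ℝ) (z : ℝ → Rd d)
    (A : ℝ → ℝ → Rd d → Rd d) : Prop :=
  ∀ t₁ ∈ Icc 0 T, ∀ t₂ ∈ Icc 0 T, TemperedIsFunction (averagedDrift b w z t₁ t₂) (A t₁ t₂)

/-- `u` is a solution of the self-interacting equation with distributional drift, where `A`
represents `A^b`: `u ∈ C([0,T]; ℝ^d)`, and `θ = u - z` belongs to `C^γ([0,T]; ℝ^d)` and solves the
nonlinear Young equation. -/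
def IsYoungSolution {d : ℕ} (T γ : ℝ) (A : ℝ → ℝ → Rd d → Rd d) (z : ℝ → Rd d) (u₀ : Rd d)
    (u : ℝ → Rd d) : Prop :=
  ContinuousOn u (Icc 0 T) ∧ MemTimeHolder T γ (fun t => u t - z t) ∧
    SolvesYoungEquation T A u₀ (fun t => u t - z t)

end

/-! Part (b) is a fixed-point argument for a two-parameter Young integral. Splitting a rectangle
changes the germ `youngGerm A θ` only through the evaluation point on a subrectangle. Hence its
defect of additivity in one variable is a first difference of a box increment of A, and the mixed
defect is a second difference. As A is C^{2+κ} in space and θ is γ-Hölder, a defect has order β =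
γ(1 + κ) > 1 in every variable that is split (`BoxHolder.rectBound`). Sewing in the first variable
and then in the second (`sewRect`) yields the integral, and Riemann sums converge to it along all
product partitions (`RectBound.norm_riemannSum_sub_le`). For the difference of two germs the mixed
defect compares second differences at different base points; this uses the κ-Hölder continuity of
the second derivative and gives a bound linear in θ - η (`BoxHolder.rectBound_sub`).

The equation has memory: going from s to t adds to the square [0,s]² two strips of length up to T.
At scale h = T/n each strip is cut into n windows of contribution of order h^{2γ}, in total
h^{2γ-1}, which is small because γ > 1/2. In a norm weighted by exp(-t/h) the solution map then
halves distances on all of [0,T] at once. This gives existence by Picard iteration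
(`ContractionScale.exists_fixed`) and uniqueness (`ContractionScale.eq_of_fixed`); every γ-Hölder
path belongs to the contraction class once the scale is fine enough.

In part (a), Fubini identifies A^b(t₁,t₂,x) with the integral of w_{r₁} w_{r₂} b(x + z_{r₂} -
z_{r₁}). A box increment is then an integral over a rectangle, and uniform continuity on compact
sets makes the Riemann sums converge to the Lebesgue integral with argument u_{r₂} - u_{r₁}. The two
equations agree by uniqueness of limits. The Lipschitz bound holds because the kernel is bounded and
[0,t]² minus [0,s]² has area at most 2T(t - s). -/

/-! ### One-parameter sewing -/

section Sewing

open Filter Topology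

variable {E : Type*} [NormedAddCommGroup E]

/-- The defect of additivity of the germ `Ξ` is at most `K ((t - s) / ℓ) ^ β` within `[a, b]`. -/
def SewingBound (Ξ : ℝ → ℝ → E) (a b K ℓ β : ℝ) : Prop :=
  ∀ s u t, a ≤ s → s ≤ u → u ≤ t → t ≤ b → ‖Ξ s t - Ξ s u - Ξ u t‖ ≤ K * ((t - s) / ℓ) ^ β

/-- The constant in the sewing estimate. -/
noncomputable def sewingConst (β : ℝ) : ℝ := ∑' k : ℕ, (2 / ((k : ℝ) + 1)) ^ β

lemma summable_sewingConst {β : ℝ} (hβ : 1 < β) :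
    Summable fun k : ℕ => (2 / ((k : ℝ) + 1)) ^ β := by
  have h := ((summable_nat_add_iff 1).2 (Real.summable_one_div_nat_rpow.2 hβ)).mul_left (2 ^ β)
  refine h.congr fun k => ?_
  rw [Real.div_rpow (by norm_num) (by positivity)]
  push_cast
  ring

lemma sewingConst_nonneg (β : ℝ) : 0 ≤ sewingConst β :=
  tsum_nonneg fun _ => by positivity

lemma SewingBound.mono {Ξ : ℝ → ℝ → E} {a b a' b' K ℓ β : ℝ} (h : SewingBound Ξ a b K ℓ β)
    (ha : a ≤ a') (hb : b' ≤ b) : SewingBound Ξ a' b' K ℓ β :=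
  fun s u t h1 h2 h3 h4 => h s u t (ha.trans h1) h2 h3 (h4.trans hb)

/-- For s = u = t the defect is `-Ξ s s` and its bound is a multiple of 0 ^ β = 0. -/
lemma SewingBound.self_eq_zero {Ξ : ℝ → ℝ → E} {a b K ℓ β : ℝ} (h : SewingBound Ξ a b K ℓ β)
    (hβ : 1 < β) {s : ℝ} (h1 : a ≤ s) (h2 : s ≤ b) : Ξ s s = 0 := by
  have := h s s s h1 le_rfl le_rfl h2
  rw [sub_self s, zero_div, Real.zero_rpow (by linarith), mul_zero] at this
  simpa using this

/-! ### Young's point-removal argument -/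

/-- Omitting the point of index `i + 1` from a sequence. -/
def omitPoint (p : ℕ → ℝ) (i : ℕ) (k : ℕ) : ℝ := if k ≤ i then p k else p (k + 1)

lemma omitPoint_monotone {p : ℕ → ℝ} (hp : Monotone p) (i : ℕ) : Monotone (omitPoint p i) := by
  intro k l hkl
  unfold omitPoint
  split_ifs <;> apply hp <;> omega

lemma sum_omitPoint (Ξ : ℝ → ℝ → E) (p : ℕ → ℝ) {i n : ℕ} (hi : i ≤ n) :
    ∑ k ∈ Finset.range (n + 2), Ξ (p k) (p (k + 1)) =
      ∑ k ∈ Finset.range (n + 1), Ξ (omitPoint p i k) (omitPoint p i (k + 1))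
        - (Ξ (p i) (p (i + 2)) - Ξ (p i) (p (i + 1)) - Ξ (p (i + 1)) (p (i + 2))) := by
  obtain ⟨m, rfl⟩ := Nat.exists_eq_add_of_le hi
  have e1 : i + m + 2 = i + 1 + 1 + m := by ring
  have e2 : i + m + 1 = i + 1 + m := by ring
  rw [e1, e2, Finset.sum_range_add _ (i + 1 + 1) m, Finset.sum_range_add _ (i + 1) m,
    Finset.sum_range_succ _ (i + 1), Finset.sum_range_succ _ i, Finset.sum_range_succ _ i]
  have h1 : ∑ k ∈ Finset.range i, Ξ (omitPoint p i k) (omitPoint p i (k + 1)) =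
      ∑ k ∈ Finset.range i, Ξ (p k) (p (k + 1)) := by
    refine Finset.sum_congr rfl fun k hk => ?_
    have := Finset.mem_range.1 hk
    rw [omitPoint, omitPoint, if_pos (by omega), if_pos (by omega)]
  have h2 : ∑ k ∈ Finset.range m, Ξ (omitPoint p i (i + 1 + k)) (omitPoint p i (i + 1 + k + 1)) =
      ∑ k ∈ Finset.range m, Ξ (p (i + 1 + 1 + k)) (p (i + 1 + 1 + k + 1)) := by
    refine Finset.sum_congr rfl fun k _ => ?_
    rw [omitPoint, omitPoint, if_neg (by omega), if_neg (by omega)]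
    congr 2 <;> ring
  have h3 : Ξ (omitPoint p i i) (omitPoint p i (i + 1)) = Ξ (p i) (p (i + 2)) := by
    rw [omitPoint, omitPoint, if_pos le_rfl, if_neg (by omega)]
  rw [h1, h2, h3]
  abel

/-- Pigeonhole: the n + 1 double gaps cover every elementary interval at most twice, so they add up
to at most twice the total length. -/
lemma exists_small_double_gap {p : ℕ → ℝ} (hp : Monotone p) (n : ℕ) :
    ∃ i ≤ n, p (i + 2) - p i ≤ 2 / ((n : ℝ) + 1) * (p (n + 2) - p 0) := by
  have h : ∑ i ∈ Finset.range (n + 1), (p (i + 2) - p i) ≤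
      ∑ _i ∈ Finset.range (n + 1), 2 / ((n : ℝ) + 1) * (p (n + 2) - p 0) := by
    have e : ∀ i, p (i + 2) - p i = (p (i + 1 + 1) - p (i + 1)) + (p (i + 1) - p i) :=
      fun i => by ring
    simp_rw [e]
    rw [Finset.sum_add_distrib, Finset.sum_range_sub, Finset.sum_range_sub (fun i => p (i + 1))]
    rw [Finset.sum_const, Finset.card_range, nsmul_eq_mul]
    have : ((n + 1 : ℕ) : ℝ) * (2 / ((n : ℝ) + 1) * (p (n + 2) - p 0)) = 2 * (p (n + 2) - p 0) := by
      push_cast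
      field_simp
    rw [this]
    have h1 := hp (show n + 1 ≤ n + 2 by omega)
    have h2 := hp (show 0 ≤ 0 + 1 by omega)
    show p (n + 1 + 1) - p (0 + 1) + (p (n + 1) - p 0) ≤ _
    have : p (n + 1 + 1) = p (n + 2) := rfl
    linarith
  obtain ⟨i, hi, h⟩ := Finset.exists_le_of_sum_le (by simp) h
  exact ⟨i, by simpa [Nat.lt_succ_iff] using hi, h⟩

/-- Young's maximal inequality: all Riemann sums of a germ are close to the germ. -/
lemma SewingBound.norm_sum_sub_le {Ξ : ℝ → ℝ → E} {a b K ℓ β : ℝ} (hK : 0 ≤ K) (hℓ : 0 < ℓ)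
    (hβ : 1 < β) (h : SewingBound Ξ a b K ℓ β) (n : ℕ) :
    ∀ p : ℕ → ℝ, Monotone p → a ≤ p 0 → p (n + 1) ≤ b →
      ‖∑ k ∈ Finset.range (n + 1), Ξ (p k) (p (k + 1)) - Ξ (p 0) (p (n + 1))‖ ≤
        (∑ k ∈ Finset.range n, (2 / ((k : ℝ) + 1)) ^ β) * (K * ((p (n + 1) - p 0) / ℓ) ^ β) := by
  induction n with
  | zero => intro p _ _ _; simp
  | succ n ih =>
    intro p hp ha hb
    -- Removing the middle point of a small double gap costs one defect, whose factor `(2 / (n + 1))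
    -- ^ β` is the next term of the convergent series `sewingConst`.
    obtain ⟨i, hi, hgap⟩ := exists_small_double_gap hp n
    have hih := ih (omitPoint p i) (omitPoint_monotone hp i)
    have h0 : omitPoint p i 0 = p 0 := by simp [omitPoint]
    have h1 : omitPoint p i (n + 1) = p (n + 2) := by rw [omitPoint, if_neg (by omega)]
    rw [h0, h1] at hih
    specialize hih ha hb
    have hd := h (p i) (p (i + 1)) (p (i + 2)) (ha.trans (hp (Nat.zero_le _)))
      (hp (by omega)) (hp (by omega)) ((hp (by omega)).trans hb)
    have hd' : K * ((p (i + 2) - p i) / ℓ) ^ β ≤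
        (2 / ((n : ℝ) + 1)) ^ β * (K * ((p (n + 2) - p 0) / ℓ) ^ β) := by
      have hpos : 0 ≤ (p (n + 2) - p 0) / ℓ :=
        div_nonneg (sub_nonneg.2 (hp (Nat.zero_le _))) hℓ.le
      have : ((p (i + 2) - p i) / ℓ) ^ β ≤ (2 / ((n : ℝ) + 1) * ((p (n + 2) - p 0) / ℓ)) ^ β := by
        refine Real.rpow_le_rpow (div_nonneg (sub_nonneg.2 (hp (by omega))) hℓ.le) ?_ (by linarith)
        rw [← mul_div_assoc]
        exact div_le_div_of_nonneg_right hgap hℓ.le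
      rw [Real.mul_rpow (by positivity) hpos] at this
      calc _ ≤ K * ((2 / ((n : ℝ) + 1)) ^ β * ((p (n + 2) - p 0) / ℓ) ^ β) :=
            mul_le_mul_of_nonneg_left this hK
        _ = _ := by ring
    rw [sum_omitPoint Ξ p hi, Finset.sum_range_succ (fun k : ℕ => (2 / ((k : ℝ) + 1)) ^ β) n, add_mul]
    refine le_trans ?_ (add_le_add hih (hd.trans hd'))
    refine le_trans (le_of_eq ?_) (norm_sub_le _ _)
    congr 1
    abel

lemma SewingBound.norm_sum_sub_le_const {Ξ : ℝ → ℝ → E} {a b K ℓ β : ℝ} (hK : 0 ≤ K) (hℓ : 0 < ℓ)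
    (hβ : 1 < β) (h : SewingBound Ξ a b K ℓ β) (n : ℕ) {p : ℕ → ℝ} (hp : Monotone p)
    (ha : a ≤ p 0) (hb : p n ≤ b) :
    ‖∑ k ∈ Finset.range n, Ξ (p k) (p (k + 1)) - Ξ (p 0) (p n)‖ ≤
      sewingConst β * (K * ((p n - p 0) / ℓ) ^ β) := by
  have hpos : 0 ≤ K * ((p n - p 0) / ℓ) ^ β := mul_nonneg hK
    (Real.rpow_nonneg (div_nonneg (sub_nonneg.2 (hp (Nat.zero_le _))) hℓ.le) _)
  cases n with
  | zero =>
    -- The empty sum is compared with `Ξ (p 0) (p 0)`, which has to vanish.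
    rw [h.self_eq_zero hβ ha hb]
    simpa using mul_nonneg (sewingConst_nonneg β) hpos
  | succ n =>
    refine (h.norm_sum_sub_le hK hℓ hβ n p hp ha hb).trans
      (mul_le_mul_of_nonneg_right ?_ hpos)
    exact (summable_sewingConst hβ).sum_le_tsum _ fun k _ => by positivity

/-- One factor of each power is kept and telescopes; the remaining power β - 1 > 0 is estimated by
the mesh. This makes summed defects negligible. -/
lemma sum_rpow_increments_le {p : ℕ → ℝ} (hp : Monotone p) {n : ℕ} {δ ℓ β : ℝ} (hℓ : 0 < ℓ)
    (hβ : 1 < β) (hδ : ∀ k < n, p (k + 1) - p k ≤ δ) :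
    ∑ k ∈ Finset.range n, ((p (k + 1) - p k) / ℓ) ^ β ≤
      (δ / ℓ) ^ (β - 1) * ((p n - p 0) / ℓ) := by
  rw [← Finset.sum_range_sub p, Finset.sum_div, Finset.mul_sum]
  refine Finset.sum_le_sum fun k hk => ?_
  have h0 : 0 ≤ (p (k + 1) - p k) / ℓ := div_nonneg (sub_nonneg.2 (hp (Nat.le_succ k))) hℓ.le
  have h1 : ((p (k + 1) - p k) / ℓ) ^ β =
      ((p (k + 1) - p k) / ℓ) ^ (β - 1) * ((p (k + 1) - p k) / ℓ) := by
    rcases h0.eq_or_lt with h | h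
    · rw [← h, Real.zero_rpow (by linarith), mul_zero]
    · rw [← Real.rpow_add_one h.ne', sub_add_cancel]
  rw [h1]
  refine mul_le_mul_of_nonneg_right (Real.rpow_le_rpow h0 ?_ (by linarith)) h0
  exact div_le_div_of_nonneg_right (hδ k (Finset.mem_range.1 hk)) hℓ.le

/-! ### Limits of dyadic Riemann sums -/

/-- The dyadic grid of `[0, T]`, clamped to `[s, t]`. -/
noncomputable def clampedGrid (T s t : ℝ) (n k : ℕ) : ℝ := max s (min t (T * (k / 2 ^ n)))

lemma clampedGrid_monotone {T : ℝ} (hT : 0 ≤ T) (s t : ℝ) (n : ℕ) :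
    Monotone (clampedGrid T s t n) := by
  intro k l hkl
  unfold clampedGrid
  have : (k : ℝ) ≤ l := by exact_mod_cast hkl
  gcongr

lemma clampedGrid_zero {T s t : ℝ} (hs : 0 ≤ s) (hst : s ≤ t) (n : ℕ) :
    clampedGrid T s t n 0 = s := by
  have : min t (T * (((0 : ℕ) : ℝ) / 2 ^ n)) = 0 := by simpa using hs.trans hst
  rw [clampedGrid, this, max_eq_left hs]

lemma clampedGrid_last {T s t : ℝ} (hst : s ≤ t) (ht : t ≤ T) (n : ℕ) :
    clampedGrid T s t n (2 ^ n) = t := by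
  have : T * (((2 ^ n : ℕ) : ℝ) / 2 ^ n) = T := by
    push_cast
    field_simp
  rw [clampedGrid, this, min_eq_left ht, max_eq_right hst]

lemma clampedGrid_mem {T s t : ℝ} (hst : s ≤ t) (n k : ℕ) :
    clampedGrid T s t n k ∈ Icc s t :=
  ⟨le_max_left _ _, max_le hst (min_le_left _ _)⟩

lemma clamp_sub_le {s t x y : ℝ} (hxy : x ≤ y) :
    max s (min t y) - max s (min t x) ≤ y - x := by
  rcases le_total t y with h1 | h1 <;> rcases le_total t x with h2 | h2 <;>
    simp only [min_eq_left, min_eq_right, h1, h2] <;>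
    rcases max_cases s t with h3 | h3 <;> rcases max_cases s x with h4 | h4 <;>
      rcases max_cases s y with h5 | h5 <;> linarith

lemma clampedGrid_gap_le {T : ℝ} (hT : 0 ≤ T) (s t : ℝ) (n k : ℕ) :
    clampedGrid T s t n (k + 1) - clampedGrid T s t n k ≤ T / 2 ^ n := by
  refine (clamp_sub_le (by push_cast; gcongr; linarith)).trans (le_of_eq ?_)
  push_cast
  ring

lemma clampedGrid_succ_two_mul (T s t : ℝ) (n k : ℕ) :
    clampedGrid T s t (n + 1) (2 * k) = clampedGrid T s t n k := by
  unfold clampedGrid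
  congr 3
  push_cast
  rw [pow_succ]
  field_simp

/-- Riemann sums over the clamped dyadic grid. -/
noncomputable def gridSum (T : ℝ) (Ξ : ℝ → ℝ → E) (s t : ℝ) (n : ℕ) : E :=
  ∑ k ∈ Finset.range (2 ^ n), Ξ (clampedGrid T s t n k) (clampedGrid T s t n (k + 1))

lemma sum_range_two_mul {M : Type*} [AddCommMonoid M] (f : ℕ → M) (n : ℕ) :
    ∑ k ∈ Finset.range (2 * n), f k = ∑ k ∈ Finset.range n, (f (2 * k) + f (2 * k + 1)) := by
  induction n with
  | zero => simp
  | succ n ih =>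
    rw [mul_add, mul_one, Finset.sum_range_succ, Finset.sum_range_succ, ih,
      Finset.sum_range_succ, add_assoc]

/-- The size of the error made by Riemann sums on the dyadic grid. -/
noncomputable def gridError (T s t K ℓ β : ℝ) (n : ℕ) : ℝ :=
  K * ((T / 2 ^ n / ℓ) ^ (β - 1) * ((t - s) / ℓ))

lemma sum_grid_rpow_le {T s t K ℓ β : ℝ} (hs : 0 ≤ s) (hst : s ≤ t) (ht : t ≤ T) (hK : 0 ≤ K)
    (hℓ : 0 < ℓ) (hβ : 1 < β) (n : ℕ) :
    ∑ k ∈ Finset.range (2 ^ n),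
      K * ((clampedGrid T s t n (k + 1) - clampedGrid T s t n k) / ℓ) ^ β ≤
        gridError T s t K ℓ β n := by
  have hT : 0 ≤ T := by linarith
  have := sum_rpow_increments_le (clampedGrid_monotone hT s t n) (n := 2 ^ n) hℓ hβ
    (fun k _ => clampedGrid_gap_le hT s t n k)
  rw [clampedGrid_zero hs hst, clampedGrid_last hst ht] at this
  rw [← Finset.mul_sum]
  exact mul_le_mul_of_nonneg_left this hK

lemma gridError_eq {T s t K ℓ β : ℝ} (hT : 0 ≤ T) (hℓ : 0 < ℓ) (n : ℕ) :
    gridError T s t K ℓ β n =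
      K * ((T / ℓ) ^ (β - 1) * ((t - s) / ℓ)) * ((1 / 2 : ℝ) ^ (β - 1)) ^ n := by
  have : T / 2 ^ n / ℓ = T / ℓ * (1 / 2) ^ n := by
    rw [div_pow, one_pow]
    field_simp
  rw [gridError, this, Real.mul_rpow (by positivity) (by positivity), ← Real.rpow_natCast_mul
    (by norm_num), mul_comm (n : ℝ), Real.rpow_mul_natCast (by norm_num)]
  ring

lemma half_rpow_lt_one {β : ℝ} (hβ : 1 < β) : ((1 / 2 : ℝ) ^ (β - 1)) < 1 :=
  Real.rpow_lt_one (by norm_num) (by norm_num) (by linarith)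

lemma tendsto_gridError {T s t K ℓ β : ℝ} (hT : 0 ≤ T) (hℓ : 0 < ℓ) (hβ : 1 < β) :
    Tendsto (gridError T s t K ℓ β) atTop (𝓝 0) := by
  have := (tendsto_pow_atTop_nhds_zero_of_lt_one (by positivity) (half_rpow_lt_one hβ)).const_mul
    (K * ((T / ℓ) ^ (β - 1) * ((t - s) / ℓ)))
  rw [mul_zero] at this
  exact this.congr fun n => (gridError_eq hT hℓ n).symm

/-- The sewing of the germ `Ξ`, as a limit of Riemann sums. -/
noncomputable def sew (T : ℝ) (Ξ : ℝ → ℝ → E) (s t : ℝ) : E :=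
  limUnder atTop (gridSum T Ξ s t)

variable {Ξ : ℝ → ℝ → E} {T s t u K ℓ β : ℝ}

/-- The next level splits every cell at one point, so the two sums differ by one defect per cell. -/
lemma SewingBound.dist_gridSum_le (h : SewingBound Ξ s t K ℓ β) (hs : 0 ≤ s) (hst : s ≤ t)
    (ht : t ≤ T) (hK : 0 ≤ K) (hℓ : 0 < ℓ) (hβ : 1 < β) (n : ℕ) :
    dist (gridSum T Ξ s t n) (gridSum T Ξ s t (n + 1)) ≤ gridError T s t K ℓ β n := by
  have hT : 0 ≤ T := by linarith
  refine le_trans ?_ (sum_grid_rpow_le hs hst ht hK hℓ hβ n)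
  rw [dist_eq_norm, gridSum, gridSum, pow_succ, mul_comm, sum_range_two_mul,
    ← Finset.sum_sub_distrib]
  refine (norm_sum_le _ _).trans (Finset.sum_le_sum fun k _ => ?_)
  have e : clampedGrid T s t (n + 1) (2 * k + 1 + 1) = clampedGrid T s t n (k + 1) :=
    clampedGrid_succ_two_mul T s t n (k + 1)
  have hm := clampedGrid_monotone hT s t (n + 1)
  have := h (clampedGrid T s t (n + 1) (2 * k)) (clampedGrid T s t (n + 1) (2 * k + 1))
    (clampedGrid T s t (n + 1) (2 * k + 1 + 1)) (clampedGrid_mem hst _ _).1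
    (hm (by omega)) (hm (by omega)) (clampedGrid_mem hst _ _).2
  rw [e, clampedGrid_succ_two_mul] at this
  rw [e, clampedGrid_succ_two_mul, ← sub_sub]
  exact this

/-- The grids of [s,u], [u,t] and [s,t] are clampings of one common grid, so they can be compared
cell by cell. A cell on one side of u collapses in the other piece and contributes `Ξ u u = 0`; only
a cell around u leaves a defect. This gives additivity of the sewing. -/
lemma norm_clamped_term_le (h : SewingBound Ξ s t K ℓ β) (hsu : s ≤ u) (hut : u ≤ t) (hK : 0 ≤ K)
    (hℓ : 0 < ℓ) (hβ : 1 < β) {a b : ℝ} (hab : a ≤ b) :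
    ‖Ξ (max s (min t a)) (max s (min t b)) - Ξ (max s (min u a)) (max s (min u b))
      - Ξ (max u (min t a)) (max u (min t b))‖ ≤
        K * ((max s (min t b) - max s (min t a)) / ℓ) ^ β := by
  have hpos : 0 ≤ K * ((max s (min t b) - max s (min t a)) / ℓ) ^ β := by
    have : max s (min t a) ≤ max s (min t b) := by gcongr
    exact mul_nonneg hK (Real.rpow_nonneg (div_nonneg (sub_nonneg.2 this) hℓ.le) _)
  have huu : Ξ u u = 0 := h.self_eq_zero hβ hsu hut
  rcases le_total b u with hb | hb
  · have ha := hab.trans hb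
    rw [min_eq_right (ha.trans hut), min_eq_right (hb.trans hut), min_eq_right ha, min_eq_right hb,
      max_eq_left ha, max_eq_left hb, huu]
    simpa [min_eq_right (ha.trans hut), min_eq_right (hb.trans hut)] using hpos
  rcases le_total u a with ha | ha
  · have e1 : max u (min t a) = max s (min t a) := by
      rw [max_eq_right (le_min hut ha), max_eq_right (hsu.trans (le_min hut ha))]
    have e2 : max u (min t b) = max s (min t b) := by
      rw [max_eq_right (le_min hut hb), max_eq_right (hsu.trans (le_min hut hb))]
    rw [e1, e2, min_eq_left ha, min_eq_left hb, max_eq_right hsu, huu]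
    simpa using hpos
  · have e1 : max s (min u a) = max s (min t a) := by
      rw [min_eq_right ha, min_eq_right (ha.trans hut)]
    have e2 : max s (min u b) = u := by rw [min_eq_left hb, max_eq_right hsu]
    have e3 : max u (min t a) = u := by rw [min_eq_right (ha.trans hut), max_eq_left ha]
    have e4 : max u (min t b) = max s (min t b) := by
      rw [max_eq_right (le_min hut hb), max_eq_right (hsu.trans (le_min hut hb))]
    rw [e1, e2, e3, e4]
    refine h _ _ _ (le_max_left _ _) ?_ ?_ (max_le (hsu.trans hut) (min_le_left _ _))
    · exact max_le hsu ((min_le_right _ _).trans ha)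
    · exact le_max_of_le_right (le_min hut hb)

variable [CompleteSpace E]

lemma SewingBound.tendsto_gridSum (h : SewingBound Ξ s t K ℓ β) (hs : 0 ≤ s) (hst : s ≤ t)
    (ht : t ≤ T) (hK : 0 ≤ K) (hℓ : 0 < ℓ) (hβ : 1 < β) :
    Tendsto (gridSum T Ξ s t) atTop (𝓝 (sew T Ξ s t)) := by
  have hc : CauchySeq (gridSum T Ξ s t) :=
    cauchySeq_of_le_geometric _ _ (half_rpow_lt_one hβ) fun n => by
      have := h.dist_gridSum_le hs hst ht hK hℓ hβ n
      rwa [gridError_eq (by linarith) hℓ] at this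
  exact hc.tendsto_limUnder

lemma SewingBound.norm_sew_sub_le (h : SewingBound Ξ s t K ℓ β) (hs : 0 ≤ s) (hst : s ≤ t)
    (ht : t ≤ T) (hK : 0 ≤ K) (hℓ : 0 < ℓ) (hβ : 1 < β) :
    ‖sew T Ξ s t - Ξ s t‖ ≤ sewingConst β * (K * ((t - s) / ℓ) ^ β) := by
  have hl := ((h.tendsto_gridSum hs hst ht hK hℓ hβ).sub_const (Ξ s t)).norm
  refine le_of_tendsto' hl fun n => ?_
  have := h.norm_sum_sub_le_const hK hℓ hβ (2 ^ n)
    (clampedGrid_monotone (T := T) (by linarith) s t n) (clampedGrid_mem hst _ _).1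
    (clampedGrid_mem hst _ _).2
  rwa [clampedGrid_zero hs hst, clampedGrid_last hst ht] at this

lemma SewingBound.sew_add_sew (h : SewingBound Ξ s t K ℓ β) (hs : 0 ≤ s) (hsu : s ≤ u)
    (hut : u ≤ t) (ht : t ≤ T) (hK : 0 ≤ K) (hℓ : 0 < ℓ) (hβ : 1 < β) :
    sew T Ξ s u + sew T Ξ u t = sew T Ξ s t := by
  have hT : 0 ≤ T := by linarith
  have h1 := h.tendsto_gridSum hs (hsu.trans hut) ht hK hℓ hβ
  have h2 := (h.mono le_rfl hut).tendsto_gridSum hs hsu (hut.trans ht) hK hℓ hβ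
  have h3 := (h.mono hsu le_rfl).tendsto_gridSum (hs.trans hsu) hut ht hK hℓ hβ
  have h4 := (h1.sub h2).sub h3
  have h5 : Tendsto (fun n => gridSum T Ξ s t n - gridSum T Ξ s u n - gridSum T Ξ u t n) atTop
      (𝓝 0) := by
    refine squeeze_zero_norm (fun n => ?_) (tendsto_gridError (s := s) (t := t) (K := K) hT hℓ hβ)
    refine le_trans ?_ (sum_grid_rpow_le hs (hsu.trans hut) ht hK hℓ hβ n)
    rw [gridSum, gridSum, gridSum, ← Finset.sum_sub_distrib, ← Finset.sum_sub_distrib]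
    refine (norm_sum_le _ _).trans (Finset.sum_le_sum fun k _ => ?_)
    exact norm_clamped_term_le h hsu hut hK hℓ hβ (by push_cast; gcongr; linarith)
  have h6 := tendsto_nhds_unique h4 h5
  rw [sub_sub, sub_eq_zero] at h6
  exact h6.symm

end Sewing

/-! ### Two-parameter sewing -/

section RectSewing

open Filter Topology

variable {E : Type*} [NormedAddCommGroup E]

lemma gridSum_congr {T : ℝ} (hT : 0 ≤ T) {Ξ Ξ' : ℝ → ℝ → E} {s t : ℝ} (hst : s ≤ t)
    (h : ∀ a b, s ≤ a → a ≤ b → b ≤ t → Ξ a b = Ξ' a b) :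
    gridSum T Ξ s t = gridSum T Ξ' s t := by
  funext n
  refine Finset.sum_congr rfl fun k _ => h _ _ (clampedGrid_mem hst _ _).1
    (clampedGrid_monotone hT s t n (Nat.le_succ k)) (clampedGrid_mem hst _ _).2

lemma gridSum_sub (T : ℝ) (Ξ Ξ' : ℝ → ℝ → E) (s t : ℝ) (n : ℕ) :
    gridSum T (fun a b => Ξ a b - Ξ' a b) s t n = gridSum T Ξ s t n - gridSum T Ξ' s t n := by
  simp only [gridSum, Finset.sum_sub_distrib]

lemma SewingBound.sub {Ξ Ξ' : ℝ → ℝ → E} {a b K K' ℓ β : ℝ} (h : SewingBound Ξ a b K ℓ β)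
    (h' : SewingBound Ξ' a b K' ℓ β) :
    SewingBound (fun x y => Ξ x y - Ξ' x y) a b (K + K') ℓ β := by
  intro s u t h1 h2 h3 h4
  rw [add_mul]
  refine le_trans (le_of_eq ?_) ((norm_sub_le _ _).trans
    (add_le_add (h s u t h1 h2 h3 h4) (h' s u t h1 h2 h3 h4)))
  congr 1
  beta_reduce
  abel

lemma SewingBound.congr {Ξ Ξ' : ℝ → ℝ → E} {a b K ℓ β : ℝ} (h : SewingBound Ξ a b K ℓ β)
    (e : ∀ s t, a ≤ s → s ≤ t → t ≤ b → Ξ' s t = Ξ s t) : SewingBound Ξ' a b K ℓ β := by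
  intro s u t h1 h2 h3 h4
  rw [e s t h1 (h2.trans h3) h4, e s u h1 h2 (h3.trans h4), e u t (h1.trans h2) h3 h4]
  exact h s u t h1 h2 h3 h4

/-- An additive function is a germ without defect, so the maximal inequality with K = 0 turns into
an identity; the scale 1 and exponent 2 are arbitrary. -/
lemma sum_eq_of_additive {F : ℝ → ℝ → E} {a b : ℝ}
    (h : ∀ s u t, a ≤ s → s ≤ u → u ≤ t → t ≤ b → F s u + F u t = F s t) {p : ℕ → ℝ}
    (hp : Monotone p) {n : ℕ} (ha : a ≤ p 0) (hb : p n ≤ b) :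
    ∑ k ∈ Finset.range n, F (p k) (p (k + 1)) = F (p 0) (p n) := by
  have hS : SewingBound F a b 0 1 2 := fun s u t h1 h2 h3 h4 => by
    rw [← h s u t h1 h2 h3 h4]
    simp
  have := hS.norm_sum_sub_le_const le_rfl one_pos one_lt_two n hp ha hb
  rw [zero_mul, mul_zero, norm_le_zero_iff, sub_eq_zero] at this
  exact this

/-- Bounds on a germ `Ξ s₁ t₁ s₂ t₂`, indexed by rectangles `[s₁, t₁] × [s₂, t₂]` contained in
`[a₁, b₁] × [a₂, b₂]`, and on its defects of additivity in each variable and in both. -/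
structure RectBound (Ξ : ℝ → ℝ → ℝ → ℝ → E) (a₁ b₁ a₂ b₂ K ℓ γ β : ℝ) : Prop where
  val : ∀ s₁ t₁ s₂ t₂, a₁ ≤ s₁ → s₁ ≤ t₁ → t₁ ≤ b₁ → a₂ ≤ s₂ → s₂ ≤ t₂ → t₂ ≤ b₂ →
    ‖Ξ s₁ t₁ s₂ t₂‖ ≤ K * ((t₁ - s₁) / ℓ) ^ γ * ((t₂ - s₂) / ℓ) ^ γ
  fst : ∀ s₂ t₂, a₂ ≤ s₂ → s₂ ≤ t₂ → t₂ ≤ b₂ →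
    SewingBound (fun x y => Ξ x y s₂ t₂) a₁ b₁ (K * ((t₂ - s₂) / ℓ) ^ γ) ℓ β
  snd : ∀ s₁ t₁, a₁ ≤ s₁ → s₁ ≤ t₁ → t₁ ≤ b₁ →
    SewingBound (fun x y => Ξ s₁ t₁ x y) a₂ b₂ (K * ((t₁ - s₁) / ℓ) ^ γ) ℓ β
  both : ∀ s₂ u₂ t₂, a₂ ≤ s₂ → s₂ ≤ u₂ → u₂ ≤ t₂ → t₂ ≤ b₂ →
    SewingBound (fun x y => Ξ x y s₂ t₂ - Ξ x y s₂ u₂ - Ξ x y u₂ t₂) a₁ b₁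
      (K * ((t₂ - s₂) / ℓ) ^ β) ℓ β

lemma RectBound.mono {Ξ : ℝ → ℝ → ℝ → ℝ → E} {a₁ b₁ a₂ b₂ a₁' b₁' a₂' b₂' K ℓ γ β : ℝ}
    (h : RectBound Ξ a₁ b₁ a₂ b₂ K ℓ γ β) (h1 : a₁ ≤ a₁') (h2 : b₁' ≤ b₁) (h3 : a₂ ≤ a₂')
    (h4 : b₂' ≤ b₂) : RectBound Ξ a₁' b₁' a₂' b₂' K ℓ γ β where
  val s₁ t₁ s₂ t₂ e1 e2 e3 e4 e5 e6 :=
    h.val s₁ t₁ s₂ t₂ (h1.trans e1) e2 (e3.trans h2) (h3.trans e4) e5 (e6.trans h4)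
  fst s₂ t₂ e1 e2 e3 := (h.fst s₂ t₂ (h3.trans e1) e2 (e3.trans h4)).mono h1 h2
  snd s₁ t₁ e1 e2 e3 := (h.snd s₁ t₁ (h1.trans e1) e2 (e3.trans h2)).mono h3 h4
  both s₂ u₂ t₂ e1 e2 e3 e4 := (h.both s₂ u₂ t₂ (h3.trans e1) e2 e3 (e4.trans h4)).mono h1 h2

lemma RectBound.sub {Ξ Ξ' : ℝ → ℝ → ℝ → ℝ → E} {a₁ b₁ a₂ b₂ K K' ℓ γ β : ℝ}
    (h : RectBound Ξ a₁ b₁ a₂ b₂ K ℓ γ β) (h' : RectBound Ξ' a₁ b₁ a₂ b₂ K' ℓ γ β) :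
    RectBound (fun s₁ t₁ s₂ t₂ => Ξ s₁ t₁ s₂ t₂ - Ξ' s₁ t₁ s₂ t₂) a₁ b₁ a₂ b₂ (K + K') ℓ γ β where
  val s₁ t₁ s₂ t₂ e1 e2 e3 e4 e5 e6 := by
    rw [add_mul, add_mul]
    exact (norm_sub_le _ _).trans (add_le_add (h.val s₁ t₁ s₂ t₂ e1 e2 e3 e4 e5 e6)
      (h'.val s₁ t₁ s₂ t₂ e1 e2 e3 e4 e5 e6))
  fst s₂ t₂ e1 e2 e3 := by
    rw [add_mul]
    exact (h.fst s₂ t₂ e1 e2 e3).sub (h'.fst s₂ t₂ e1 e2 e3)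
  snd s₁ t₁ e1 e2 e3 := by
    rw [add_mul]
    exact (h.snd s₁ t₁ e1 e2 e3).sub (h'.snd s₁ t₁ e1 e2 e3)
  both s₂ u₂ t₂ e1 e2 e3 e4 := by
    rw [add_mul]
    exact ((h.both s₂ u₂ t₂ e1 e2 e3 e4).sub (h'.both s₂ u₂ t₂ e1 e2 e3 e4)).congr
      fun _ _ _ _ _ => by abel

/-! ### Iterated sewing -/

/-- Sewing in the first variable. -/
noncomputable def sewFst (T : ℝ) (Ξ : ℝ → ℝ → ℝ → ℝ → E) (s₁ t₁ s₂ t₂ : ℝ) : E :=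
  sew T (fun x y => Ξ x y s₂ t₂) s₁ t₁

/-- Sewing in both variables. -/
noncomputable def sewRect (T : ℝ) (Ξ : ℝ → ℝ → ℝ → ℝ → E) (s₁ t₁ s₂ t₂ : ℝ) : E :=
  sew T (fun x y => sewFst T Ξ s₁ t₁ x y) s₂ t₂

variable [CompleteSpace E] {Ξ Ξ' : ℝ → ℝ → ℝ → ℝ → E} {T a₁ b₁ a₂ b₂ K K' ℓ γ β u : ℝ}

lemma RectBound.norm_sewFst_sub_le (h : RectBound Ξ a₁ b₁ a₂ b₂ K ℓ γ β) (h0 : 0 ≤ a₁)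
    (h1 : a₁ ≤ b₁) (h2 : b₁ ≤ T) (hK : 0 ≤ K) (hℓ : 0 < ℓ) (hβ : 1 < β) {s₂ t₂ : ℝ}
    (e1 : a₂ ≤ s₂) (e2 : s₂ ≤ t₂) (e3 : t₂ ≤ b₂) :
    ‖sewFst T Ξ a₁ b₁ s₂ t₂ - Ξ a₁ b₁ s₂ t₂‖ ≤
      sewingConst β * (K * ((t₂ - s₂) / ℓ) ^ γ * ((b₁ - a₁) / ℓ) ^ β) := by
  have hp : 0 ≤ (t₂ - s₂) / ℓ := div_nonneg (sub_nonneg.2 e2) hℓ.le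
  exact (h.fst s₂ t₂ e1 e2 e3).norm_sew_sub_le h0 h1 h2 (by positivity) hℓ hβ

lemma RectBound.sewFst_add (h : RectBound Ξ a₁ b₁ a₂ b₂ K ℓ γ β) (h0 : 0 ≤ a₁)
    (h1 : a₁ ≤ u) (h1' : u ≤ b₁) (h2 : b₁ ≤ T) (hK : 0 ≤ K) (hℓ : 0 < ℓ) (hβ : 1 < β) {s₂ t₂ : ℝ}
    (e1 : a₂ ≤ s₂) (e2 : s₂ ≤ t₂) (e3 : t₂ ≤ b₂) :
    sewFst T Ξ a₁ u s₂ t₂ + sewFst T Ξ u b₁ s₂ t₂ = sewFst T Ξ a₁ b₁ s₂ t₂ := by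
  have hp : 0 ≤ (t₂ - s₂) / ℓ := div_nonneg (sub_nonneg.2 e2) hℓ.le
  exact (h.fst s₂ t₂ e1 e2 e3).sew_add_sew h0 h1 h1' h2 (by positivity) hℓ hβ

lemma RectBound.tendsto_sewFst (h : RectBound Ξ a₁ b₁ a₂ b₂ K ℓ γ β) (h0 : 0 ≤ a₁)
    (h1 : a₁ ≤ b₁) (h2 : b₁ ≤ T) (hK : 0 ≤ K) (hℓ : 0 < ℓ) (hβ : 1 < β) {s₂ t₂ : ℝ}
    (e1 : a₂ ≤ s₂) (e2 : s₂ ≤ t₂) (e3 : t₂ ≤ b₂) :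
    Tendsto (gridSum T (fun x y => Ξ x y s₂ t₂) a₁ b₁) atTop (𝓝 (sewFst T Ξ a₁ b₁ s₂ t₂)) := by
  have hp : 0 ≤ (t₂ - s₂) / ℓ := div_nonneg (sub_nonneg.2 e2) hℓ.le
  exact (h.fst s₂ t₂ e1 e2 e3).tendsto_gridSum h0 h1 h2 (by positivity) hℓ hβ

/-- Sewing is linear, so the defect in the second variable of the sewn germ is the sewing of the
defect, to which `RectBound.both` applies. The bound has the power β in both variables. -/
lemma RectBound.sewingBound_sewFst_sub (h : RectBound Ξ a₁ b₁ a₂ b₂ K ℓ γ β) (h0 : 0 ≤ a₁)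
    (h1 : a₁ ≤ b₁) (h2 : b₁ ≤ T) (hK : 0 ≤ K) (hℓ : 0 < ℓ) (hβ : 1 < β) :
    SewingBound (fun x y => sewFst T Ξ a₁ b₁ x y - Ξ a₁ b₁ x y) a₂ b₂
      (sewingConst β * (K * ((b₁ - a₁) / ℓ) ^ β)) ℓ β := by
  intro s u t e1 e2 e3 e4
  have hp : 0 ≤ (t - s) / ℓ := div_nonneg (by linarith) hℓ.le
  have hb := (h.both s u t e1 e2 e3 e4).norm_sew_sub_le h0 h1 h2 (by positivity) hℓ hβ
  have hl := ((h.tendsto_sewFst h0 h1 h2 hK hℓ hβ e1 (e2.trans e3) e4).sub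
    (h.tendsto_sewFst h0 h1 h2 hK hℓ hβ e1 e2 (e3.trans e4))).sub
    (h.tendsto_sewFst h0 h1 h2 hK hℓ hβ (e1.trans e2) e3 e4)
  have hl' := (h.both s u t e1 e2 e3 e4).tendsto_gridSum h0 h1 h2 (by positivity) hℓ hβ
  simp_rw [← gridSum_sub] at hl
  rw [← tendsto_nhds_unique hl hl'] at hb
  refine le_trans (le_of_eq ?_) (hb.trans (le_of_eq ?_))
  · congr 1
    beta_reduce
    abel
  · ring

/-- Adding back the defect of `Ξ` itself, controlled by `RectBound.snd`, shows that a second sewing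
is possible. -/
lemma RectBound.sewingBound_sewFst (h : RectBound Ξ a₁ b₁ a₂ b₂ K ℓ γ β) (h0 : 0 ≤ a₁)
    (h1 : a₁ ≤ b₁) (h2 : b₁ ≤ T) (hK : 0 ≤ K) (hℓ : 0 < ℓ) (hβ : 1 < β) :
    SewingBound (fun x y => sewFst T Ξ a₁ b₁ x y) a₂ b₂
      (K * (sewingConst β * ((b₁ - a₁) / ℓ) ^ β + ((b₁ - a₁) / ℓ) ^ γ)) ℓ β := by
  intro s u t e1 e2 e3 e4
  have e := add_le_add (h.sewingBound_sewFst_sub h0 h1 h2 hK hℓ hβ s u t e1 e2 e3 e4)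
    (h.snd a₁ b₁ le_rfl h1 le_rfl s u t e1 e2 e3 e4)
  refine le_trans (le_of_eq ?_) ((norm_add_le _ _).trans (e.trans (le_of_eq ?_)))
  · congr 1
    beta_reduce
    abel
  · ring

lemma RectBound.norm_sewRect_sub_le (h : RectBound Ξ a₁ b₁ a₂ b₂ K ℓ γ β) (h0 : 0 ≤ a₁)
    (h1 : a₁ ≤ b₁) (h2 : b₁ ≤ T) (k0 : 0 ≤ a₂) (k1 : a₂ ≤ b₂) (k2 : b₂ ≤ T)
    (hK : 0 ≤ K) (hℓ : 0 < ℓ) (hβ : 1 < β) :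
    ‖sewRect T Ξ a₁ b₁ a₂ b₂ - sewFst T Ξ a₁ b₁ a₂ b₂‖ ≤ sewingConst β *
      (K * (sewingConst β * ((b₁ - a₁) / ℓ) ^ β + ((b₁ - a₁) / ℓ) ^ γ) * ((b₂ - a₂) / ℓ) ^ β) := by
  have hp : 0 ≤ (b₁ - a₁) / ℓ := div_nonneg (sub_nonneg.2 h1) hℓ.le
  have hC := sewingConst_nonneg β
  exact (h.sewingBound_sewFst h0 h1 h2 hK hℓ hβ).norm_sew_sub_le k0 k1 k2 (by positivity) hℓ hβ

lemma RectBound.sewRect_add_snd (h : RectBound Ξ a₁ b₁ a₂ b₂ K ℓ γ β) (h0 : 0 ≤ a₁)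
    (h1 : a₁ ≤ b₁) (h2 : b₁ ≤ T) (k0 : 0 ≤ a₂) (k1 : a₂ ≤ u) (k1' : u ≤ b₂) (k2 : b₂ ≤ T)
    (hK : 0 ≤ K) (hℓ : 0 < ℓ) (hβ : 1 < β) :
    sewRect T Ξ a₁ b₁ a₂ u + sewRect T Ξ a₁ b₁ u b₂ = sewRect T Ξ a₁ b₁ a₂ b₂ := by
  have hp : 0 ≤ (b₁ - a₁) / ℓ := div_nonneg (sub_nonneg.2 h1) hℓ.le
  have hC := sewingConst_nonneg β
  exact (h.sewingBound_sewFst h0 h1 h2 hK hℓ hβ).sew_add_sew k0 k1 k1' k2 (by positivity) hℓ hβ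

lemma RectBound.tendsto_sewRect (h : RectBound Ξ a₁ b₁ a₂ b₂ K ℓ γ β) (h0 : 0 ≤ a₁)
    (h1 : a₁ ≤ b₁) (h2 : b₁ ≤ T) (k0 : 0 ≤ a₂) (k1 : a₂ ≤ b₂) (k2 : b₂ ≤ T)
    (hK : 0 ≤ K) (hℓ : 0 < ℓ) (hβ : 1 < β) :
    Tendsto (gridSum T (fun x y => sewFst T Ξ a₁ b₁ x y) a₂ b₂) atTop
      (𝓝 (sewRect T Ξ a₁ b₁ a₂ b₂)) := by
  have hp : 0 ≤ (b₁ - a₁) / ℓ := div_nonneg (sub_nonneg.2 h1) hℓ.le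
  have hC := sewingConst_nonneg β
  exact (h.sewingBound_sewFst h0 h1 h2 hK hℓ hβ).tendsto_gridSum k0 k1 k2 (by positivity) hℓ hβ

/-- The outer sewing runs in the second variable, so additivity in the first is inherited from
`sewFst` on each cell and passes to the limit. -/
lemma RectBound.sewRect_add_fst (h : RectBound Ξ a₁ b₁ a₂ b₂ K ℓ γ β) (h0 : 0 ≤ a₁)
    (h1 : a₁ ≤ u) (h1' : u ≤ b₁) (h2 : b₁ ≤ T) (k0 : 0 ≤ a₂) (k1 : a₂ ≤ b₂) (k2 : b₂ ≤ T)
    (hK : 0 ≤ K) (hℓ : 0 < ℓ) (hβ : 1 < β) :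
    sewRect T Ξ a₁ u a₂ b₂ + sewRect T Ξ u b₁ a₂ b₂ = sewRect T Ξ a₁ b₁ a₂ b₂ := by
  have l1 := (h.mono le_rfl h1' le_rfl le_rfl).tendsto_sewRect h0 h1 (h1'.trans h2) k0 k1 k2
    hK hℓ hβ
  have l2 := (h.mono h1 le_rfl le_rfl le_rfl).tendsto_sewRect (h0.trans h1) h1' h2 k0 k1 k2
    hK hℓ hβ
  have l3 := h.tendsto_sewRect h0 (h1.trans h1') h2 k0 k1 k2 hK hℓ hβ
  have l4 := l3.sub l1
  simp_rw [← gridSum_sub] at l4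
  have e : gridSum T (fun x y => sewFst T Ξ a₁ b₁ x y - sewFst T Ξ a₁ u x y) a₂ b₂ =
      gridSum T (fun x y => sewFst T Ξ u b₁ x y) a₂ b₂ :=
    gridSum_congr (by linarith) k1 fun x y e1 e2 e3 => by
      rw [← h.sewFst_add h0 h1 h1' h2 hK hℓ hβ e1 e2 e3, add_sub_cancel_left]
  have l5 := tendsto_nhds_unique (l4.congr fun n => congrFun e n) l2
  rw [← l5, add_sub_cancel]

/-- Linearity, through both limits; it lets the difference of two Young integrals be estimated by
bounds on the difference of the germs. -/
lemma RectBound.sewRect_sub (h : RectBound Ξ a₁ b₁ a₂ b₂ K ℓ γ β)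
    (h' : RectBound Ξ' a₁ b₁ a₂ b₂ K' ℓ γ β) (h0 : 0 ≤ a₁)
    (h1 : a₁ ≤ b₁) (h2 : b₁ ≤ T) (k0 : 0 ≤ a₂) (k1 : a₂ ≤ b₂) (k2 : b₂ ≤ T)
    (hK : 0 ≤ K) (hK' : 0 ≤ K') (hℓ : 0 < ℓ) (hβ : 1 < β) :
    sewRect T (fun s₁ t₁ s₂ t₂ => Ξ s₁ t₁ s₂ t₂ - Ξ' s₁ t₁ s₂ t₂) a₁ b₁ a₂ b₂ =
      sewRect T Ξ a₁ b₁ a₂ b₂ - sewRect T Ξ' a₁ b₁ a₂ b₂ := by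
  have hs := h.sub h'
  have l1 := h.tendsto_sewRect h0 h1 h2 k0 k1 k2 hK hℓ hβ
  have l2 := h'.tendsto_sewRect h0 h1 h2 k0 k1 k2 hK' hℓ hβ
  have l3 := hs.tendsto_sewRect h0 h1 h2 k0 k1 k2 (add_nonneg hK hK') hℓ hβ
  have l4 := l1.sub l2
  simp_rw [← gridSum_sub] at l4
  refine tendsto_nhds_unique l3 (l4.congr fun n => congrFun ?_ n)
  refine gridSum_congr (by linarith) k1 fun x y e1 e2 e3 => ?_
  have m1 := h.tendsto_sewFst h0 h1 h2 hK hℓ hβ e1 e2 e3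
  have m2 := h'.tendsto_sewFst h0 h1 h2 hK' hℓ hβ e1 e2 e3
  have m3 := hs.tendsto_sewFst h0 h1 h2 (add_nonneg hK hK') hℓ hβ e1 e2 e3
  have m4 := m1.sub m2
  simp_rw [← gridSum_sub] at m4
  exact tendsto_nhds_unique m4 m3

/-- For sides at most ℓ the powers β are dominated by powers γ. With C = `sewingConst β`, the germ
and the two sewing errors add up to 1 + C + C(C + 1) = (1 + C)². -/
lemma RectBound.norm_sewRect_le (h : RectBound Ξ a₁ b₁ a₂ b₂ K ℓ γ β) (h0 : 0 ≤ a₁)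
    (h1 : a₁ ≤ b₁) (h2 : b₁ ≤ T) (k0 : 0 ≤ a₂) (k1 : a₂ ≤ b₂) (k2 : b₂ ≤ T)
    (hK : 0 ≤ K) (hℓ : 0 < ℓ) (hβ : 1 < β) (hγβ : γ ≤ β)
    (h3 : b₁ - a₁ ≤ ℓ) (k3 : b₂ - a₂ ≤ ℓ) :
    ‖sewRect T Ξ a₁ b₁ a₂ b₂‖ ≤
      (1 + sewingConst β) ^ 2 * K * ((b₁ - a₁) / ℓ) ^ γ * ((b₂ - a₂) / ℓ) ^ γ := by
  have A1 := h.val a₁ b₁ a₂ b₂ le_rfl h1 le_rfl le_rfl k1 le_rfl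
  have A2 := h.norm_sewFst_sub_le h0 h1 h2 hK hℓ hβ le_rfl k1 le_rfl
  have A3 := h.norm_sewRect_sub_le h0 h1 h2 k0 k1 k2 hK hℓ hβ
  have hC := sewingConst_nonneg β
  have hp : 0 ≤ (b₁ - a₁) / ℓ := div_nonneg (sub_nonneg.2 h1) hℓ.le
  have hq : 0 ≤ (b₂ - a₂) / ℓ := div_nonneg (sub_nonneg.2 k1) hℓ.le
  have hp1 : (b₁ - a₁) / ℓ ≤ 1 := (div_le_one hℓ).2 h3
  have hq1 : (b₂ - a₂) / ℓ ≤ 1 := (div_le_one hℓ).2 k3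
  have B1 : ((b₁ - a₁) / ℓ) ^ β ≤ ((b₁ - a₁) / ℓ) ^ γ := by
    rcases hp.eq_or_lt with e | e
    · rw [← e, Real.zero_rpow (by linarith)]
      exact Real.rpow_nonneg le_rfl _
    · exact Real.rpow_le_rpow_of_exponent_ge e hp1 hγβ
  have B2 : ((b₂ - a₂) / ℓ) ^ β ≤ ((b₂ - a₂) / ℓ) ^ γ := by
    rcases hq.eq_or_lt with e | e
    · rw [← e, Real.zero_rpow (by linarith)]
      exact Real.rpow_nonneg le_rfl _
    · exact Real.rpow_le_rpow_of_exponent_ge e hq1 hγβ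
  set x := ((b₁ - a₁) / ℓ) ^ γ
  set y := ((b₂ - a₂) / ℓ) ^ γ
  have hx : 0 ≤ x := by positivity
  have hy : 0 ≤ y := by positivity
  have A2' : ‖sewFst T Ξ a₁ b₁ a₂ b₂ - Ξ a₁ b₁ a₂ b₂‖ ≤ sewingConst β * (K * y * x) :=
    A2.trans (by gcongr)
  have A3' : ‖sewRect T Ξ a₁ b₁ a₂ b₂ - sewFst T Ξ a₁ b₁ a₂ b₂‖ ≤
      sewingConst β * (K * (sewingConst β * x + x) * y) :=
    A3.trans (by gcongr)
  have e : sewRect T Ξ a₁ b₁ a₂ b₂ = (sewRect T Ξ a₁ b₁ a₂ b₂ - sewFst T Ξ a₁ b₁ a₂ b₂) +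
      (sewFst T Ξ a₁ b₁ a₂ b₂ - Ξ a₁ b₁ a₂ b₂) + Ξ a₁ b₁ a₂ b₂ := by abel
  rw [e]
  refine (norm_add₃_le).trans ((add_le_add (add_le_add A3' A2') A1).trans (le_of_eq ?_))
  ring

/-- Riemann sums over product partitions converge to the sewing. -/
lemma RectBound.norm_riemannSum_sub_le (h : RectBound Ξ a₁ b₁ a₂ b₂ K ℓ γ β) (h0 : 0 ≤ a₁)
    (h1 : a₁ ≤ b₁) (h2 : b₁ ≤ T) (k0 : 0 ≤ a₂) (k1 : a₂ ≤ b₂) (k2 : b₂ ≤ T)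
    (hK : 0 ≤ K) (hℓ : 0 < ℓ) (hβ : 1 < β) {p q : ℕ → ℝ} (hp : Monotone p) (hq : Monotone q)
    {n m : ℕ} (hp0 : p 0 = a₁) (hpn : p n = b₁) (hq0 : q 0 = a₂) (hqm : q m = b₂) {δ : ℝ}
    (hpδ : ∀ i < n, p (i + 1) - p i ≤ δ) (hqδ : ∀ i < m, q (i + 1) - q i ≤ δ) :
    ‖∑ i ∈ Finset.range n, ∑ j ∈ Finset.range m, Ξ (p i) (p (i + 1)) (q j) (q (j + 1)) -
      sewRect T Ξ a₁ b₁ a₂ b₂‖ ≤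
      (sewingConst β * (K * (sewingConst β * ((b₂ - a₂) / ℓ) ^ β + ((b₂ - a₂) / ℓ) ^ γ)) *
          ((b₁ - a₁) / ℓ)
        + sewingConst β * (K * (sewingConst β * ((b₁ - a₁) / ℓ) ^ β + ((b₁ - a₁) / ℓ) ^ γ)) *
          ((b₂ - a₂) / ℓ)) * (δ / ℓ) ^ (β - 1) := by
  have hC := sewingConst_nonneg β
  have hx : 0 ≤ (b₁ - a₁) / ℓ := div_nonneg (sub_nonneg.2 h1) hℓ.le
  have hy : 0 ≤ (b₂ - a₂) / ℓ := div_nonneg (sub_nonneg.2 k1) hℓ.le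
  have pa : ∀ i, a₁ ≤ p i := fun i => hp0 ▸ hp (Nat.zero_le i)
  have qa : ∀ j, a₂ ≤ q j := fun j => hq0 ▸ hq (Nat.zero_le j)
  have pb : ∀ i < n, p (i + 1) ≤ b₁ := fun i hi => hpn ▸ hp hi
  have qb : ∀ j < m, q (j + 1) ≤ b₂ := fun j hj => hqm ▸ hq hj
  have S1 : ∑ i ∈ Finset.range n, ((p (i + 1) - p i) / ℓ) ^ β ≤
      (δ / ℓ) ^ (β - 1) * ((b₁ - a₁) / ℓ) := by
    rw [← hp0, ← hpn]
    exact sum_rpow_increments_le hp hℓ hβ hpδ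
  have S2 : ∑ i ∈ Finset.range m, ((q (i + 1) - q i) / ℓ) ^ β ≤
      (δ / ℓ) ^ (β - 1) * ((b₂ - a₂) / ℓ) := by
    rw [← hq0, ← hqm]
    exact sum_rpow_increments_le hq hℓ hβ hqδ
  -- In a fixed row the error of the first sewing is itself a germ in the second variable. The
  -- maximal inequality bounds its sum over j independently of the number of columns, keeping the
  -- power β of the row width.
  have R1 : ∀ i ∈ Finset.range n, ‖∑ j ∈ Finset.range m, (sewFst T Ξ (p i) (p (i + 1)) (q j)
      (q (j + 1)) - Ξ (p i) (p (i + 1)) (q j) (q (j + 1)))‖ ≤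
      sewingConst β * (K * (sewingConst β * ((b₂ - a₂) / ℓ) ^ β + ((b₂ - a₂) / ℓ) ^ γ)) *
        ((p (i + 1) - p i) / ℓ) ^ β := by
    intro i hi
    have hi := Finset.mem_range.1 hi
    have hi' : 0 ≤ (p (i + 1) - p i) / ℓ := div_nonneg (sub_nonneg.2 (hp (Nat.le_succ i))) hℓ.le
    have hm := h.mono (pa i) (pb i hi) le_rfl le_rfl
    have B1 := (hm.sewingBound_sewFst_sub (h0.trans (pa i)) (hp (Nat.le_succ i))
      ((pb i hi).trans h2) hK hℓ hβ).norm_sum_sub_le_const (by positivity) hℓ hβ m hq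
      hq0.ge hqm.le
    have B2 := hm.norm_sewFst_sub_le (h0.trans (pa i)) (hp (Nat.le_succ i))
      ((pb i hi).trans h2) hK hℓ hβ le_rfl k1 le_rfl
    rw [hq0, hqm] at B1
    have := (norm_le_norm_sub_add _ _).trans (add_le_add B1 B2)
    refine this.trans (le_of_eq ?_)
    ring
  -- Once the first variable is sewn over the whole side, only the error of the second sewing is
  -- left, of order β in the column width.
  have R2 : ∀ j ∈ Finset.range m, ‖sewRect T Ξ a₁ b₁ (q j) (q (j + 1)) -
      sewFst T Ξ a₁ b₁ (q j) (q (j + 1))‖ ≤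
      sewingConst β * (K * (sewingConst β * ((b₁ - a₁) / ℓ) ^ β + ((b₁ - a₁) / ℓ) ^ γ)) *
        ((q (j + 1) - q j) / ℓ) ^ β := by
    intro j hj
    have hj := Finset.mem_range.1 hj
    refine ((h.mono le_rfl le_rfl (qa j) (qb j hj)).norm_sewRect_sub_le h0 h1 h2
      (k0.trans (qa j)) (hq (Nat.le_succ j)) ((qb j hj).trans k2) hK hℓ hβ).trans (le_of_eq ?_)
    ring
  have E1 : ∀ j ∈ Finset.range m, ∑ i ∈ Finset.range n,
      sewFst T Ξ (p i) (p (i + 1)) (q j) (q (j + 1)) = sewFst T Ξ a₁ b₁ (q j) (q (j + 1)) := by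
    intro j hj
    have hj := Finset.mem_range.1 hj
    have := sum_eq_of_additive (F := fun x y => sewFst T Ξ x y (q j) (q (j + 1))) (a := a₁) (b := b₁)
      (fun s u t f1 f2 f3 f4 => (h.mono f1 f4 le_rfl le_rfl).sewFst_add (h0.trans f1) f2 f3
        (f4.trans h2) hK hℓ hβ (qa j) (hq (Nat.le_succ j)) (qb j hj)) hp hp0.ge hpn.le
    rw [hp0, hpn] at this
    exact this
  have E2 : ∑ j ∈ Finset.range m, sewRect T Ξ a₁ b₁ (q j) (q (j + 1)) =
      sewRect T Ξ a₁ b₁ a₂ b₂ := by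
    have := sum_eq_of_additive (F := fun x y => sewRect T Ξ a₁ b₁ x y) (a := a₂) (b := b₂)
      (fun s u t f1 f2 f3 f4 => (h.mono le_rfl le_rfl f1 f4).sewRect_add_snd h0 h1 h2
        (k0.trans f1) f2 f3 (f4.trans k2) hK hℓ hβ) hq hq0.ge hqm.le
    rw [hq0, hqm] at this
    exact this
  have E3 : ∑ i ∈ Finset.range n, ∑ j ∈ Finset.range m,
      sewFst T Ξ (p i) (p (i + 1)) (q j) (q (j + 1)) =
      ∑ j ∈ Finset.range m, sewFst T Ξ a₁ b₁ (q j) (q (j + 1)) := by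
    rw [Finset.sum_comm]
    exact Finset.sum_congr rfl E1
  have key : ∑ i ∈ Finset.range n, ∑ j ∈ Finset.range m, Ξ (p i) (p (i + 1)) (q j) (q (j + 1)) -
      sewRect T Ξ a₁ b₁ a₂ b₂ =
      -(∑ i ∈ Finset.range n, ∑ j ∈ Finset.range m, (sewFst T Ξ (p i) (p (i + 1)) (q j)
      (q (j + 1)) - Ξ (p i) (p (i + 1)) (q j) (q (j + 1)))) -
      ∑ j ∈ Finset.range m, (sewRect T Ξ a₁ b₁ (q j) (q (j + 1)) -
        sewFst T Ξ a₁ b₁ (q j) (q (j + 1))) := by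
    simp only [Finset.sum_sub_distrib]
    rw [E2, E3]
    abel
  rw [key]
  refine (norm_sub_le _ _).trans ?_
  rw [norm_neg]
  have N1 := (norm_sum_le _ _).trans (Finset.sum_le_sum R1)
  have N2 := (norm_sum_le _ _).trans (Finset.sum_le_sum R2)
  rw [← Finset.mul_sum] at N1 N2
  have N1' := N1.trans (mul_le_mul_of_nonneg_left S1 (by positivity))
  have N2' := N2.trans (mul_le_mul_of_nonneg_left S2 (by positivity))
  refine (add_le_add N1' N2').trans (le_of_eq ?_)
  ring

end RectSewing

/-! ### Finite differences of Hölder functions -/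

section Space

variable {d : ℕ} {κ m : ℝ} {f : Rd d → Rd d}

lemma norm_sub_le_of_fderiv_le {E F : Type*} [NormedAddCommGroup E] [NormedSpace ℝ E]
    [NormedAddCommGroup F] [NormedSpace ℝ F] {g : E → F} (hg : Differentiable ℝ g) {C : ℝ}
    (h : ∀ x, ‖fderiv ℝ g x‖ ≤ C) (x p : E) : ‖g (x + p) - g x‖ ≤ C * ‖p‖ := by
  have := (convex_univ (𝕜 := ℝ) (E := E)).norm_image_sub_le_of_norm_fderiv_le
    (fun y _ => hg y) (fun y _ => h y) (mem_univ x) (mem_univ (x + p))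
  rwa [add_sub_cancel_left] at this

lemma differentiable_shift {E F : Type*} [NormedAddCommGroup E] [NormedSpace ℝ E]
    [NormedAddCommGroup F] [NormedSpace ℝ F] {g : E → F} (hg : Differentiable ℝ g) (q : E) :
    Differentiable ℝ fun x => g (x + q) - g x := by
  fun_prop

lemma fderiv_shift {E F : Type*} [NormedAddCommGroup E] [NormedSpace ℝ E]
    [NormedAddCommGroup F] [NormedSpace ℝ F] {g : E → F} (hg : Differentiable ℝ g) (q x : E) :
    fderiv ℝ (fun x => g (x + q) - g x) x = fderiv ℝ g (x + q) - fderiv ℝ g x := by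
  rw [fderiv_fun_sub (by fun_prop) (hg x), fderiv_comp_add_right]

lemma HolderNormLE.nonneg (h : HolderNormLE 2 κ f m) : 0 ≤ m :=
  (norm_nonneg _).trans (h.2.1 0 (by norm_num) 0)

lemma HolderNormLE.norm_le {k : ℕ} (h : HolderNormLE k κ f m) (x : Rd d) : ‖f x‖ ≤ m := by
  have := h.2.1 0 (by norm_num) x
  rwa [norm_iteratedFDeriv_zero] at this

lemma HolderNormLE.differentiable (h : HolderNormLE 2 κ f m) : Differentiable ℝ f :=
  h.1.differentiable (by norm_num)

lemma HolderNormLE.differentiable_fderiv (h : HolderNormLE 2 κ f m) :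
    Differentiable ℝ (fderiv ℝ f) :=
  (h.1.fderiv_right (m := 1) (by norm_num)).differentiable (by norm_num)

lemma HolderNormLE.norm_fderiv_le (h : HolderNormLE 2 κ f m) (x : Rd d) :
    ‖fderiv ℝ f x‖ ≤ m := by
  have := h.2.1 1 (by norm_num) x
  rwa [norm_iteratedFDeriv_one] at this

lemma HolderNormLE.norm_fderiv_fderiv_le (h : HolderNormLE 2 κ f m) (x : Rd d) :
    ‖fderiv ℝ (fderiv ℝ f) x‖ ≤ m := by
  refine ContinuousLinearMap.opNorm_le_bound _ h.nonneg fun v => ?_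
  refine ContinuousLinearMap.opNorm_le_bound _ (mul_nonneg h.nonneg (norm_nonneg _)) fun w => ?_
  have h1 := (iteratedFDeriv ℝ 2 f x).le_opNorm ![v, w]
  rw [iteratedFDeriv_two_apply] at h1
  simp only [Matrix.cons_val_zero, Matrix.cons_val_one, Fin.prod_univ_two] at h1
  refine h1.trans ?_
  rw [mul_assoc]
  exact mul_le_mul_of_nonneg_right (h.2.1 2 le_rfl x) (by positivity)

lemma HolderNormLE.norm_fderiv_fderiv_sub_le (h : HolderNormLE 2 κ f m) (x q : Rd d) :
    ‖fderiv ℝ (fderiv ℝ f) (x + q) - fderiv ℝ (fderiv ℝ f) x‖ ≤ m * ‖q‖ ^ κ := by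
  have hm := h.nonneg
  refine ContinuousLinearMap.opNorm_le_bound _ (by positivity) fun v => ?_
  refine ContinuousLinearMap.opNorm_le_bound _ (by positivity) fun w => ?_
  have h1 := (iteratedFDeriv ℝ 2 f (x + q) - iteratedFDeriv ℝ 2 f x).le_opNorm ![v, w]
  rw [sub_apply, iteratedFDeriv_two_apply, iteratedFDeriv_two_apply] at h1
  simp only [Matrix.cons_val_zero, Matrix.cons_val_one, Fin.prod_univ_two] at h1
  refine h1.trans ?_
  rw [mul_assoc]
  have := h.2.2 (x + q) x
  rw [add_sub_cancel_left] at this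
  exact mul_le_mul_of_nonneg_right this (by positivity)

lemma HolderNormLE.norm_diff_le (h : HolderNormLE 2 κ f m) (x p : Rd d) :
    ‖f (x + p) - f x‖ ≤ m * ‖p‖ :=
  norm_sub_le_of_fderiv_le h.differentiable h.norm_fderiv_le x p

lemma HolderNormLE.norm_diff_two_le (h : HolderNormLE 2 κ f m) (x p q : Rd d) :
    ‖(f (x + p + q) - f (x + p)) - (f (x + q) - f x)‖ ≤ m * ‖q‖ * ‖p‖ := by
  refine norm_sub_le_of_fderiv_le (differentiable_shift h.differentiable q) (fun y => ?_) x p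
  rw [fderiv_shift h.differentiable]
  exact norm_sub_le_of_fderiv_le h.differentiable_fderiv h.norm_fderiv_fderiv_le y q

/-- Two mean value steps reduce the third difference to an increment of the second derivative, for
which only the power κ of ‖q‖ is available. -/
lemma HolderNormLE.norm_diff_three_le (h : HolderNormLE 2 κ f m) (x p q r : Rd d) :
    ‖((f (x + p + r + q) - f (x + p + r)) - (f (x + p + q) - f (x + p))) -
      ((f (x + r + q) - f (x + r)) - (f (x + q) - f x))‖ ≤ m * ‖q‖ ^ κ * ‖r‖ * ‖p‖ := by
  have hg := differentiable_shift h.differentiable q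
  have hg' : Differentiable ℝ fun x => fderiv ℝ f (x + q) - fderiv ℝ f x :=
    differentiable_shift h.differentiable_fderiv q
  refine norm_sub_le_of_fderiv_le (differentiable_shift hg r) (fun y => ?_) x p
  rw [fderiv_shift hg, fderiv_shift h.differentiable, fderiv_shift h.differentiable]
  refine norm_sub_le_of_fderiv_le hg' (fun w => ?_) y r
  rw [fderiv_shift h.differentiable_fderiv]
  exact h.norm_fderiv_fderiv_sub_le w q

/-- Stability of first differences. -/
lemma HolderNormLE.norm_diff_sub_diff_le (h : HolderNormLE 2 κ f m) (x y p p' : Rd d) :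
    ‖(f (x + p) - f x) - (f (y + p') - f y)‖ ≤ m * (‖p‖ * ‖x - y‖ + ‖p - p'‖) := by
  have h1 := h.norm_diff_two_le y (x - y) p
  have h2 := h.norm_diff_le (y + p') (p - p')
  have e1 : y + (x - y) = x := by abel
  have e2 : y + p' + (p - p') = y + p := by abel
  rw [e1] at h1
  rw [e2] at h2
  have e : (f (x + p) - f x) - (f (y + p') - f y) =
      ((f (x + p) - f x) - (f (y + p) - f y)) + (f (y + p) - f (y + p')) := by abel
  rw [e]
  refine (norm_add_le _ _).trans ((add_le_add h1 h2).trans (le_of_eq ?_))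
  ring

/-- Stability of second differences. -/
lemma HolderNormLE.norm_diff_two_sub_diff_two_le (h : HolderNormLE 2 κ f m)
    (x y p p' q q' : Rd d) :
    ‖((f (x + p + q) - f (x + p)) - (f (x + q) - f x)) -
      ((f (y + p' + q') - f (y + p')) - (f (y + q') - f y))‖ ≤
      m * (‖p‖ * ‖q‖ ^ κ * ‖x - y‖ + ‖p - p'‖ * ‖q‖ + ‖p'‖ * ‖q - q'‖) := by
  have h1 := h.norm_diff_three_le y (x - y) q p
  have h2 := h.norm_diff_two_le (y + p') (p - p') q
  have h3 := h.norm_diff_two_le (y + q') p' (q - q')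
  have e1 : y + (x - y) = x := by abel
  have e2 : y + p' + (p - p') = y + p := by abel
  have e3 : y + q' + p' + (q - q') = y + p' + q := by abel
  have e4 : y + q' + (q - q') = y + q := by abel
  have e5 : y + q' + p' = y + p' + q' := by abel
  rw [e1] at h1
  rw [e2] at h2
  rw [e3, e4, e5] at h3
  have e : ((f (x + p + q) - f (x + p)) - (f (x + q) - f x)) -
      ((f (y + p' + q') - f (y + p')) - (f (y + q') - f y)) =
      (((f (x + p + q) - f (x + p)) - (f (x + q) - f x)) -
        ((f (y + p + q) - f (y + p)) - (f (y + q) - f y))) +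
      ((f (y + p + q) - f (y + p)) - (f (y + p' + q) - f (y + p'))) +
      ((f (y + p' + q) - f (y + p' + q')) - (f (y + q) - f (y + q'))) := by abel
  rw [e]
  refine norm_add₃_le.trans ((add_le_add (add_le_add h1 h2) h3).trans (le_of_eq ?_))
  ring

end Space

/-! ### The germ of the nonlinear Young integral -/

section Germ

variable {d : ℕ} {A : ℝ → ℝ → Rd d → Rd d} {T M γ κ ℓ L Z a₁ b₁ a₂ b₂ : ℝ} {θ η : ℝ → Rd d}

/-- The germ `□_{s,t} A(θ_{s₂} - θ_{s₁})` of the nonlinear Young integral. -/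
def youngGerm (A : ℝ → ℝ → Rd d → Rd d) (θ : ℝ → Rd d) (s₁ t₁ s₂ t₂ : ℝ) : Rd d :=
  boxIncrement A s₁ s₂ t₁ t₂ (θ s₂ - θ s₁)

/-- Bounds for the rectangular increments of `A` in `C_b^{2+κ}`. -/
def BoxHolder (A : ℝ → ℝ → Rd d → Rd d) (T M γ κ : ℝ) : Prop :=
  ∀ s₁ t₁ s₂ t₂, 0 ≤ s₁ → s₁ ≤ t₁ → t₁ ≤ T → 0 ≤ s₂ → s₂ ≤ t₂ → t₂ ≤ T →
    HolderNormLE 2 κ (boxIncrement A s₁ s₂ t₁ t₂) (M * ((t₁ - s₁) ^ γ * (t₂ - s₂) ^ γ))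

/-- `θ` is `γ`-Hölder continuous on `[a, b]` with constant `L` on the time scale `ℓ`. -/
def ScaledHolder (θ : ℝ → Rd d) (a b L ℓ γ : ℝ) : Prop :=
  ∀ r r', a ≤ r → r ≤ r' → r' ≤ b → ‖θ r' - θ r‖ ≤ L * ((r' - r) / ℓ) ^ γ

lemma ScaledHolder.mono {a b a' b' : ℝ} (h : ScaledHolder θ a b L ℓ γ) (ha : a ≤ a')
    (hb : b' ≤ b) : ScaledHolder θ a' b' L ℓ γ :=
  fun r r' h1 h2 h3 => h r r' (ha.trans h1) h2 (h3.trans hb)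

/-- Box increments are additive at a fixed space point, so only the change of evaluation point on
the subrectangle starting at u₁ survives. -/
lemma youngGerm_defect_fst (A : ℝ → ℝ → Rd d → Rd d) (θ : ℝ → Rd d) (s₁ u₁ t₁ s₂ t₂ : ℝ) :
    youngGerm A θ s₁ t₁ s₂ t₂ - youngGerm A θ s₁ u₁ s₂ t₂ - youngGerm A θ u₁ t₁ s₂ t₂ =
      -(boxIncrement A u₁ s₂ t₁ t₂ (θ s₂ - θ s₁ + (θ s₁ - θ u₁))
        - boxIncrement A u₁ s₂ t₁ t₂ (θ s₂ - θ s₁)) := by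
  have e : θ s₂ - θ s₁ + (θ s₁ - θ u₁) = θ s₂ - θ u₁ := by abel
  rw [e]
  simp only [youngGerm, boxIncrement]
  abel

lemma youngGerm_defect_snd (A : ℝ → ℝ → Rd d → Rd d) (θ : ℝ → Rd d) (s₁ t₁ s₂ u₂ t₂ : ℝ) :
    youngGerm A θ s₁ t₁ s₂ t₂ - youngGerm A θ s₁ t₁ s₂ u₂ - youngGerm A θ s₁ t₁ u₂ t₂ =
      -(boxIncrement A s₁ u₂ t₁ t₂ (θ s₂ - θ s₁ + (θ u₂ - θ s₂))
        - boxIncrement A s₁ u₂ t₁ t₂ (θ s₂ - θ s₁)) := by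
  have e : θ s₂ - θ s₁ + (θ u₂ - θ s₂) = θ u₂ - θ s₁ := by abel
  rw [e]
  simp only [youngGerm, boxIncrement]
  abel

/-- The shifts caused by u₁ and by u₂ combine to a second difference, which is small in both
variables at once. -/
lemma youngGerm_defect_both (A : ℝ → ℝ → Rd d → Rd d) (θ : ℝ → Rd d) (s₁ u₁ t₁ s₂ u₂ t₂ : ℝ) :
    (youngGerm A θ s₁ t₁ s₂ t₂ - youngGerm A θ s₁ t₁ s₂ u₂ - youngGerm A θ s₁ t₁ u₂ t₂)
      - (youngGerm A θ s₁ u₁ s₂ t₂ - youngGerm A θ s₁ u₁ s₂ u₂ - youngGerm A θ s₁ u₁ u₂ t₂)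
      - (youngGerm A θ u₁ t₁ s₂ t₂ - youngGerm A θ u₁ t₁ s₂ u₂ - youngGerm A θ u₁ t₁ u₂ t₂) =
      (boxIncrement A u₁ u₂ t₁ t₂ (θ s₂ - θ s₁ + (θ s₁ - θ u₁) + (θ u₂ - θ s₂))
        - boxIncrement A u₁ u₂ t₁ t₂ (θ s₂ - θ s₁ + (θ s₁ - θ u₁)))
      - (boxIncrement A u₁ u₂ t₁ t₂ (θ s₂ - θ s₁ + (θ u₂ - θ s₂))
        - boxIncrement A u₁ u₂ t₁ t₂ (θ s₂ - θ s₁)) := by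
  have e : θ s₂ - θ s₁ + (θ s₁ - θ u₁) = θ s₂ - θ u₁ := by abel
  have e' : θ s₂ - θ s₁ + (θ u₂ - θ s₂) = θ u₂ - θ s₁ := by abel
  have e'' : θ s₂ - θ u₁ + (θ u₂ - θ s₂) = θ u₂ - θ u₁ := by abel
  rw [e, e', e'']
  simp only [youngGerm, boxIncrement]
  abel

lemma rpow_eq_scaled {x : ℝ} (hx : 0 ≤ x) (hℓ : 0 < ℓ) (γ : ℝ) : x ^ γ = ℓ ^ γ * (x / ℓ) ^ γ := by
  rw [← Real.mul_rpow hℓ.le (div_nonneg hx hℓ.le), mul_div_cancel₀ _ hℓ.ne']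

lemma box_size_le {x x' y y' : ℝ} (hM : 0 ≤ M) (hγ : 0 ≤ γ) (hℓ : 0 < ℓ) (hx : 0 ≤ x)
    (hxx : x ≤ x') (hy : 0 ≤ y) (hyy : y ≤ y') :
    M * (x ^ γ * y ^ γ) ≤ M * (ℓ ^ γ) ^ 2 * ((x' / ℓ) ^ γ * (y' / ℓ) ^ γ) := by
  have h1 := Real.rpow_le_rpow hx hxx hγ
  have h2 := Real.rpow_le_rpow hy hyy hγ
  have h0 := Real.rpow_nonneg hy γ
  calc M * (x ^ γ * y ^ γ) ≤ M * (x' ^ γ * y' ^ γ) := by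
        have := Real.rpow_nonneg (hx.trans hxx) γ
        gcongr
    _ = _ := by
        rw [rpow_eq_scaled (hx.trans hxx) hℓ, rpow_eq_scaled (hy.trans hyy) hℓ]
        ring

/-- This is why time is measured in units of ℓ: for ratios at most 1 the exponent 2γ may be lowered
to β. -/
lemma scaled_rpow_sq_le {x β : ℝ} (hx : 0 ≤ x) (hx1 : x ≤ 1) (hγ : 0 < γ)
    (hβγ : β ≤ 2 * γ) : x ^ γ * x ^ γ ≤ x ^ β := by
  rw [← Real.rpow_add_of_nonneg hx hγ.le hγ.le]
  rcases hx.eq_or_lt with e | e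
  · rw [← e, Real.zero_rpow (by linarith)]
    exact Real.rpow_nonneg le_rfl _
  · exact Real.rpow_le_rpow_of_exponent_ge e hx1 (by linarith)

/-- The origin of the exponent γ(1 + κ): the time regularity of A times the κ-th power of an
increment of θ. -/
lemma scaled_rpow_mul_rpow {x : ℝ} (hx : 0 ≤ x) (hγ : 0 < γ) (hκ : 0 < κ) :
    x ^ γ * (x ^ γ) ^ κ = x ^ (γ * (1 + κ)) := by
  rw [← Real.rpow_mul hx, ← Real.rpow_add_of_nonneg hx hγ.le (by positivity)]
  congr 1
  ring

lemma scaled_mono {x x' : ℝ} (hℓ : 0 < ℓ) (hγ : 0 < γ) (hx : 0 ≤ x) (hxx : x ≤ x') :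
    (x / ℓ) ^ γ ≤ (x' / ℓ) ^ γ :=
  Real.rpow_le_rpow (div_nonneg hx hℓ.le) (div_le_div_of_nonneg_right hxx hℓ.le) hγ.le

/-- The germ, its one-variable defects and its mixed defect carry the factors 1, L and L², all at
most (1 + L)². -/
lemma BoxHolder.rectBound (hA : BoxHolder A T M γ κ) (hM : 0 ≤ M) (hγ : 0 < γ) (hκ : 0 < κ)
    (hκ1 : κ < 1) (hℓ : 0 < ℓ) (hL : 0 ≤ L) (h0 : 0 ≤ a₁) (h1 : b₁ ≤ T) (h2 : b₁ - a₁ ≤ ℓ)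
    (k0 : 0 ≤ a₂) (k1 : b₂ ≤ T) (k2 : b₂ - a₂ ≤ ℓ) (hθ₁ : ScaledHolder θ a₁ b₁ L ℓ γ)
    (hθ₂ : ScaledHolder θ a₂ b₂ L ℓ γ) :
    RectBound (youngGerm A θ) a₁ b₁ a₂ b₂ (M * (ℓ ^ γ) ^ 2 * (1 + L) ^ 2) ℓ γ
      (γ * (1 + κ)) := by
  set N := M * (ℓ ^ γ) ^ 2 with hN
  have hN0 : 0 ≤ N := by positivity
  have hβγ : γ * (1 + κ) ≤ 2 * γ := by nlinarith
  have bound : ∀ {x x' y y' c C : ℝ}, 0 ≤ x → x ≤ x' → 0 ≤ y → y ≤ y' → 0 ≤ c → c ≤ C →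
      M * (x ^ γ * y ^ γ) * c ≤ N * ((x' / ℓ) ^ γ * (y' / ℓ) ^ γ) * C := by
    intro x x' y y' c C hx hxx hy hyy hc hcC
    have hx' := div_nonneg (hx.trans hxx) hℓ.le
    have hy' := div_nonneg (hy.trans hyy) hℓ.le
    exact mul_le_mul (box_size_le hM hγ.le hℓ hx hxx hy hyy) hcC hc (by positivity)
  refine ⟨?_, ?_, ?_, ?_⟩
  · intro s₁ t₁ s₂ t₂ e1 e2 e3 e4 e5 e6
    have hx : 0 ≤ (t₁ - s₁) / ℓ := div_nonneg (by linarith) hℓ.le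
    have hy : 0 ≤ (t₂ - s₂) / ℓ := div_nonneg (by linarith) hℓ.le
    have := (hA s₁ t₁ s₂ t₂ (h0.trans e1) e2 (e3.trans h1) (k0.trans e4) e5 (e6.trans k1)).norm_le
      (θ s₂ - θ s₁)
    have b := bound (sub_nonneg.2 e2) le_rfl (sub_nonneg.2 e5) le_rfl zero_le_one
      (show 1 ≤ (1 + L) ^ 2 by nlinarith)
    rw [mul_one] at b
    refine this.trans (b.trans (le_of_eq ?_))
    ring
  · intro s₂ t₂ e4 e5 e6 s₁ u₁ t₁ e1 e2 e2' e3
    have hx : 0 ≤ (t₁ - s₁) / ℓ := div_nonneg (by linarith) hℓ.le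
    have hy : 0 ≤ (t₂ - s₂) / ℓ := div_nonneg (by linarith) hℓ.le
    have hx1 : (t₁ - s₁) / ℓ ≤ 1 := (div_le_one hℓ).2 (by linarith)
    beta_reduce
    rw [youngGerm_defect_fst, norm_neg]
    refine ((hA u₁ t₁ s₂ t₂ (by linarith) e2' (by linarith) (by linarith) e5
      (by linarith)).norm_diff_le _ _).trans ?_
    have hp : ‖θ s₁ - θ u₁‖ ≤ L * ((t₁ - s₁) / ℓ) ^ γ := by
      rw [norm_sub_rev]
      exact (hθ₁ s₁ u₁ e1 e2 (by linarith)).trans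
        (mul_le_mul_of_nonneg_left (scaled_mono hℓ hγ (by linarith) (by linarith)) hL)
    refine (bound (sub_nonneg.2 e2') (show _ ≤ t₁ - s₁ by linarith) (sub_nonneg.2 e5) le_rfl (norm_nonneg _)
      hp).trans ?_
    calc _ = N * L * ((t₂ - s₂) / ℓ) ^ γ * (((t₁ - s₁) / ℓ) ^ γ * ((t₁ - s₁) / ℓ) ^ γ) := by ring
      _ ≤ N * (1 + L) ^ 2 * ((t₂ - s₂) / ℓ) ^ γ * ((t₁ - s₁) / ℓ) ^ (γ * (1 + κ)) := by
        have := scaled_rpow_sq_le hx hx1 hγ hβγ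
        gcongr
        nlinarith
  · intro s₁ t₁ e1 e2 e3 s₂ u₂ t₂ e4 e5 e5' e6
    have hx : 0 ≤ (t₁ - s₁) / ℓ := div_nonneg (by linarith) hℓ.le
    have hy : 0 ≤ (t₂ - s₂) / ℓ := div_nonneg (by linarith) hℓ.le
    have hy1 : (t₂ - s₂) / ℓ ≤ 1 := (div_le_one hℓ).2 (by linarith)
    beta_reduce
    rw [youngGerm_defect_snd, norm_neg]
    refine ((hA s₁ t₁ u₂ t₂ (by linarith) e2 (by linarith) (by linarith) e5'
      (by linarith)).norm_diff_le _ _).trans ?_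
    have hp : ‖θ u₂ - θ s₂‖ ≤ L * ((t₂ - s₂) / ℓ) ^ γ :=
      (hθ₂ s₂ u₂ e4 e5 (by linarith)).trans
        (mul_le_mul_of_nonneg_left (scaled_mono hℓ hγ (by linarith) (by linarith)) hL)
    refine (bound (sub_nonneg.2 e2) le_rfl (sub_nonneg.2 e5') (show _ ≤ t₂ - s₂ by linarith) (norm_nonneg _)
      hp).trans ?_
    calc _ = N * L * ((t₁ - s₁) / ℓ) ^ γ * (((t₂ - s₂) / ℓ) ^ γ * ((t₂ - s₂) / ℓ) ^ γ) := by ring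
      _ ≤ N * (1 + L) ^ 2 * ((t₁ - s₁) / ℓ) ^ γ * ((t₂ - s₂) / ℓ) ^ (γ * (1 + κ)) := by
        have := scaled_rpow_sq_le hy hy1 hγ hβγ
        gcongr
        nlinarith
  · intro s₂ u₂ t₂ e4 e5 e5' e6 s₁ u₁ t₁ e1 e2 e2' e3
    have hx : 0 ≤ (t₁ - s₁) / ℓ := div_nonneg (by linarith) hℓ.le
    have hy : 0 ≤ (t₂ - s₂) / ℓ := div_nonneg (by linarith) hℓ.le
    have hx1 : (t₁ - s₁) / ℓ ≤ 1 := (div_le_one hℓ).2 (by linarith)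
    have hy1 : (t₂ - s₂) / ℓ ≤ 1 := (div_le_one hℓ).2 (by linarith)
    beta_reduce
    rw [youngGerm_defect_both]
    refine ((hA u₁ t₁ u₂ t₂ (by linarith) e2' (by linarith) (by linarith) e5'
      (by linarith)).norm_diff_two_le _ _ _).trans ?_
    have hp : ‖θ s₁ - θ u₁‖ ≤ L * ((t₁ - s₁) / ℓ) ^ γ := by
      rw [norm_sub_rev]
      exact (hθ₁ s₁ u₁ e1 e2 (by linarith)).trans
        (mul_le_mul_of_nonneg_left (scaled_mono hℓ hγ (by linarith) (by linarith)) hL)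
    have hq : ‖θ u₂ - θ s₂‖ ≤ L * ((t₂ - s₂) / ℓ) ^ γ :=
      (hθ₂ s₂ u₂ e4 e5 (by linarith)).trans
        (mul_le_mul_of_nonneg_left (scaled_mono hℓ hγ (by linarith) (by linarith)) hL)
    rw [mul_assoc]
    refine (bound (sub_nonneg.2 e2') (show _ ≤ t₁ - s₁ by linarith) (sub_nonneg.2 e5')
      (show _ ≤ t₂ - s₂ by linarith)
      (by positivity) (mul_le_mul hq hp (norm_nonneg _) (by positivity))).trans ?_
    have hx2 := scaled_rpow_sq_le hx hx1 hγ hβγ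
    have hy2 := scaled_rpow_sq_le hy hy1 hγ hβγ
    have hx3 : 0 ≤ ((t₁ - s₁) / ℓ) ^ γ * ((t₁ - s₁) / ℓ) ^ γ := by positivity
    have hy3 : 0 ≤ ((t₂ - s₂) / ℓ) ^ γ * ((t₂ - s₂) / ℓ) ^ γ := by positivity
    calc _ = N * L ^ 2 * (((t₂ - s₂) / ℓ) ^ γ * ((t₂ - s₂) / ℓ) ^ γ) *
          (((t₁ - s₁) / ℓ) ^ γ * ((t₁ - s₁) / ℓ) ^ γ) := by ring
      _ ≤ N * (1 + L) ^ 2 * ((t₂ - s₂) / ℓ) ^ (γ * (1 + κ)) *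
          ((t₁ - s₁) / ℓ) ^ (γ * (1 + κ)) := by
        gcongr
        linarith

/-- Linearity in the size Z of θ - η is what makes the solution map contractive. Exchanging the base
point costs 2Z and each exchanged increment costs Z: 3Z for the one-variable defects and 4Z for the
mixed one. -/
lemma BoxHolder.rectBound_sub (hA : BoxHolder A T M γ κ) (hM : 0 ≤ M) (hγ : 0 < γ) (hκ : 0 < κ)
    (hκ1 : κ < 1) (hℓ : 0 < ℓ) (hZ : 0 ≤ Z) (h0 : 0 ≤ a₁) (h1 : b₁ ≤ T) (h2 : b₁ - a₁ ≤ ℓ)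
    (k0 : 0 ≤ a₂) (k1 : b₂ ≤ T) (k2 : b₂ - a₂ ≤ ℓ)
    (hθ₁ : ScaledHolder θ a₁ b₁ 1 ℓ γ) (hθ₂ : ScaledHolder θ a₂ b₂ 1 ℓ γ)
    (hη₁ : ScaledHolder η a₁ b₁ 1 ℓ γ)
    (hζ₁ : ScaledHolder (fun r => θ r - η r) a₁ b₁ Z ℓ γ)
    (hζ₂ : ScaledHolder (fun r => θ r - η r) a₂ b₂ Z ℓ γ)
    (hZ₁ : ∀ r, a₁ ≤ r → r ≤ b₁ → ‖θ r - η r‖ ≤ Z) (hZ₂ : ∀ r, a₂ ≤ r → r ≤ b₂ → ‖θ r - η r‖ ≤ Z) :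
    RectBound (fun s₁ t₁ s₂ t₂ => youngGerm A θ s₁ t₁ s₂ t₂ - youngGerm A η s₁ t₁ s₂ t₂)
      a₁ b₁ a₂ b₂ (M * (ℓ ^ γ) ^ 2 * (4 * Z)) ℓ γ (γ * (1 + κ)) := by
  set N := M * (ℓ ^ γ) ^ 2 with hN
  have hN0 : 0 ≤ N := by positivity
  have hβγ : γ * (1 + κ) ≤ 2 * γ := by nlinarith
  have bound : ∀ {x x' y y' c C : ℝ}, 0 ≤ x → x ≤ x' → 0 ≤ y → y ≤ y' → 0 ≤ c → c ≤ C →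
      M * (x ^ γ * y ^ γ) * c ≤ N * ((x' / ℓ) ^ γ * (y' / ℓ) ^ γ) * C := by
    intro x x' y y' c C hx hxx hy hyy hc hcC
    have hx' := div_nonneg (hx.trans hxx) hℓ.le
    have hy' := div_nonneg (hy.trans hyy) hℓ.le
    exact mul_le_mul (box_size_le hM hγ.le hℓ hx hxx hy hyy) hcC hc (by positivity)
  have dist_le : ∀ {s₁ s₂ : ℝ}, a₁ ≤ s₁ → s₁ ≤ b₁ → a₂ ≤ s₂ → s₂ ≤ b₂ →
      ‖(θ s₂ - θ s₁) - (η s₂ - η s₁)‖ ≤ 2 * Z := by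
    intro s₁ s₂ e1 e2 e3 e4
    have : (θ s₂ - θ s₁) - (η s₂ - η s₁) = (θ s₂ - η s₂) - (θ s₁ - η s₁) := by abel
    rw [this, two_mul]
    exact (norm_sub_le _ _).trans (add_le_add (hZ₂ s₂ e3 e4) (hZ₁ s₁ e1 e2))
  have inc : ∀ {φ : ℝ → Rd d} {a b C s u t : ℝ}, 0 ≤ C → ScaledHolder φ a b C ℓ γ → a ≤ s →
      s ≤ u → u ≤ t → t ≤ b → ‖φ u - φ s‖ ≤ C * ((t - s) / ℓ) ^ γ :=
    fun hC h e1 e2 e3 e4 => (h _ _ e1 e2 (e3.trans e4)).trans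
      (mul_le_mul_of_nonneg_left (scaled_mono hℓ hγ (by linarith) (by linarith)) hC)
  refine ⟨?_, ?_, ?_, ?_⟩
  · intro s₁ t₁ s₂ t₂ e1 e2 e3 e4 e5 e6
    have hx : 0 ≤ (t₁ - s₁) / ℓ := div_nonneg (by linarith) hℓ.le
    have hy : 0 ≤ (t₂ - s₂) / ℓ := div_nonneg (by linarith) hℓ.le
    have := (hA s₁ t₁ s₂ t₂ (h0.trans e1) e2 (e3.trans h1) (k0.trans e4) e5
      (e6.trans k1)).norm_diff_le (η s₂ - η s₁) ((θ s₂ - θ s₁) - (η s₂ - η s₁))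
    rw [add_sub_cancel] at this
    have b := bound (sub_nonneg.2 e2) le_rfl (sub_nonneg.2 e5) le_rfl (norm_nonneg _)
      ((dist_le e1 (e2.trans e3) e4 (e5.trans e6)).trans (show 2 * Z ≤ 4 * Z by linarith))
    refine this.trans (b.trans (le_of_eq ?_))
    ring
  · intro s₂ t₂ e4 e5 e6 s₁ u₁ t₁ e1 e2 e2' e3
    have hx : 0 ≤ (t₁ - s₁) / ℓ := div_nonneg (by linarith) hℓ.le
    have hy : 0 ≤ (t₂ - s₂) / ℓ := div_nonneg (by linarith) hℓ.le
    have hx1 : (t₁ - s₁) / ℓ ≤ 1 := (div_le_one hℓ).2 (by linarith)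
    have hx2 := scaled_rpow_sq_le hx hx1 hγ hβγ
    have hs := (hA u₁ t₁ s₂ t₂ (by linarith) e2' (by linarith) (by linarith) e5
      (by linarith)).norm_diff_sub_diff_le (θ s₂ - θ s₁) (η s₂ - η s₁) (θ s₁ - θ u₁) (η s₁ - η u₁)
    have hp := inc zero_le_one hθ₁ e1 e2 e2' e3
    have hpp := inc hZ hζ₁ e1 e2 e2' e3
    have hd := dist_le e1 (show s₁ ≤ b₁ by linarith) e4 (show s₂ ≤ b₂ by linarith)
    rw [norm_sub_rev] at hp
    have e' : (θ u₁ - η u₁) - (θ s₁ - η s₁) = -((θ s₁ - θ u₁) - (η s₁ - η u₁)) := by abel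
    rw [e', norm_neg] at hpp
    have e : (youngGerm A θ s₁ t₁ s₂ t₂ - youngGerm A η s₁ t₁ s₂ t₂) -
        (youngGerm A θ s₁ u₁ s₂ t₂ - youngGerm A η s₁ u₁ s₂ t₂) -
        (youngGerm A θ u₁ t₁ s₂ t₂ - youngGerm A η u₁ t₁ s₂ t₂) =
        (youngGerm A θ s₁ t₁ s₂ t₂ - youngGerm A θ s₁ u₁ s₂ t₂ - youngGerm A θ u₁ t₁ s₂ t₂) -
        (youngGerm A η s₁ t₁ s₂ t₂ - youngGerm A η s₁ u₁ s₂ t₂ - youngGerm A η u₁ t₁ s₂ t₂) := by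
      abel
    beta_reduce
    rw [e, youngGerm_defect_fst, youngGerm_defect_fst, ← neg_sub', norm_neg]
    refine hs.trans ((bound (sub_nonneg.2 e2') (show _ ≤ t₁ - s₁ by linarith) (sub_nonneg.2 e5)
      le_rfl (by positivity) (add_le_add (mul_le_mul hp hd (norm_nonneg _) (by positivity))
        hpp)).trans ?_)
    calc _ = N * (3 * Z) * ((t₂ - s₂) / ℓ) ^ γ *
          (((t₁ - s₁) / ℓ) ^ γ * ((t₁ - s₁) / ℓ) ^ γ) := by ring
      _ ≤ N * (4 * Z) * ((t₂ - s₂) / ℓ) ^ γ * ((t₁ - s₁) / ℓ) ^ (γ * (1 + κ)) := by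
        gcongr
        norm_num
  · intro s₁ t₁ e1 e2 e3 s₂ u₂ t₂ e4 e5 e5' e6
    have hx : 0 ≤ (t₁ - s₁) / ℓ := div_nonneg (by linarith) hℓ.le
    have hy : 0 ≤ (t₂ - s₂) / ℓ := div_nonneg (by linarith) hℓ.le
    have hy1 : (t₂ - s₂) / ℓ ≤ 1 := (div_le_one hℓ).2 (by linarith)
    have hy2 := scaled_rpow_sq_le hy hy1 hγ hβγ
    have hs := (hA s₁ t₁ u₂ t₂ (by linarith) e2 (by linarith) (by linarith) e5'
      (by linarith)).norm_diff_sub_diff_le (θ s₂ - θ s₁) (η s₂ - η s₁) (θ u₂ - θ s₂) (η u₂ - η s₂)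
    have hp := inc zero_le_one hθ₂ e4 e5 e5' e6
    have hpp := inc hZ hζ₂ e4 e5 e5' e6
    have hd := dist_le e1 (show s₁ ≤ b₁ by linarith) e4 (show s₂ ≤ b₂ by linarith)
    have e' : (θ u₂ - η u₂) - (θ s₂ - η s₂) = (θ u₂ - θ s₂) - (η u₂ - η s₂) := by abel
    rw [e'] at hpp
    have e : (youngGerm A θ s₁ t₁ s₂ t₂ - youngGerm A η s₁ t₁ s₂ t₂) -
        (youngGerm A θ s₁ t₁ s₂ u₂ - youngGerm A η s₁ t₁ s₂ u₂) -
        (youngGerm A θ s₁ t₁ u₂ t₂ - youngGerm A η s₁ t₁ u₂ t₂) =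
        (youngGerm A θ s₁ t₁ s₂ t₂ - youngGerm A θ s₁ t₁ s₂ u₂ - youngGerm A θ s₁ t₁ u₂ t₂) -
        (youngGerm A η s₁ t₁ s₂ t₂ - youngGerm A η s₁ t₁ s₂ u₂ - youngGerm A η s₁ t₁ u₂ t₂) := by
      abel
    beta_reduce
    rw [e, youngGerm_defect_snd, youngGerm_defect_snd, ← neg_sub', norm_neg]
    refine hs.trans ((bound (sub_nonneg.2 e2) le_rfl (sub_nonneg.2 e5')
      (show _ ≤ t₂ - s₂ by linarith) (by positivity)
      (add_le_add (mul_le_mul hp hd (norm_nonneg _) (by positivity)) hpp)).trans ?_)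
    calc _ = N * (3 * Z) * ((t₁ - s₁) / ℓ) ^ γ *
          (((t₂ - s₂) / ℓ) ^ γ * ((t₂ - s₂) / ℓ) ^ γ) := by ring
      _ ≤ N * (4 * Z) * ((t₁ - s₁) / ℓ) ^ γ * ((t₂ - s₂) / ℓ) ^ (γ * (1 + κ)) := by
        gcongr
        norm_num
  · intro s₂ u₂ t₂ e4 e5 e5' e6 s₁ u₁ t₁ e1 e2 e2' e3
    have hx : 0 ≤ (t₁ - s₁) / ℓ := div_nonneg (by linarith) hℓ.le
    have hy : 0 ≤ (t₂ - s₂) / ℓ := div_nonneg (by linarith) hℓ.le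
    have hx1 : (t₁ - s₁) / ℓ ≤ 1 := (div_le_one hℓ).2 (by linarith)
    have hy1 : (t₂ - s₂) / ℓ ≤ 1 := (div_le_one hℓ).2 (by linarith)
    have hx2 := scaled_rpow_sq_le hx hx1 hγ hβγ
    have hy2 := scaled_rpow_sq_le hy hy1 hγ hβγ
    have hy3 := scaled_rpow_mul_rpow hy hγ hκ
    have hs := (hA u₁ t₁ u₂ t₂ (by linarith) e2' (by linarith) (by linarith) e5'
      (by linarith)).norm_diff_two_sub_diff_two_le (θ s₂ - θ s₁) (η s₂ - η s₁) (θ s₁ - θ u₁)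
        (η s₁ - η u₁) (θ u₂ - θ s₂) (η u₂ - η s₂)
    have hp := inc zero_le_one hθ₁ e1 e2 e2' e3
    have hp' := inc zero_le_one hη₁ e1 e2 e2' e3
    have hpp := inc hZ hζ₁ e1 e2 e2' e3
    have hq := inc zero_le_one hθ₂ e4 e5 e5' e6
    have hqq := inc hZ hζ₂ e4 e5 e5' e6
    have hd := dist_le e1 (show s₁ ≤ b₁ by linarith) e4 (show s₂ ≤ b₂ by linarith)
    rw [norm_sub_rev] at hp hp'
    have e' : (θ u₁ - η u₁) - (θ s₁ - η s₁) = -((θ s₁ - θ u₁) - (η s₁ - η u₁)) := by abel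
    have e'' : (θ u₂ - η u₂) - (θ s₂ - η s₂) = (θ u₂ - θ s₂) - (η u₂ - η s₂) := by abel
    rw [e', norm_neg] at hpp
    rw [e''] at hqq
    -- The base-point term contains only the κ-th power of this increment, so in the second variable
    -- it has exactly the order γ(1 + κ).
    have hqκ : ‖θ u₂ - θ s₂‖ ^ κ ≤ (((t₂ - s₂) / ℓ) ^ γ) ^ κ :=
      Real.rpow_le_rpow (norm_nonneg _) (by rwa [one_mul] at hq) hκ.le
    rw [one_mul] at hp hp' hq
    beta_reduce
    have e : ∀ a b c a' b' c' a'' b'' c'' α β' δ α' β'' δ' α'' β''' δ'' : Rd d,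
        (a - α - (b - β') - (c - δ)) - (a' - α' - (b' - β'') - (c' - δ')) -
          (a'' - α'' - (b'' - β''') - (c'' - δ'')) =
        ((a - b - c) - (a' - b' - c') - (a'' - b'' - c'')) -
          ((α - β' - δ) - (α' - β'' - δ') - (α'' - β''' - δ'')) := by
      intros
      abel
    rw [e, youngGerm_defect_both, youngGerm_defect_both]
    have hsum : ‖θ s₁ - θ u₁‖ * ‖θ u₂ - θ s₂‖ ^ κ * ‖(θ s₂ - θ s₁) - (η s₂ - η s₁)‖ +
        ‖(θ s₁ - θ u₁) - (η s₁ - η u₁)‖ * ‖θ u₂ - θ s₂‖ +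
        ‖η s₁ - η u₁‖ * ‖(θ u₂ - θ s₂) - (η u₂ - η s₂)‖ ≤
        ((t₁ - s₁) / ℓ) ^ γ * (((t₂ - s₂) / ℓ) ^ γ) ^ κ * (2 * Z) +
        (Z * ((t₁ - s₁) / ℓ) ^ γ) * ((t₂ - s₂) / ℓ) ^ γ +
        ((t₁ - s₁) / ℓ) ^ γ * (Z * ((t₂ - s₂) / ℓ) ^ γ) := by
      gcongr
    refine hs.trans ((bound (sub_nonneg.2 e2') (show _ ≤ t₁ - s₁ by linarith)
      (sub_nonneg.2 e5') (show _ ≤ t₂ - s₂ by linarith) (by positivity) hsum).trans ?_)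
    have hx3 : 0 ≤ ((t₁ - s₁) / ℓ) ^ γ * ((t₁ - s₁) / ℓ) ^ γ := by positivity
    calc _ = N * ((2 * Z) * (((t₂ - s₂) / ℓ) ^ γ * (((t₂ - s₂) / ℓ) ^ γ) ^ κ) +
            (2 * Z) * (((t₂ - s₂) / ℓ) ^ γ * ((t₂ - s₂) / ℓ) ^ γ)) *
          (((t₁ - s₁) / ℓ) ^ γ * ((t₁ - s₁) / ℓ) ^ γ) := by ring
      _ ≤ N * ((2 * Z) * ((t₂ - s₂) / ℓ) ^ (γ * (1 + κ)) +
            (2 * Z) * ((t₂ - s₂) / ℓ) ^ (γ * (1 + κ))) *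
          ((t₁ - s₁) / ℓ) ^ (γ * (1 + κ)) := by
        rw [hy3]
        gcongr
      _ = _ := by ring

end Germ

/-! ### The nonlinear Young integral -/

section Integral

open Filter Topology

variable {d : ℕ} {A : ℝ → ℝ → Rd d → Rd d} {T M γ κ : ℝ} {θ : ℝ → Rd d}

/-- The uniform partition of `[0, t]` into `n` intervals. -/
noncomputable def uniformPartition {t : ℝ} (ht : 0 ≤ t) (n : ℕ) (hn : 0 < n) :
    IntervalPartition 0 t where
  n := n
  pts i := i * (t / n)
  mono i j hij := by
    have : (i : ℝ) ≤ j := by exact_mod_cast hij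
    show (i : ℝ) * (t / n) ≤ j * (t / n)
    gcongr
  first := by simp
  last := by
    have : (n : ℝ) ≠ 0 := by positivity
    field_simp

lemma exists_partition_meshLT {t : ℝ} (ht : 0 ≤ t) {δ : ℝ} (hδ : 0 < δ) :
    ∃ P : IntervalPartition 0 t, P.MeshLT δ := by
  obtain ⟨n, hn⟩ := exists_nat_gt (t / δ)
  have hn0 : (0 : ℝ) < n := (div_nonneg ht hδ.le).trans_lt hn
  refine ⟨uniformPartition ht n (by exact_mod_cast hn0), fun i _ => ?_⟩
  show ((i + 1 : ℕ) : ℝ) * (t / n) - i * (t / n) < δ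
  have : ((i + 1 : ℕ) : ℝ) * (t / n) - i * (t / n) = t / n := by
    push_cast
    ring
  rw [this, div_lt_iff₀ hn0, mul_comm]
  exact (div_lt_iff₀ hδ).1 hn

/-- Partitions of arbitrarily small mesh exist, so two limits can be tested on a common Riemann sum.
-/
lemma HasNonlinearYoungIntegral.unique {t₁ t₂ : ℝ} (ht₁ : 0 ≤ t₁) (ht₂ : 0 ≤ t₂) {I I' : Rd d}
    (h : HasNonlinearYoungIntegral A θ t₁ t₂ I) (h' : HasNonlinearYoungIntegral A θ t₁ t₂ I') :
    I = I' := by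
  by_contra hne
  have hε : 0 < ‖I - I'‖ / 2 := half_pos (norm_pos_iff.2 (sub_ne_zero.2 hne))
  obtain ⟨δ, hδ, H⟩ := h _ hε
  obtain ⟨δ', hδ', H'⟩ := h' _ hε
  obtain ⟨P, hP⟩ := exists_partition_meshLT ht₁ (lt_min hδ hδ')
  obtain ⟨Q, hQ⟩ := exists_partition_meshLT ht₂ (lt_min hδ hδ')
  have h1 := H P Q (fun i hi => (hP i hi).trans_le (min_le_left _ _))
    (fun i hi => (hQ i hi).trans_le (min_le_left _ _))
  have h2 := H' P Q (fun i hi => (hP i hi).trans_le (min_le_right _ _))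
    (fun i hi => (hQ i hi).trans_le (min_le_right _ _))
  have h3 : I - I' = (youngRiemannSum A θ P Q - I') - (youngRiemannSum A θ P Q - I) := by abel
  have h4 := norm_sub_le (youngRiemannSum A θ P Q - I') (youngRiemannSum A θ P Q - I)
  rw [← h3] at h4
  linarith

lemma RectBound.hasNonlinearYoungIntegral {K β : ℝ}
    (h : RectBound (youngGerm A θ) 0 T 0 T K T γ β) (hT : 0 < T) (hK : 0 ≤ K) (hβ : 1 < β)
    {t : ℝ} (ht : 0 ≤ t) (htT : t ≤ T) :
    HasNonlinearYoungIntegral A θ t t (sewRect T (youngGerm A θ) 0 t 0 t) := by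
  intro ε hε
  set c := sewingConst β * (K * (sewingConst β * ((t - 0) / T) ^ β + ((t - 0) / T) ^ γ)) *
          ((t - 0) / T)
        + sewingConst β * (K * (sewingConst β * ((t - 0) / T) ^ β + ((t - 0) / T) ^ γ)) *
          ((t - 0) / T) with hc
  have hlim : Tendsto (fun δ : ℝ => c * (δ / T) ^ (β - 1)) (𝓝 0) (𝓝 (c * (0 / T) ^ (β - 1))) := by
    have : ContinuousAt (fun δ : ℝ => c * (δ / T) ^ (β - 1)) 0 :=
      ((continuousAt_id.div_const T).rpow_const (Or.inr (by linarith))).const_mul c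
    exact this
  rw [zero_div, Real.zero_rpow (by linarith), mul_zero] at hlim
  have hev := (hlim.eventually_lt_const hε).filter_mono
    (nhdsWithin_le_nhds (s := Ioi (0 : ℝ)))
  obtain ⟨δ, hδ, hδ0⟩ := (hev.and self_mem_nhdsWithin).exists
  refine ⟨δ, hδ0, fun P Q hP hQ => lt_of_le_of_lt ?_ hδ⟩
  exact (h.mono le_rfl htT le_rfl htT).norm_riemannSum_sub_le le_rfl ht htT le_rfl ht htT hK hT hβ
    P.mono Q.mono P.first P.last Q.first Q.last (fun i hi => (hP i hi).le) (fun i hi => (hQ i hi).le)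

/-- The solution map of the nonlinear Young equation. -/
noncomputable def youngMap (T : ℝ) (A : ℝ → ℝ → Rd d → Rd d) (u₀ : Rd d) (θ : ℝ → Rd d)
    (t : ℝ) : Rd d :=
  u₀ + sewRect T (youngGerm A θ) 0 t 0 t

/-- The sewing is the only possible limit of the Riemann sums, so the equation becomes a fixed-point
identity for `youngMap`. -/
lemma RectBound.solves_iff {K β : ℝ}
    (h : RectBound (youngGerm A θ) 0 T 0 T K T γ β) (hT : 0 < T) (hK : 0 ≤ K) (hβ : 1 < β)
    (u₀ : Rd d) :
    SolvesYoungEquation T A u₀ θ ↔ ∀ t ∈ Icc 0 T, θ t = youngMap T A u₀ θ t := by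
  refine forall₂_congr fun t ht => ?_
  have hi := h.hasNonlinearYoungIntegral hT hK hβ ht.1 ht.2
  constructor
  · rintro ⟨I, hI, e⟩
    rw [e, youngMap, hI.unique ht.1 ht.1 hi]
  · intro e
    exact ⟨_, hi, e⟩

end Integral

/-! ### Windows of fixed length -/

section Windows

variable {d : ℕ} {T γ h : ℝ}

lemma norm_le_of_windows {E : Type*} [NormedAddCommGroup E] {F : ℝ → ℝ → E} {a₀ x B : ℝ}
    (hF : ∀ s u t, a₀ ≤ s → s ≤ u → u ≤ t → t ≤ x → F s u + F u t = F s t) (hB : 0 ≤ B)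
    (hh : 0 < h)
    (hbd : ∀ a b, a₀ ≤ a → a ≤ b → b ≤ x → b - a ≤ h → ‖F a b‖ ≤ B) (n : ℕ) :
    ∀ t, a₀ ≤ t → t ≤ x → t - a₀ ≤ n * h → ‖F a₀ t‖ ≤ n * B := by
  induction n with
  | zero =>
    intro t h1 h2 h3
    have ht : t = a₀ := by
      rw [Nat.cast_zero, zero_mul] at h3
      linarith
    subst ht
    have := hF t t t le_rfl le_rfl le_rfl h2
    have h0 : F t t = 0 := by simpa using this
    simp [h0]
  | succ n ih =>
    intro t h1 h2 h3
    have hn : (0 : ℝ) ≤ n * h := by positivity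
    push_cast at h3 ⊢
    rcases le_total (t - a₀) (n * h) with hle | hle
    · exact (ih t h1 h2 hle).trans (by linarith)
    · rw [← hF a₀ (a₀ + n * h) t le_rfl (by linarith) (by linarith) h2, add_mul, one_mul]
      refine (norm_add_le _ _).trans (add_le_add ?_ ?_)
      · exact ih _ (by linarith) (by linarith) (by linarith)
      · exact hbd _ _ (by linarith) (by linarith) h2 (by linarith)

/-- Increments of the diagonal of a sewn germ, estimated by cutting strips into windows. -/
lemma RectBound.norm_diagonal_increment_le {E : Type*} [NormedAddCommGroup E] [CompleteSpace E]
    {Ξ : ℝ → ℝ → ℝ → ℝ → E} {K₀ K β : ℝ} (hΞ : RectBound Ξ 0 T 0 T K₀ T γ β) (hT : 0 < T)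
    (hK₀ : 0 ≤ K₀) (hK : 0 ≤ K) (hβ : 1 < β) (hγ : 0 < γ) (hγβ : γ ≤ β) {n : ℕ} (hh : 0 < h)
    (hn : T ≤ n * h) {s t : ℝ} (hs : 0 ≤ s) (hst : s ≤ t) (ht : t ≤ T) (hsth : t - s ≤ h)
    (hloc : ∀ a₁ b₁ a₂ b₂, 0 ≤ a₁ → a₁ ≤ b₁ → b₁ ≤ t → b₁ - a₁ ≤ h → 0 ≤ a₂ → a₂ ≤ b₂ → b₂ ≤ t →
      b₂ - a₂ ≤ h → RectBound Ξ a₁ b₁ a₂ b₂ K h γ β) :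
    ‖sewRect T Ξ 0 t 0 t - sewRect T Ξ 0 s 0 s‖ ≤
      2 * n * ((1 + sewingConst β) ^ 2 * K) * ((t - s) / h) ^ γ := by
  have hx : 0 ≤ (t - s) / h := div_nonneg (sub_nonneg.2 hst) hh.le
  have hC := sewingConst_nonneg β
  -- The side of a window along the strip only contributes a factor at most 1; the smallness comes
  -- from the width t - s.
  have unit : ∀ {a b : ℝ}, a ≤ b → b - a ≤ h → ((b - a) / h) ^ γ ≤ 1 := fun h1 h2 =>
    Real.rpow_le_one (div_nonneg (sub_nonneg.2 h1) hh.le) ((div_le_one hh).2 h2) hγ.le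
  have hB : 0 ≤ (1 + sewingConst β) ^ 2 * K * ((t - s) / h) ^ γ := by positivity
  -- The square [0,t]² is [0,s]² together with the strips [s,t] × [0,t] and [0,s] × [s,t]. Each
  -- strip is covered by n windows, whence the factor 2n.
  have e1 : sewRect T Ξ 0 s 0 t + sewRect T Ξ s t 0 t = sewRect T Ξ 0 t 0 t :=
    (hΞ.mono le_rfl ht le_rfl ht).sewRect_add_fst le_rfl hs hst ht le_rfl (hs.trans hst) ht hK₀ hT hβ
  have e2 : sewRect T Ξ 0 s 0 s + sewRect T Ξ 0 s s t = sewRect T Ξ 0 s 0 t :=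
    (hΞ.mono le_rfl (hst.trans ht) le_rfl ht).sewRect_add_snd le_rfl hs (hst.trans ht) le_rfl hs
      hst ht hK₀ hT hβ
  have n1 : ‖sewRect T Ξ s t 0 t‖ ≤ n * ((1 + sewingConst β) ^ 2 * K * ((t - s) / h) ^ γ) := by
    refine norm_le_of_windows (F := fun a b => sewRect T Ξ s t a b) (a₀ := 0) (x := t)
      (fun a u b f1 f2 f3 f4 => ?_) hB hh (fun a b f1 f2 f3 f4 => ?_) n t (hs.trans hst) le_rfl
      (by linarith)
    · exact (hΞ.mono hs ht f1 (f4.trans ht)).sewRect_add_snd hs hst ht f1 f2 f3 (f4.trans ht)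
        hK₀ hT hβ
    · have := (hloc s t a b hs hst le_rfl hsth f1 f2 f3 f4).norm_sewRect_le hs hst ht f1 f2
        (f3.trans ht) hK hh hβ hγβ hsth f4
      exact this.trans (mul_le_of_le_one_right hB (unit f2 f4))
  have n2 : ‖sewRect T Ξ 0 s s t‖ ≤ n * ((1 + sewingConst β) ^ 2 * K * ((t - s) / h) ^ γ) := by
    refine norm_le_of_windows (F := fun a b => sewRect T Ξ a b s t) (a₀ := 0) (x := s)
      (fun a u b f1 f2 f3 f4 => ?_) hB hh (fun a b f1 f2 f3 f4 => ?_) n s hs le_rfl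
      (by linarith)
    · exact (hΞ.mono f1 ((f4.trans hst).trans ht) hs ht).sewRect_add_fst f1 f2 f3
        ((f4.trans hst).trans ht) hs hst ht hK₀ hT hβ
    · have := (hloc a b s t f1 f2 (f3.trans hst) f4 hs hst le_rfl hsth).norm_sewRect_le f1 f2
        ((f3.trans hst).trans ht) hs hst ht hK hh hβ hγβ f4 hsth
      refine this.trans ?_
      rw [mul_right_comm]
      exact mul_le_of_le_one_right hB (unit f2 f4)
  have e : sewRect T Ξ 0 t 0 t - sewRect T Ξ 0 s 0 s = sewRect T Ξ s t 0 t + sewRect T Ξ 0 s s t := by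
    rw [← e1, ← e2]
    abel
  rw [e]
  refine (norm_add_le _ _).trans ((add_le_add n1 n2).trans (le_of_eq ?_))
  ring

/-- `θ` has increments at most `((r' - r) / h) ^ γ` over intervals of length at most `h`. -/
def LocalHolder (θ : ℝ → Rd d) (T h γ : ℝ) : Prop :=
  ∀ r r', 0 ≤ r → r ≤ r' → r' ≤ T → r' - r ≤ h → ‖θ r' - θ r‖ ≤ ((r' - r) / h) ^ γ

lemma LocalHolder.scaledHolder {θ : ℝ → Rd d} (hθ : LocalHolder θ T h γ) {a b : ℝ} (ha : 0 ≤ a)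
    (hb : b ≤ T) (hab : b - a ≤ h) : ScaledHolder θ a b 1 h γ := by
  intro r r' h1 h2 h3
  rw [one_mul]
  exact hθ r r' (ha.trans h1) h2 (h3.trans hb) (by linarith)

/-- Over lengths beyond h the increment is at most n, one per window, while the power of the length
over h is at least 1. -/
lemma LocalHolder.scaledHolder_global {θ : ℝ → Rd d} (hθ : LocalHolder θ T h γ) (hT : 0 < T)
    (hh : 0 < h) (hγ : 0 < γ) {n : ℕ} (hn : T ≤ n * h) :
    ScaledHolder θ 0 T ((n + 1) * (T / h) ^ γ) T γ := by
  intro r r' h1 h2 h3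
  have hx : 0 ≤ (r' - r) / h := div_nonneg (sub_nonneg.2 h2) hh.le
  have e : (n + 1) * (T / h) ^ γ * ((r' - r) / T) ^ γ = (n + 1) * ((r' - r) / h) ^ γ := by
    rw [mul_assoc, ← Real.mul_rpow (by positivity) (div_nonneg (sub_nonneg.2 h2) hT.le)]
    congr 2
    field_simp
  rw [e]
  rcases le_total (r' - r) h with hle | hle
  · refine (hθ r r' h1 h2 h3 hle).trans ?_
    exact le_mul_of_one_le_left (by positivity) (by linarith [n.cast_nonneg (α := ℝ)])
  · have h4 : ‖θ r' - θ r‖ ≤ n * 1 := by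
      refine norm_le_of_windows (F := fun a b => θ b - θ a) (a₀ := r) (x := T) (h := h)
        (fun _ _ _ _ _ _ _ => by abel) zero_le_one hh (fun a b f1 f2 f3 f4 => ?_) n r' h2 h3
        (by linarith)
      exact (hθ a b (h1.trans f1) f2 f3 f4).trans
        (Real.rpow_le_one (div_nonneg (sub_nonneg.2 f2) hh.le) ((div_le_one hh).2 f4) hγ.le)
    have h5 : 1 ≤ ((r' - r) / h) ^ γ := Real.one_le_rpow ((one_le_div hh).2 hle) hγ.le
    refine h4.trans (mul_le_mul (by linarith) h5 zero_le_one (by positivity))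

/-! ### Exponentially weighted bounds -/

/-- A path bounded, with its local Hölder seminorm, by `Z` in the norm with weight
`exp (-t / h)`. -/
structure WeightedBound (ζ : ℝ → Rd d) (T h γ Z : ℝ) : Prop where
  val : ∀ r, 0 ≤ r → r ≤ T → ‖ζ r‖ ≤ Z * Real.exp (r / h)
  inc : ∀ r r', 0 ≤ r → r ≤ r' → r' ≤ T → r' - r ≤ h →
    ‖ζ r' - ζ r‖ ≤ Z * Real.exp (r' / h) * ((r' - r) / h) ^ γ

/-- The weight grows by e ≥ 2 over a window, so adding up increments backwards in steps of h is a
geometric series: Y + 2Y/e ≤ 2Y. The constant is therefore independent of the number of windows. -/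
lemma weightedBound_of_increments {ζ : ℝ → Rd d} {Y : ℝ} (hh : 0 < h) (hγ : 0 < γ) (hY : 0 ≤ Y)
    (h0 : ζ 0 = 0) (hinc : ∀ r r', 0 ≤ r → r ≤ r' → r' ≤ T → r' - r ≤ h →
      ‖ζ r' - ζ r‖ ≤ Y * Real.exp (r' / h) * ((r' - r) / h) ^ γ) :
    WeightedBound ζ T h γ (2 * Y) := by
  have key : ∀ n : ℕ, ∀ r, 0 ≤ r → r ≤ T → r ≤ n * h → ‖ζ r‖ ≤ 2 * Y * Real.exp (r / h) := by
    intro n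
    induction n with
    | zero =>
      intro r h1 h2 h3
      have : r = 0 := by
        rw [Nat.cast_zero, zero_mul] at h3
        linarith
      rw [this, h0, norm_zero]
      positivity
    | succ n ih =>
      intro r h1 h2 h3
      push_cast at h3
      have step : ∀ r₀, 0 ≤ r₀ → r₀ ≤ r → r - r₀ ≤ h → ‖ζ r - ζ r₀‖ ≤ Y * Real.exp (r / h) := by
        intro r₀ f1 f2 f3
        exact (hinc r₀ r f1 f2 h2 f3).trans (mul_le_of_le_one_right (by positivity)
          (Real.rpow_le_one (div_nonneg (sub_nonneg.2 f2) hh.le) ((div_le_one hh).2 f3) hγ.le))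
      rcases le_total r h with hle | hle
      · have := step 0 le_rfl h1 (by linarith)
        rw [h0, sub_zero] at this
        have : 0 ≤ Y * Real.exp (r / h) := by positivity
        linarith
      · have s1 := step (r - h) (by linarith) (by linarith) (by linarith)
        have s2 := ih (r - h) (by linarith) (by linarith) (by linarith)
        have s3 : 2 * Real.exp ((r - h) / h) ≤ Real.exp (r / h) := by
          have e : r / h = (r - h) / h + 1 := by
            field_simp
            ring
          rw [e, Real.exp_add, mul_comm]
          have := Real.add_one_le_exp (1 : ℝ)
          gcongr
          linarith
        have s4 : ζ r = (ζ r - ζ (r - h)) + ζ (r - h) := by abel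
        rw [s4]
        refine (norm_add_le _ _).trans ((add_le_add s1 s2).trans ?_)
        have := mul_le_mul_of_nonneg_left s3 hY
        linarith
  refine ⟨fun r h1 h2 => ?_, fun r r' h1 h2 h3 h4 => (hinc r r' h1 h2 h3 h4).trans ?_⟩
  · obtain ⟨n, hn⟩ := exists_nat_ge (r / h)
    exact key n r h1 h2 ((div_le_iff₀ hh).1 hn)
  · have hx : 0 ≤ (r' - r) / h := div_nonneg (sub_nonneg.2 h2) hh.le
    gcongr
    linarith

/-- The starting bound of the iterations: two paths of the class with the same initial value differ
by increments with constant 2, and passing to values doubles it. -/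
lemma LocalHolder.weightedBound_sub {θ η : ℝ → Rd d} (hθ : LocalHolder θ T h γ)
    (hη : LocalHolder η T h γ) (hh : 0 < h) (hγ : 0 < γ) (h0 : θ 0 = η 0) :
    WeightedBound (fun r => θ r - η r) T h γ 4 := by
  have := weightedBound_of_increments (ζ := fun r => θ r - η r) (T := T) (Y := 2) hh hγ
    zero_le_two (sub_eq_zero.2 h0) fun r r' h1 h2 h3 h4 => ?_
  · norm_num at this
    exact this
  · have e : (θ r' - η r') - (θ r - η r) = (θ r' - θ r) - (η r' - η r) := by abel
    have hx : 0 ≤ (r' - r) / h := div_nonneg (sub_nonneg.2 h2) hh.le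
    have hx' : 0 ≤ r' / h := div_nonneg (h1.trans h2) hh.le
    beta_reduce
    rw [e]
    refine (norm_sub_le _ _).trans ((add_le_add (hθ r r' h1 h2 h3 h4)
      (hη r r' h1 h2 h3 h4)).trans ?_)
    rw [← two_mul]
    refine mul_le_mul_of_nonneg_right ?_ (by positivity)
    exact le_mul_of_one_le_right zero_le_two (Real.one_le_exp hx')

end Windows

/-! ### Well-posedness of the nonlinear Young equation -/

section FixedPoint

open Filter Topology

variable {d : ℕ} {A : ℝ → ℝ → Rd d → Rd d} {T M γ κ h : ℝ} {θ η : ℝ → Rd d} {u₀ : Rd d} {n : ℕ}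

/-- The Lipschitz constant of the solution map on the time scale `h`, for `n` windows. -/
noncomputable def contractionConst (M γ β h : ℝ) (n : ℕ) : ℝ :=
  2 * n * ((1 + sewingConst β) ^ 2 * (M * (h ^ γ) ^ 2 * 4))

lemma contractionConst_nonneg {β : ℝ} (hM : 0 ≤ M) : 0 ≤ contractionConst M γ β h n := by
  have := sewingConst_nonneg β
  unfold contractionConst
  positivity

/-- With h = T/n, a total of n windows of size h^{2γ} gives n^{1-2γ}, which vanishes exactly because
γ > 1/2. -/
lemma tendsto_contractionConst {β : ℝ} (hT : 0 < T) (hγ : 1 / 2 < γ) :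
    Tendsto (fun n : ℕ => contractionConst M γ β (T / n) n) atTop (𝓝 0) := by
  have h1 : Tendsto (fun n : ℕ => ((n : ℝ)) ^ (-(2 * γ - 1))) atTop (𝓝 0) :=
    (tendsto_rpow_neg_atTop (by linarith)).comp tendsto_natCast_atTop_atTop
  have h2 := h1.const_mul (2 * ((1 + sewingConst β) ^ 2 * (M * (T ^ γ) ^ 2 * 4)))
  rw [mul_zero] at h2
  refine h2.congr' ?_
  filter_upwards [eventually_gt_atTop 0] with n hn
  have hn' : (0 : ℝ) < n := by exact_mod_cast hn
  have e : ((n : ℝ)) ^ (-(2 * γ - 1)) = n * ((n : ℝ) ^ γ)⁻¹ ^ 2 := by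
    have e1 : -(2 * γ - 1) = 1 + (-γ) + (-γ) := by ring
    rw [e1, Real.rpow_add hn', Real.rpow_add hn', Real.rpow_one, Real.rpow_neg hn'.le]
    ring
  rw [contractionConst, e, Real.div_rpow hT.le hn'.le]
  ring

lemma BoxHolder.rectBound_global (hA : BoxHolder A T M γ κ) (hM : 0 ≤ M) (hγ : 0 < γ)
    (hκ : 0 < κ) (hκ1 : κ < 1) (hT : 0 < T) {L : ℝ} (hL : 0 ≤ L) (hθ : ScaledHolder θ 0 T L T γ) :
    RectBound (youngGerm A θ) 0 T 0 T (M * (T ^ γ) ^ 2 * (1 + L) ^ 2) T γ (γ * (1 + κ)) :=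
  hA.rectBound hM hγ hκ hκ1 hT hL le_rfl le_rfl (by simp) le_rfl le_rfl (by simp) hθ hθ

lemma LocalHolder.exists_rectBound (hθ : LocalHolder θ T h γ) (hA : BoxHolder A T M γ κ)
    (hM : 0 ≤ M) (hγ : 0 < γ) (hκ : 0 < κ) (hκ1 : κ < 1) (hT : 0 < T) (hh : 0 < h)
    (hn : T ≤ n * h) :
    ∃ K, 0 ≤ K ∧ RectBound (youngGerm A θ) 0 T 0 T K T γ (γ * (1 + κ)) :=
  ⟨_, by positivity, hA.rectBound_global hM hγ hκ hκ1 hT (by positivity)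
    (hθ.scaledHolder_global hT hh hγ hn)⟩

/-- Additivity on a degenerate rectangle forces the sewing over it to vanish. -/
lemma youngMap_zero (hθ : LocalHolder θ T h γ) (hA : BoxHolder A T M γ κ)
    (hM : 0 ≤ M) (hγ : 0 < γ) (hκ : 0 < κ) (hκ1 : κ < 1) (hT : 0 < T) (hh : 0 < h)
    (hn : T ≤ n * h) (hβ : 1 < γ * (1 + κ)) : youngMap T A u₀ θ 0 = u₀ := by
  obtain ⟨K, hK, hR⟩ := hθ.exists_rectBound hA hM hγ hκ hκ1 hT hh hn
  have := (hR.mono le_rfl hT.le le_rfl hT.le).sewRect_add_snd (u := 0) le_rfl le_rfl hT.le le_rfl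
    le_rfl le_rfl hT.le hK hT hβ
  rw [youngMap]
  simpa using this

/-- Invariance of the class: Hölder constant 1 gives the germ constant (1 + 1)² = 4, the same 4 that
the difference estimate produces, so one constant serves both. -/
lemma LocalHolder.youngMap (hθ : LocalHolder θ T h γ) (hA : BoxHolder A T M γ κ)
    (hM : 0 ≤ M) (hγ : 0 < γ) (hκ : 0 < κ) (hκ1 : κ < 1) (hT : 0 < T) (hh : 0 < h)
    (hn : T ≤ n * h) (hβ : 1 < γ * (1 + κ))
    (hρ : contractionConst M γ (γ * (1 + κ)) h n ≤ 1) (u₀ : Rd d) :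
    LocalHolder (youngMap T A u₀ θ) T h γ := by
  intro s t h1 h2 h3 h4
  obtain ⟨K, hK, hR⟩ := hθ.exists_rectBound hA hM hγ hκ hκ1 hT hh hn
  have hx : 0 ≤ (t - s) / h := div_nonneg (sub_nonneg.2 h2) hh.le
  have hγβ : γ ≤ γ * (1 + κ) := by nlinarith
  have key := hR.norm_diagonal_increment_le (h := h) (K := M * (h ^ γ) ^ 2 * 4) hT hK
    (by positivity) hβ hγ hγβ hh hn h1 h2 h3 h4 fun a₁ b₁ a₂ b₂ f1 f2 f3 f4 g1 g2 g3 g4 => by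
      have := hA.rectBound hM hγ hκ hκ1 hh zero_le_one f1 (f3.trans h3) f4 g1 (g3.trans h3) g4
        (hθ.scaledHolder f1 (f3.trans h3) f4) (hθ.scaledHolder g1 (g3.trans h3) g4)
      norm_num at this
      exact this
  rw [_root_.youngMap, _root_.youngMap, add_sub_add_left_eq_sub]
  exact key.trans (mul_le_of_le_one_left (by positivity) hρ)

/-- The integral up to t sees the paths on [0,t] only, where the weight is at most exp(t/h). The
germ estimate with Z exp(t/h) in place of Z thus yields increments with the right weight. -/
lemma WeightedBound.youngMap {Z : ℝ} (hζ : WeightedBound (fun r => θ r - η r) T h γ Z)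
    (hZ : 0 ≤ Z) (hθ : LocalHolder θ T h γ) (hη : LocalHolder η T h γ) (hA : BoxHolder A T M γ κ)
    (hM : 0 ≤ M) (hγ : 0 < γ) (hκ : 0 < κ) (hκ1 : κ < 1) (hT : 0 < T) (hh : 0 < h)
    (hn : T ≤ n * h) (hβ : 1 < γ * (1 + κ)) (u₀ : Rd d) :
    WeightedBound (fun r => youngMap T A u₀ θ r - youngMap T A u₀ η r) T h γ
      (2 * (contractionConst M γ (γ * (1 + κ)) h n * Z)) := by
  have hρ := contractionConst_nonneg (γ := γ) (β := γ * (1 + κ)) (h := h) (n := n) hM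
  refine weightedBound_of_increments hh hγ (mul_nonneg hρ hZ) ?_ ?_
  · rw [youngMap_zero hθ hA hM hγ hκ hκ1 hT hh hn hβ, youngMap_zero hη hA hM hγ hκ hκ1 hT hh hn hβ,
      sub_self]
  intro s t h1 h2 h3 h4
  obtain ⟨K, hK, hR⟩ := hθ.exists_rectBound hA hM hγ hκ hκ1 hT hh hn
  obtain ⟨K', hK', hR'⟩ := hη.exists_rectBound hA hM hγ hκ hκ1 hT hh hn
  have hx : 0 ≤ (t - s) / h := div_nonneg (sub_nonneg.2 h2) hh.le
  have hγβ : γ ≤ γ * (1 + κ) := by nlinarith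
  have hZt : 0 ≤ Z * Real.exp (t / h) := by positivity
  have wval : ∀ r, 0 ≤ r → r ≤ t → ‖θ r - η r‖ ≤ Z * Real.exp (t / h) := fun r f1 f2 =>
    (hζ.val r f1 (f2.trans h3)).trans (by gcongr)
  have winc : ∀ a b, 0 ≤ a → b ≤ t → b - a ≤ h →
      ScaledHolder (fun r => θ r - η r) a b (Z * Real.exp (t / h)) h γ := by
    intro a b f1 f2 f3 r r' g1 g2 g3
    have hy : 0 ≤ (r' - r) / h := div_nonneg (sub_nonneg.2 g2) hh.le
    refine (hζ.inc r r' (f1.trans g1) g2 ((g3.trans f2).trans h3) (by linarith)).trans ?_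
    have : r' ≤ t := g3.trans f2
    gcongr
  have key := (hR.sub hR').norm_diagonal_increment_le (h := h)
    (K := M * (h ^ γ) ^ 2 * (4 * (Z * Real.exp (t / h)))) hT (add_nonneg hK hK')
    (by positivity) hβ hγ hγβ hh hn h1 h2 h3 h4 fun a₁ b₁ a₂ b₂ f1 f2 f3 f4 g1 g2 g3 g4 =>
      hA.rectBound_sub hM hγ hκ hκ1 hh hZt f1 (f3.trans h3) f4 g1 (g3.trans h3) g4
        (hθ.scaledHolder f1 (f3.trans h3) f4) (hθ.scaledHolder g1 (g3.trans h3) g4)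
        (hη.scaledHolder f1 (f3.trans h3) f4) (winc a₁ b₁ f1 f3 f4) (winc a₂ b₂ g1 g3 g4)
        (fun r e1 e2 => wval r (f1.trans e1) (e2.trans f3))
        (fun r e1 e2 => wval r (g1.trans e1) (e2.trans g3))
  have ht0 := h1.trans h2
  have hsT := h2.trans h3
  rw [(hR.mono le_rfl h3 le_rfl h3).sewRect_sub (hR'.mono le_rfl h3 le_rfl h3) le_rfl ht0 h3
      le_rfl ht0 h3 hK hK' hT hβ,
    (hR.mono le_rfl hsT le_rfl hsT).sewRect_sub (hR'.mono le_rfl hsT le_rfl hsT) le_rfl h1 hsT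
      le_rfl h1 hsT hK hK' hT hβ] at key
  simp only [_root_.youngMap, add_sub_add_left_eq_sub]
  refine key.trans (le_of_eq ?_)
  rw [contractionConst]
  ring

/-- Data for which the solution map is a contraction on paths with `LocalHolder _ T h γ`. -/
structure ContractionScale (A : ℝ → ℝ → Rd d → Rd d) (T M γ κ h : ℝ) (n : ℕ) : Prop where
  box : BoxHolder A T M γ κ
  M_nonneg : 0 ≤ M
  γ_pos : 0 < γ
  κ_pos : 0 < κ
  κ_lt : κ < 1
  T_pos : 0 < T
  h_pos : 0 < h
  cover : T ≤ n * h
  one_lt : 1 < γ * (1 + κ)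
  small : contractionConst M γ (γ * (1 + κ)) h n ≤ 1 / 4

lemma ContractionScale.localHolder_youngMap (S : ContractionScale A T M γ κ h n)
    (hθ : LocalHolder θ T h γ) (u₀ : Rd d) : LocalHolder (youngMap T A u₀ θ) T h γ :=
  hθ.youngMap S.box S.M_nonneg S.γ_pos S.κ_pos S.κ_lt S.T_pos S.h_pos S.cover S.one_lt
    (S.small.trans (by norm_num)) u₀

lemma WeightedBound.mono {ζ : ℝ → Rd d} {Z Z' : ℝ} (hζ : WeightedBound ζ T h γ Z) (hh : 0 < h)
    (hZ : Z ≤ Z') : WeightedBound ζ T h γ Z' where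
  val r h1 h2 := (hζ.val r h1 h2).trans (by gcongr)
  inc r r' h1 h2 h3 h4 := by
    have hy : 0 ≤ (r' - r) / h := div_nonneg (sub_nonneg.2 h2) hh.le
    exact (hζ.inc r r' h1 h2 h3 h4).trans (by gcongr)

/-- The smallness 1/4 absorbs the factor 2 lost in passing from increments to values and leaves 1/2.
-/
lemma ContractionScale.weightedBound_youngMap (S : ContractionScale A T M γ κ h n) {Z : ℝ}
    (hZ : 0 ≤ Z) (hθ : LocalHolder θ T h γ) (hη : LocalHolder η T h γ)
    (hζ : WeightedBound (fun r => θ r - η r) T h γ Z) (u₀ : Rd d) :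
    WeightedBound (fun r => youngMap T A u₀ θ r - youngMap T A u₀ η r) T h γ (Z / 2) := by
  refine (hζ.youngMap hZ hθ hη S.box S.M_nonneg S.γ_pos S.κ_pos S.κ_lt S.T_pos S.h_pos S.cover
    S.one_lt u₀).mono S.h_pos ?_
  have := mul_le_mul_of_nonneg_right S.small hZ
  linarith

lemma WeightedBound.congr {ζ ζ' : ℝ → Rd d} {Z : ℝ} (hζ : WeightedBound ζ T h γ Z)
    (e : ∀ r ∈ Icc 0 T, ζ' r = ζ r) : WeightedBound ζ' T h γ Z where
  val r h1 h2 := by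
    rw [e r ⟨h1, h2⟩]
    exact hζ.val r h1 h2
  inc r r' h1 h2 h3 h4 := by
    rw [e r ⟨h1, h2.trans h3⟩, e r' ⟨h1.trans h2, h3⟩]
    exact hζ.inc r r' h1 h2 h3 h4

lemma tendsto_four_mul_half_pow : Tendsto (fun k : ℕ => 4 * (1 / 2 : ℝ) ^ k) atTop (𝓝 0) := by
  have := (tendsto_pow_atTop_nhds_zero_of_lt_one (r := (1 / 2 : ℝ)) (by norm_num)
    (by norm_num)).const_mul 4
  rwa [mul_zero] at this

/-- Fixed points of the solution map are unique. -/
lemma ContractionScale.eq_of_fixed (S : ContractionScale A T M γ κ h n)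
    (hθ : LocalHolder θ T h γ) (hη : LocalHolder η T h γ)
    (fθ : ∀ t ∈ Icc 0 T, θ t = youngMap T A u₀ θ t) (fη : ∀ t ∈ Icc 0 T, η t = youngMap T A u₀ η t)
    {t : ℝ} (ht : t ∈ Icc 0 T) : θ t = η t := by
  have hz : (0 : ℝ) ∈ Icc 0 T := ⟨le_rfl, S.T_pos.le⟩
  have h0 : θ 0 = η 0 := by
    rw [fθ 0 hz, fη 0 hz, youngMap_zero hθ S.box S.M_nonneg S.γ_pos S.κ_pos S.κ_lt S.T_pos S.h_pos
      S.cover S.one_lt, youngMap_zero hη S.box S.M_nonneg S.γ_pos S.κ_pos S.κ_lt S.T_pos S.h_pos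
      S.cover S.one_lt]
  -- Fixed points may be replaced by their images, so the same difference is halved again and again.
  have key : ∀ k : ℕ, WeightedBound (fun r => θ r - η r) T h γ (4 * (1 / 2) ^ k) := by
    intro k
    induction k with
    | zero => simpa using hθ.weightedBound_sub hη S.h_pos S.γ_pos h0
    | succ k ih =>
      refine ((S.weightedBound_youngMap (by positivity) hθ hη ih u₀).congr fun r hr => by
        rw [fθ r hr, fη r hr]).mono S.h_pos (le_of_eq ?_)
      ring
  have hl := tendsto_four_mul_half_pow.mul_const (Real.exp (t / h))
  rw [zero_mul] at hl
  have := ge_of_tendsto' hl fun k => (key k).val t ht.1 ht.2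
  exact sub_eq_zero.1 (norm_le_zero_iff.1 this)

/-- The Picard iterates. -/
noncomputable def picard (T : ℝ) (A : ℝ → ℝ → Rd d → Rd d) (u₀ : Rd d) : ℕ → ℝ → Rd d
  | 0 => fun _ => u₀
  | k + 1 => youngMap T A u₀ (picard T A u₀ k)

/-- The solution map has a fixed point. -/
lemma ContractionScale.exists_fixed (S : ContractionScale A T M γ κ h n) (u₀ : Rd d) :
    ∃ θ : ℝ → Rd d, LocalHolder θ T h γ ∧ ∀ t ∈ Icc 0 T, θ t = youngMap T A u₀ θ t := by
  have hloc : ∀ k, LocalHolder (picard T A u₀ k) T h γ := by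
    intro k
    induction k with
    | zero =>
      intro r r' h1 h2 _ _
      have hy : 0 ≤ (r' - r) / h := div_nonneg (sub_nonneg.2 h2) S.h_pos.le
      simpa [picard] using Real.rpow_nonneg hy γ
    | succ k ih => exact S.localHolder_youngMap ih u₀
  have hzero : ∀ k, picard T A u₀ k 0 = u₀ := by
    intro k
    cases k with
    | zero => rfl
    | succ k =>
      exact youngMap_zero (hloc k) S.box S.M_nonneg S.γ_pos S.κ_pos S.κ_lt S.T_pos S.h_pos
        S.cover S.one_lt
  -- The bound is uniform in j, so the iterates are Cauchy at every time.
  have key : ∀ k j, WeightedBound (fun r => picard T A u₀ k r - picard T A u₀ (k + j) r) T h γ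
      (4 * (1 / 2) ^ k) := by
    intro k
    induction k with
    | zero =>
      intro j
      simpa using (hloc 0).weightedBound_sub (hloc (0 + j)) S.h_pos S.γ_pos
        ((hzero _).trans (hzero _).symm)
    | succ k ih =>
      intro j
      have e : k + 1 + j = k + j + 1 := by ring
      rw [e]
      refine (S.weightedBound_youngMap (by positivity) (hloc k) (hloc (k + j)) (ih j) u₀).mono
        S.h_pos (le_of_eq ?_)
      ring
  have hconv : ∀ t ∈ Icc 0 T, ∃ x, Tendsto (fun k => picard T A u₀ k t) atTop (𝓝 x) := by
    intro t ht
    refine cauchySeq_tendsto_of_complete (cauchySeq_of_le_tendsto_0'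
      (fun k => 4 * (1 / 2 : ℝ) ^ k * Real.exp (t / h)) (fun k j hkj => ?_) ?_)
    · obtain ⟨i, rfl⟩ := Nat.exists_eq_add_of_le hkj
      rw [dist_eq_norm]
      exact (key k i).val t ht.1 ht.2
    · have hl := tendsto_four_mul_half_pow.mul_const (Real.exp (t / h))
      rwa [zero_mul] at hl
  choose! θ hθ using hconv
  have hθloc : LocalHolder θ T h γ := by
    intro r r' h1 h2 h3 h4
    exact le_of_tendsto' ((hθ r' ⟨h1.trans h2, h3⟩).sub (hθ r ⟨h1, h2.trans h3⟩)).norm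
      fun k => hloc k r r' h1 h2 h3 h4
  have shift : ∀ k, ∀ t ∈ Icc 0 T, Tendsto (fun j => picard T A u₀ (k + j) t) atTop (𝓝 (θ t)) :=
    fun k t ht => ((tendsto_add_atTop_iff_nat k).2 (hθ t ht)).congr fun j => by rw [add_comm]
  -- Weighted bounds are closed under pointwise limits, so j may be sent to infinity; no function
  -- space has to be shown complete.
  have hlim : ∀ k, WeightedBound (fun r => picard T A u₀ k r - θ r) T h γ (4 * (1 / 2) ^ k) := by
    intro k
    refine ⟨fun r h1 h2 => ?_, fun r r' h1 h2 h3 h4 => ?_⟩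
    · exact le_of_tendsto' (tendsto_const_nhds.sub (shift k r ⟨h1, h2⟩)).norm
        fun j => (key k j).val r h1 h2
    · exact le_of_tendsto' ((tendsto_const_nhds.sub (shift k r' ⟨h1.trans h2, h3⟩)).sub
        (tendsto_const_nhds.sub (shift k r ⟨h1, h2.trans h3⟩))).norm
        fun j => (key k j).inc r r' h1 h2 h3 h4
  refine ⟨θ, hθloc, fun t ht => ?_⟩
  have l1 : Tendsto (fun k => picard T A u₀ (k + 1) t) atTop (𝓝 (θ t)) :=
    (tendsto_add_atTop_iff_nat 1).2 (hθ t ht)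
  refine tendsto_nhds_unique l1 (tendsto_iff_norm_sub_tendsto_zero.2 ?_)
  have hl := (tendsto_four_mul_half_pow.div_const 2).mul_const (Real.exp (t / h))
  rw [zero_div, zero_mul] at hl
  exact squeeze_zero (fun _ => norm_nonneg _) (fun k =>
    (S.weightedBound_youngMap (by positivity) (hloc k) hθloc (hlim k) u₀).val t ht.1 ht.2) hl

lemma eventually_contractionScale (hA : BoxHolder A T M γ κ) (hM : 0 ≤ M) (hγ : 1 / 2 < γ)
    (hκ : 0 < κ) (hκ1 : κ < 1) (hT : 0 < T) (hβ : 1 < γ * (1 + κ)) :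
    ∀ᶠ n : ℕ in atTop, ContractionScale A T M γ κ (T / n) n := by
  have h1 := (tendsto_contractionConst (M := M) (β := γ * (1 + κ)) hT hγ).eventually_le_const
    (show (0 : ℝ) < 1 / 4 by norm_num)
  filter_upwards [h1, eventually_gt_atTop 0] with n h2 h3
  have hn : (0 : ℝ) < n := by exact_mod_cast h3
  exact ⟨hA, hM, by linarith, hκ, hκ1, hT, by positivity, by field_simp; rfl, hβ, h2⟩

/-- Refining the scale multiplies the Hölder constant by n^{-γ}, which absorbs any L. Uniqueness in
the contraction class thus becomes uniqueness among all γ-Hölder paths. -/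
lemma ScaledHolder.eventually_localHolder {L : ℝ} (hθ : ScaledHolder θ 0 T L T γ) (hγ : 0 < γ)
    (hT : 0 < T) : ∀ᶠ n : ℕ in atTop, LocalHolder θ T (T / n) γ := by
  have h1 : Tendsto (fun n : ℕ => L * (n : ℝ) ^ (-γ)) atTop (𝓝 0) := by
    have := ((tendsto_rpow_neg_atTop hγ).comp tendsto_natCast_atTop_atTop).const_mul L
    rwa [mul_zero] at this
  filter_upwards [h1.eventually_le_const one_pos, eventually_gt_atTop 0] with n h2 h3
  have hn : (0 : ℝ) < n := by exact_mod_cast h3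
  intro r r' f1 f2 f3 _
  have hx : 0 ≤ (r' - r) / (T / n) := div_nonneg (sub_nonneg.2 f2) (by positivity)
  have e : (r' - r) / T = (r' - r) / (T / n) * (n : ℝ)⁻¹ := by field_simp
  refine (hθ r r' f1 f2 f3).trans ?_
  rw [e, Real.mul_rpow hx (by positivity), Real.inv_rpow hn.le, ← Real.rpow_neg hn.le,
    mul_left_comm]
  exact mul_le_of_le_one_right (by positivity) h2

lemma MemTimeHolder.exists_scaledHolder (hθ : MemTimeHolder T γ θ) (hT : 0 < T) :
    ∃ L, 0 ≤ L ∧ ScaledHolder θ 0 T L T γ := by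
  obtain ⟨C, hC⟩ := hθ
  refine ⟨|C| * T ^ γ, by positivity, fun r r' h1 h2 h3 => ?_⟩
  have := hC r ⟨h1, h2.trans h3⟩ r' ⟨h1.trans h2, h3⟩
  rw [abs_of_nonneg (sub_nonneg.2 h2), rpow_eq_scaled (sub_nonneg.2 h2) hT, ← mul_assoc] at this
  have hx : 0 ≤ (r' - r) / T := div_nonneg (sub_nonneg.2 h2) hT.le
  refine this.trans ?_
  gcongr
  exact le_abs_self C

lemma ScaledHolder.memTimeHolder {L : ℝ} (hθ : ScaledHolder θ 0 T L T γ) (hT : 0 < T) :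
    MemTimeHolder T γ θ := by
  have key : ∀ s t, 0 ≤ s → s ≤ t → t ≤ T → ‖θ t - θ s‖ ≤ L / T ^ γ * |t - s| ^ γ := by
    intro s t h1 h2 h3
    refine (hθ s t h1 h2 h3).trans (le_of_eq ?_)
    rw [abs_of_nonneg (sub_nonneg.2 h2), Real.div_rpow (sub_nonneg.2 h2) hT.le]
    ring
  refine ⟨L / T ^ γ, fun s hs t ht => ?_⟩
  rcases le_total s t with hst | hst
  · exact key s t hs.1 hst ht.2
  · rw [norm_sub_rev, abs_sub_comm]
    exact key t s ht.1 hst hs.2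

lemma ScaledHolder.continuousOn {L : ℝ} (hθ : ScaledHolder θ 0 T L T γ) (hT : 0 < T)
    (hγ : 0 < γ) : ContinuousOn θ (Icc 0 T) := by
  obtain ⟨C, hC⟩ := hθ.memTimeHolder hT
  intro s hs
  rw [ContinuousWithinAt, tendsto_iff_norm_sub_tendsto_zero]
  have hl : Tendsto (fun t : ℝ => C * |t - s| ^ γ) (𝓝[Icc 0 T] s) (𝓝 0) := by
    have : ContinuousAt (fun t : ℝ => C * |t - s| ^ γ) s :=
      ((continuousAt_id.sub continuousAt_const).abs.rpow_const (Or.inr hγ.le)).const_mul C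
    have h0 : C * |s - s| ^ γ = 0 := by
      rw [sub_self, abs_zero, Real.zero_rpow hγ.ne', mul_zero]
    have h1 := this.tendsto
    rw [h0] at h1
    exact h1.mono_left nhdsWithin_le_nhds
  refine squeeze_zero' (Eventually.of_forall fun _ => norm_nonneg _) ?_ hl
  filter_upwards [self_mem_nhdsWithin] with t ht using hC s hs t ht

lemma MemTimeSpaceHolder.exists_boxHolder (hA : MemTimeSpaceHolder T γ 2 κ A) (hT : 0 < T) :
    ∃ M, 0 ≤ M ∧ BoxHolder A T M γ κ := by
  obtain ⟨M, hM⟩ := hA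
  have hz : (0 : ℝ) ∈ Icc 0 T := ⟨le_rfl, hT.le⟩
  refine ⟨M, (hM 0 hz 0 hz 0 hz 0 hz).1.nonneg, fun s₁ t₁ s₂ t₂ h1 h2 h3 k1 k2 k3 => ?_⟩
  have := (hM s₁ ⟨h1, h2.trans h3⟩ s₂ ⟨k1, k2.trans k3⟩ t₁ ⟨h1.trans h2, h3⟩ t₂
    ⟨k1.trans k2, k3⟩).2.2.2
  rwa [abs_of_nonneg (sub_nonneg.2 h2), abs_of_nonneg (sub_nonneg.2 k2)] at this

/-- Existence of solutions of the nonlinear Young equation. -/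
lemma exists_youngSolution (hT : 0 < T) {z : ℝ → Rd d} (hz : ContinuousOn z (Icc 0 T))
    (hγ : 1 / 2 < γ) (hκ : 0 < κ) (hκ1 : κ < 1) (hβ : 1 < γ * (1 + κ))
    (hA : MemTimeSpaceHolder T γ 2 κ A) (u₀ : Rd d) :
    ∃ u : ℝ → Rd d, IsYoungSolution T γ A z u₀ u := by
  obtain ⟨M, hM, hB⟩ := hA.exists_boxHolder hT
  obtain ⟨n, S⟩ := (eventually_contractionScale hB hM hγ hκ hκ1 hT hβ).exists
  obtain ⟨θ, hθ, hfix⟩ := S.exists_fixed u₀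
  have hg := hθ.scaledHolder_global hT S.h_pos S.γ_pos S.cover
  obtain ⟨K, hK, hR⟩ := hθ.exists_rectBound hB hM S.γ_pos hκ hκ1 hT S.h_pos S.cover
  have e : (fun t => (θ t + z t) - z t) = θ := by
    funext t
    exact add_sub_cancel_right _ _
  refine ⟨fun t => θ t + z t, (hg.continuousOn hT S.γ_pos).add hz, ?_⟩
  rw [e]
  exact ⟨hg.memTimeHolder hT, (hR.solves_iff hT hK hβ u₀).2 hfix⟩

/-- Uniqueness of solutions of the nonlinear Young equation. -/
lemma IsYoungSolution.eqOn (hT : 0 < T) {z : ℝ → Rd d}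
    (hγ : 1 / 2 < γ) (hκ : 0 < κ) (hκ1 : κ < 1) (hβ : 1 < γ * (1 + κ))
    (hA : MemTimeSpaceHolder T γ 2 κ A) {u v : ℝ → Rd d} (hu : IsYoungSolution T γ A z u₀ u)
    (hv : IsYoungSolution T γ A z u₀ v) : EqOn u v (Icc 0 T) := by
  obtain ⟨M, hM, hB⟩ := hA.exists_boxHolder hT
  have hγ0 : 0 < γ := by linarith
  obtain ⟨L, hL, hθ⟩ := hu.2.1.exists_scaledHolder hT
  obtain ⟨L', hL', hη⟩ := hv.2.1.exists_scaledHolder hT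
  -- One common scale at which the map contracts and both solutions belong to the class.
  obtain ⟨n, S, h1, h2⟩ := ((eventually_contractionScale hB hM hγ hκ hκ1 hT hβ).and
    ((hθ.eventually_localHolder hγ0 hT).and (hη.eventually_localHolder hγ0 hT))).exists
  have R1 := hB.rectBound_global hM hγ0 hκ hκ1 hT hL hθ
  have R2 := hB.rectBound_global hM hγ0 hκ hκ1 hT hL' hη
  intro t ht
  have := S.eq_of_fixed h1 h2 ((R1.solves_iff hT (by positivity) hβ u₀).1 hu.2.2)
    ((R2.solves_iff hT (by positivity) hβ u₀).1 hv.2.2) ht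
  exact sub_left_injective this

end FixedPoint

/-! ### The averaged drift of a bounded continuous function -/

section Averaging

variable {d : ℕ} {f : Rd d → Rd d} {C W : ℝ}

lemma integrable_schwartz_smul_bdd (φ : 𝓢(Rd d, ℝ)) {g : Rd d → Rd d} (hg : Continuous g)
    (hC : ∀ x, ‖g x‖ ≤ C) : Integrable (fun x => φ x • g x) :=
  φ.integrable.smul_bdd C hg.aestronglyMeasurable (Filter.Eventually.of_forall hC)

lemma continuous_integral_shift (hf : Continuous f) (hC : ∀ x, ‖f x‖ ≤ C) (φ : 𝓢(Rd d, ℝ)) :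
    Continuous fun y => ∫ x, φ x • f (x + y) := by
  refine continuous_of_dominated (bound := fun x => ‖φ x‖ * C) (fun y => ?_)
    (fun y => Filter.Eventually.of_forall fun x => ?_) (φ.integrable.norm.mul_const C)
    (Filter.Eventually.of_forall fun x => by fun_prop)
  · exact (φ.continuous.smul (by fun_prop)).aestronglyMeasurable
  · rw [norm_smul]
    exact mul_le_mul_of_nonneg_left (hC _) (norm_nonneg _)

lemma norm_integral_shift_le (hC : ∀ x, ‖f x‖ ≤ C) (φ : 𝓢(Rd d, ℝ)) (y : Rd d) :
    ‖∫ x, φ x • f (x + y)‖ ≤ ∫ x, ‖φ x‖ * C :=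
  norm_integral_le_of_norm_le (φ.integrable.norm.mul_const C)
    (Filter.Eventually.of_forall fun x => by
      rw [norm_smul]
      exact mul_le_mul_of_nonneg_left (hC _) (norm_nonneg _))

lemma TemperedIsFunction.apply_compSubConst {b : TemperedRd d} (hb : TemperedIsFunction b f)
    (φ : 𝓢(Rd d, ℝ)) (y : Rd d) :
    b (SchwartzMap.compSubConstCLM ℝ (-y) φ) = ∫ x, φ x • f (x + -y) := by
  rw [(hb _).2, ← integral_add_right_eq_self (fun x => φ x • f (x + -y)) y]
  simp only [SchwartzMap.compSubConstCLM_apply, sub_neg_eq_add, add_neg_cancel_right]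

variable {S : Measure (ℝ × ℝ)} {g : ℝ × ℝ → Rd d} {ρ : ℝ × ℝ → ℝ}

/-- The reflection of the measure cancels the sign of the shift of f, leaving f at `x + g r`. -/
lemma convMeasure_reflectedMeasure_map {b : TemperedRd d} (hb : TemperedIsFunction b f)
    (hf : Continuous f) (hC : ∀ x, ‖f x‖ ≤ C) (hg : AEMeasurable g S) (hρ : AEMeasurable ρ S)
    (φ : 𝓢(Rd d, ℝ)) :
    convMeasure b (reflectedMeasure ((S.withDensity fun r => ENNReal.ofReal (ρ r)).map g)) φ =
      ∫ r, max (ρ r) 0 • (∫ x, φ x • f (x + g r)) ∂S := by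
  have hcont := continuous_integral_shift hf hC φ
  have hg' : AEMeasurable g (S.withDensity fun r => ENNReal.ofReal (ρ r)) :=
    hg.mono_ac (withDensity_absolutelyContinuous _ _)
  simp only [convMeasure, reflectedMeasure, hb.apply_compSubConst]
  rw [integral_map (f := fun y => ∫ x, φ x • f (x + -y)) (φ := fun y => -y)
    measurable_neg.aemeasurable (hcont.comp continuous_neg).aestronglyMeasurable]
  simp only [neg_neg]
  rw [integral_map hg' hcont.aestronglyMeasurable,
    integral_withDensity_eq_integral_toReal_smul₀ hρ.ennreal_ofReal
      (Filter.Eventually.of_forall fun _ => ENNReal.ofReal_lt_top)]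
  simp only [ENNReal.toReal_ofReal']

/-- Positive and negative part recombine to the signed density, and Fubini exchanges r and x: φ is
integrable, f and ρ are bounded and S is finite. -/
lemma convMeasure_sub_convMeasure [IsFiniteMeasure S] {b : TemperedRd d}
    (hb : TemperedIsFunction b f) (hf : Continuous f) (hC : ∀ x, ‖f x‖ ≤ C)
    (hg : AEMeasurable g S) (hρ : AEMeasurable ρ S) (hW : ∀ᵐ r ∂S, ‖ρ r‖ ≤ W) (φ : 𝓢(Rd d, ℝ)) :
    convMeasure b (reflectedMeasure ((S.withDensity fun r => ENNReal.ofReal (ρ r)).map g)) φ -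
      convMeasure b (reflectedMeasure ((S.withDensity fun r => ENNReal.ofReal (-ρ r)).map g)) φ =
      ∫ x, φ x • ∫ r, ρ r • f (x + g r) ∂S := by
  have hcont := continuous_integral_shift hf hC φ
  rw [convMeasure_reflectedMeasure_map hb hf hC hg hρ,
    convMeasure_reflectedMeasure_map (ρ := fun r => -ρ r) hb hf hC hg hρ.neg]
  have hH : AEStronglyMeasurable (fun r => ∫ x, φ x • f (x + g r)) S :=
    (hcont.measurable.comp_aemeasurable hg).aestronglyMeasurable
  have hHb : ∀ᵐ r ∂S, ‖∫ x, φ x • f (x + g r)‖ ≤ ∫ x, ‖φ x‖ * C :=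
    Filter.Eventually.of_forall fun r => norm_integral_shift_le hC φ _
  have hρi : Integrable ρ S := Integrable.of_bound hρ.aestronglyMeasurable W hW
  have i1 : Integrable (fun r => max (ρ r) 0 • ∫ x, φ x • f (x + g r)) S :=
    hρi.pos_part.smul_bdd _ hH hHb
  have i2 : Integrable (fun r => max (-ρ r) 0 • ∫ x, φ x • f (x + g r)) S :=
    hρi.neg_part.smul_bdd _ hH hHb
  rw [← integral_sub i1 i2]
  simp only [← sub_smul, max_zero_sub_max_neg_zero_eq_self]
  have hprod : Integrable (fun p : (ℝ × ℝ) × Rd d => ρ p.1 • φ p.2) (S.prod volume) :=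
    hρi.smul_prod φ.integrable
  have hmeas : AEStronglyMeasurable (fun p : (ℝ × ℝ) × Rd d => f (p.2 + g p.1))
      (S.prod volume) := by
    have h1 : AEMeasurable (fun p : (ℝ × ℝ) × Rd d => p.2 + g p.1) (S.prod volume) :=
      measurable_snd.aemeasurable.add hg.comp_fst
    exact (hf.measurable.comp_aemeasurable h1).aestronglyMeasurable
  have hint : Integrable (Function.uncurry fun (r : ℝ × ℝ) (x : Rd d) =>
      (ρ r • φ x) • f (x + g r)) (S.prod volume) :=
    hprod.smul_bdd C hmeas (Filter.Eventually.of_forall fun _ => hC _)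
  have e1 : ∀ r, ρ r • ∫ x, φ x • f (x + g r) = ∫ x, (ρ r • φ x) • f (x + g r) := by
    intro r
    rw [← integral_smul]
    simp only [smul_assoc]
  have e2 : ∀ x, φ x • ∫ r, ρ r • f (x + g r) ∂S = ∫ r, (ρ r • φ x) • f (x + g r) ∂S := by
    intro x
    rw [← integral_smul]
    simp only [smul_smul, smul_eq_mul, mul_comm]
  simp only [e1, e2]
  exact integral_integral_swap hint

lemma continuous_integral_density [IsFiniteMeasure S] (hf : Continuous f) (hC : ∀ x, ‖f x‖ ≤ C)
    (hg : AEMeasurable g S) (hρ : AEMeasurable ρ S) (hW : ∀ᵐ r ∂S, ‖ρ r‖ ≤ W) :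
    Continuous fun x => ∫ r, ρ r • f (x + g r) ∂S := by
  have hρi : Integrable ρ S := Integrable.of_bound hρ.aestronglyMeasurable W hW
  refine continuous_of_dominated (bound := fun r => ‖ρ r‖ * C) (fun x => ?_)
    (fun x => Filter.Eventually.of_forall fun r => ?_) (hρi.norm.mul_const C)
    (Filter.Eventually.of_forall fun r => by fun_prop)
  · exact hρ.aestronglyMeasurable.smul
      ((hf.measurable.comp_aemeasurable (hg.const_add x)).aestronglyMeasurable)
  · rw [norm_smul]
    exact mul_le_mul_of_nonneg_left (hC _) (norm_nonneg _)

lemma norm_integral_density_le [IsFiniteMeasure S] (hC : ∀ x, ‖f x‖ ≤ C)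
    (hρ : AEMeasurable ρ S) (hW : ∀ᵐ r ∂S, ‖ρ r‖ ≤ W) (x : Rd d) :
    ‖∫ r, ρ r • f (x + g r) ∂S‖ ≤ ∫ r, ‖ρ r‖ * C ∂S :=
  norm_integral_le_of_norm_le
    ((Integrable.of_bound hρ.aestronglyMeasurable W hW).norm.mul_const C)
    (Filter.Eventually.of_forall fun r => by
      rw [norm_smul]
      exact mul_le_mul_of_nonneg_left (hC _) (norm_nonneg _))

/-- A continuous function is determined by the distribution that it gives. -/
lemma TemperedIsFunction.unique {D : 𝓢(Rd d, ℝ) → Rd d} {F F' : Rd d → Rd d}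
    (h : TemperedIsFunction D F) (h' : TemperedIsFunction D F') (hF : Continuous F)
    (hF' : Continuous F') : F = F' := by
  have h0 : ∀ᵐ x, F x - F' x = 0 := by
    refine ae_eq_zero_of_integral_contDiff_smul_eq_zero (f := fun x => F x - F' x)
      (hF.sub hF').locallyIntegrable fun ψ hψ hψc => ?_
    -- Smooth compactly supported test functions are Schwartz functions, so both representations can
    -- be tested on them.
    have e : ∀ x, ψ x = hψc.toSchwartzMap hψ x := fun x => rfl
    simp only [smul_sub, e]
    rw [integral_sub (h _).1 (h' _).1, ← (h _).2, ← (h' _).2, sub_self]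
  exact (Continuous.ae_eq_iff_eq volume hF hF').1 (h0.mono fun x hx => sub_eq_zero.1 hx)

end Averaging

/-! ### Integrals over rectangles -/

section RectIntegral

open Filter Topology

variable {d : ℕ} {T : ℝ}

/-- The integral of `k` over `(s₁, t₁] × (s₂, t₂]`. -/
noncomputable def rectIntegral (k : ℝ × ℝ → Rd d) (s₁ t₁ s₂ t₂ : ℝ) : Rd d :=
  ∫ r in Ioc s₁ t₁ ×ˢ Ioc s₂ t₂, k r

lemma Ioc_prod_subset {s₁ t₁ s₂ t₂ : ℝ} (h1 : 0 ≤ s₁) (h3 : t₁ ≤ T) (k1 : 0 ≤ s₂) (k3 : t₂ ≤ T) :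
    Ioc s₁ t₁ ×ˢ Ioc s₂ t₂ ⊆ Icc 0 T ×ˢ Icc 0 T :=
  Set.prod_mono (fun _ hx => ⟨h1.trans hx.1.le, hx.2.trans h3⟩)
    (fun _ hx => ⟨k1.trans hx.1.le, hx.2.trans k3⟩)

/-- Half-open rectangles tile without overlap, which makes the additivity exact. -/
lemma rectIntegral_add_fst {k : ℝ × ℝ → Rd d} (hk : IntegrableOn k (Icc 0 T ×ˢ Icc 0 T))
    {s₁ u₁ t₁ s₂ t₂ : ℝ} (h1 : 0 ≤ s₁) (h2 : s₁ ≤ u₁) (h2' : u₁ ≤ t₁) (h3 : t₁ ≤ T) (k1 : 0 ≤ s₂)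
    (k3 : t₂ ≤ T) :
    rectIntegral k s₁ u₁ s₂ t₂ + rectIntegral k u₁ t₁ s₂ t₂ = rectIntegral k s₁ t₁ s₂ t₂ := by
  rw [rectIntegral, rectIntegral, rectIntegral, ← Ioc_union_Ioc_eq_Ioc h2 h2', union_prod,
    setIntegral_union _ (measurableSet_Ioc.prod measurableSet_Ioc)
      (hk.mono_set (Ioc_prod_subset h1 (h2'.trans h3) k1 k3))
      (hk.mono_set (Ioc_prod_subset (h1.trans h2) h3 k1 k3))]
  exact Set.Disjoint.set_prod_left (Ioc_disjoint_Ioc_of_le le_rfl) _ _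

lemma rectIntegral_add_snd {k : ℝ × ℝ → Rd d} (hk : IntegrableOn k (Icc 0 T ×ˢ Icc 0 T))
    {s₁ t₁ s₂ u₂ t₂ : ℝ} (h1 : 0 ≤ s₁) (h3 : t₁ ≤ T) (k1 : 0 ≤ s₂) (k2 : s₂ ≤ u₂) (k2' : u₂ ≤ t₂)
    (k3 : t₂ ≤ T) :
    rectIntegral k s₁ t₁ s₂ u₂ + rectIntegral k s₁ t₁ u₂ t₂ = rectIntegral k s₁ t₁ s₂ t₂ := by
  rw [rectIntegral, rectIntegral, rectIntegral, ← Ioc_union_Ioc_eq_Ioc k2 k2', prod_union,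
    setIntegral_union _ (measurableSet_Ioc.prod measurableSet_Ioc)
      (hk.mono_set (Ioc_prod_subset h1 h3 k1 (k2'.trans k3)))
      (hk.mono_set (Ioc_prod_subset h1 h3 (k1.trans k2) k3))]
  exact Set.Disjoint.set_prod_right (Ioc_disjoint_Ioc_of_le le_rfl) _ _

/-- Inclusion-exclusion over the four rectangles with a corner at the origin. -/
lemma boxIncrement_eq_rectIntegral {A : ℝ → ℝ → Rd d → Rd d} {x : Rd d} {k : ℝ × ℝ → Rd d}
    (hk : IntegrableOn k (Icc 0 T ×ˢ Icc 0 T))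
    (hA : ∀ t₁ ∈ Icc 0 T, ∀ t₂ ∈ Icc 0 T, A t₁ t₂ x = rectIntegral k 0 t₁ 0 t₂)
    {s₁ t₁ s₂ t₂ : ℝ} (h1 : 0 ≤ s₁) (h2 : s₁ ≤ t₁) (h3 : t₁ ≤ T) (k1 : 0 ≤ s₂) (k2 : s₂ ≤ t₂)
    (k3 : t₂ ≤ T) : boxIncrement A s₁ s₂ t₁ t₂ x = rectIntegral k s₁ t₁ s₂ t₂ := by
  have ms₁ : s₁ ∈ Icc 0 T := ⟨h1, h2.trans h3⟩
  have mt₁ : t₁ ∈ Icc 0 T := ⟨h1.trans h2, h3⟩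
  have ms₂ : s₂ ∈ Icc 0 T := ⟨k1, k2.trans k3⟩
  have mt₂ : t₂ ∈ Icc 0 T := ⟨k1.trans k2, k3⟩
  rw [boxIncrement, hA t₁ mt₁ t₂ mt₂, hA t₁ mt₁ s₂ ms₂, hA s₁ ms₁ t₂ mt₂, hA s₁ ms₁ s₂ ms₂,
    ← rectIntegral_add_snd hk le_rfl h3 le_rfl k1 k2 k3,
    ← rectIntegral_add_snd hk le_rfl ms₁.2 le_rfl k1 k2 k3,
    ← rectIntegral_add_fst hk le_rfl h1 h2 h3 k1 k3]
  abel

lemma IntervalPartition.le_pts {a b : ℝ} (P : IntervalPartition a b) (i : ℕ) : a ≤ P.pts i :=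
  P.first.ge.trans (P.mono (Nat.zero_le i))

lemma IntervalPartition.pts_succ_le {a b : ℝ} (P : IntervalPartition a b) {i : ℕ} (hi : i < P.n) :
    P.pts (i + 1) ≤ b :=
  (P.mono (Nat.succ_le_of_lt hi)).trans P.last.le

lemma sum_rectIntegral {k : ℝ × ℝ → Rd d} (hk : IntegrableOn k (Icc 0 T ×ˢ Icc 0 T))
    {t₁ t₂ : ℝ} (ht₁ : t₁ ≤ T) (ht₂ : t₂ ≤ T) (P : IntervalPartition 0 t₁)
    (Q : IntervalPartition 0 t₂) :
    ∑ i ∈ Finset.range P.n, ∑ j ∈ Finset.range Q.n,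
      rectIntegral k (P.pts i) (P.pts (i + 1)) (Q.pts j) (Q.pts (j + 1)) =
        rectIntegral k 0 t₁ 0 t₂ := by
  have inner : ∀ i ∈ Finset.range P.n, ∑ j ∈ Finset.range Q.n,
      rectIntegral k (P.pts i) (P.pts (i + 1)) (Q.pts j) (Q.pts (j + 1)) =
        rectIntegral k (P.pts i) (P.pts (i + 1)) 0 t₂ := by
    intro i hi
    have hi' : P.pts (i + 1) ≤ T := (P.pts_succ_le (Finset.mem_range.1 hi)).trans ht₁
    have := sum_eq_of_additive (F := fun x y => rectIntegral k (P.pts i) (P.pts (i + 1)) x y)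
      (a := 0) (b := t₂) (fun s u t f1 f2 f3 f4 => rectIntegral_add_snd hk (P.le_pts i) hi' f1 f2 f3
        (f4.trans ht₂)) Q.mono Q.first.ge Q.last.le
    rw [Q.first, Q.last] at this
    exact this
  rw [Finset.sum_congr rfl inner]
  have := sum_eq_of_additive (F := fun x y => rectIntegral k x y 0 t₂)
    (a := 0) (b := t₁) (fun s u t f1 f2 f3 f4 => rectIntegral_add_fst hk f1 f2 f3 (f4.trans ht₁)
      le_rfl ht₂) P.mono P.first.ge P.last.le
  rw [P.first, P.last] at this
  exact this

lemma norm_rectIntegral_le {k : ℝ × ℝ → Rd d} {B s₁ t₁ s₂ t₂ : ℝ} (h2 : s₁ ≤ t₁) (k2 : s₂ ≤ t₂)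
    (hB : ∀ᵐ r ∂(volume.restrict (Ioc s₁ t₁ ×ˢ Ioc s₂ t₂)), ‖k r‖ ≤ B) :
    ‖rectIntegral k s₁ t₁ s₂ t₂‖ ≤ B * ((t₁ - s₁) * (t₂ - s₂)) := by
  have hfin : volume (Ioc s₁ t₁ ×ˢ Ioc s₂ t₂) < ⊤ :=
    (measure_mono (Set.prod_mono Ioc_subset_Icc_self Ioc_subset_Icc_self)).trans_lt
      (isCompact_Icc.prod isCompact_Icc).measure_lt_top
  have := norm_setIntegral_le_of_norm_le_const_ae hfin hB
  rwa [Measure.volume_eq_prod, measureReal_prod_prod, Real.volume_real_Ioc_of_le h2,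
    Real.volume_real_Ioc_of_le k2] at this

end RectIntegral

/-! ### The nonlinear Young integral for a bounded continuous drift -/

section ContinuousDrift

open Filter Topology

variable {d : ℕ} {T W C : ℝ} {w : ℝ → ℝ} {z : ℝ → Rd d} {f : Rd d → Rd d}

instance isFiniteMeasure_restrict_square (a b c e : ℝ) :
    IsFiniteMeasure ((volume : Measure (ℝ × ℝ)).restrict (Icc a b ×ˢ Icc c e)) :=
  ⟨by
    rw [Measure.restrict_apply_univ]
    exact (isCompact_Icc.prod isCompact_Icc).measure_lt_top⟩

lemma restrict_square_eq_prod (T : ℝ) :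
    (volume : Measure (ℝ × ℝ)).restrict (Icc 0 T ×ˢ Icc 0 T) =
      (volume.restrict (Icc 0 T)).prod (volume.restrict (Icc 0 T)) := by
  rw [Measure.prod_restrict, Measure.volume_eq_prod]

lemma aemeasurable_weight (hw : MemLp w ⊤ (volume.restrict (Icc 0 T))) :
    AEMeasurable (fun r : ℝ × ℝ => w r.1 * w r.2) (volume.restrict (Icc 0 T ×ˢ Icc 0 T)) := by
  rw [restrict_square_eq_prod]
  have := hw.aestronglyMeasurable.aemeasurable
  exact this.comp_fst.mul this.comp_snd

lemma exists_weight_bound (hw : MemLp w ⊤ (volume.restrict (Icc 0 T))) :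
    ∃ W, 0 ≤ W ∧ ∀ᵐ r ∂(volume.restrict (Icc 0 T ×ˢ Icc 0 T)), ‖w r.1 * w r.2‖ ≤ W := by
  have hlt : eLpNormEssSup w (volume.restrict (Icc 0 T)) < ⊤ := by
    have := hw.2
    rwa [eLpNorm_exponent_top] at this
  have hb : ∀ᵐ r ∂(volume.restrict (Icc 0 T)),
      ‖w r‖ ≤ (eLpNormEssSup w (volume.restrict (Icc 0 T))).toReal := by
    filter_upwards [ae_le_eLpNormEssSup (f := w) (μ := volume.restrict (Icc 0 T))] with r hr
    rw [← toReal_enorm]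
    exact ENNReal.toReal_mono hlt.ne hr
  refine ⟨(eLpNormEssSup w (volume.restrict (Icc 0 T))).toReal *
    (eLpNormEssSup w (volume.restrict (Icc 0 T))).toReal,
    mul_nonneg ENNReal.toReal_nonneg ENNReal.toReal_nonneg, ?_⟩
  rw [restrict_square_eq_prod]
  filter_upwards [Measure.quasiMeasurePreserving_fst.ae hb,
    Measure.quasiMeasurePreserving_snd.ae hb] with r h1 h2
  rw [norm_mul]
  exact mul_le_mul h1 h2 (norm_nonneg _) ENNReal.toReal_nonneg

lemma continuousOn_difference {u : ℝ → Rd d} (hu : ContinuousOn u (Icc 0 T)) :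
    ContinuousOn (fun r : ℝ × ℝ => u r.2 - u r.1) (Icc 0 T ×ˢ Icc 0 T) :=
  (hu.comp continuousOn_snd fun _ hr => hr.2).sub (hu.comp continuousOn_fst fun _ hr => hr.1)

lemma integrableOn_kernel (hw : MemLp w ⊤ (volume.restrict (Icc 0 T))) (hf : Continuous f)
    (hC : ∀ x, ‖f x‖ ≤ C) {v : ℝ × ℝ → Rd d} (hv : ContinuousOn v (Icc 0 T ×ˢ Icc 0 T)) :
    IntegrableOn (fun r : ℝ × ℝ => (w r.1 * w r.2) • f (v r)) (Icc 0 T ×ˢ Icc 0 T) := by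
  obtain ⟨W, _, hW⟩ := exists_weight_bound hw
  have h1 := Integrable.of_bound (aemeasurable_weight hw).aestronglyMeasurable W hW
  exact h1.smul_bdd C ((hf.comp_continuousOn hv).aestronglyMeasurable
    (measurableSet_Icc.prod measurableSet_Icc)) (Eventually.of_forall fun _ => hC _)

/-- `A^b` is given by an integral if `b` is a bounded continuous function. -/
lemma RepresentsAveragedDrift.eq_rectIntegral {b : TemperedRd d} {A : ℝ → ℝ → Rd d → Rd d}
    (hA : RepresentsAveragedDrift T b w z A)
    (hAc : ∀ t₁ ∈ Icc 0 T, ∀ t₂ ∈ Icc 0 T, Continuous (A t₁ t₂))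
    (hz : ContinuousOn z (Icc 0 T)) (hw : MemLp w ⊤ (volume.restrict (Icc 0 T)))
    (hb : TemperedIsFunction b f) (hf : Continuous f) (hC : ∀ x, ‖f x‖ ≤ C)
    {t₁ t₂ : ℝ} (ht₁ : t₁ ∈ Icc 0 T) (ht₂ : t₂ ∈ Icc 0 T) (x : Rd d) :
    A t₁ t₂ x = rectIntegral (fun r => (w r.1 * w r.2) • f (x + (z r.2 - z r.1))) 0 t₁ 0 t₂ := by
  set S : Measure (ℝ × ℝ) := volume.restrict (Icc 0 t₁ ×ˢ Icc 0 t₂) with hS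
  have hsub : Icc 0 t₁ ×ˢ Icc 0 t₂ ⊆ Icc 0 T ×ˢ Icc 0 T :=
    Set.prod_mono (Icc_subset_Icc_right ht₁.2) (Icc_subset_Icc_right ht₂.2)
  have hle : S ≤ volume.restrict (Icc 0 T ×ˢ Icc 0 T) := Measure.restrict_mono hsub le_rfl
  obtain ⟨W, _, hW⟩ := exists_weight_bound hw
  have hρ : AEMeasurable (fun r : ℝ × ℝ => w r.1 * w r.2) S :=
    (aemeasurable_weight hw).mono_measure hle
  have hg : AEMeasurable (fun r : ℝ × ℝ => z r.2 - z r.1) S :=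
    ((continuousOn_difference hz).mono hsub).aemeasurable
      (measurableSet_Icc.prod measurableSet_Icc)
  have hWS : ∀ᵐ r ∂S, ‖w r.1 * w r.2‖ ≤ W := ae_mono hle hW
  have hcont := continuous_integral_density hf hC hg hρ hWS
  have hrep : TemperedIsFunction (averagedDrift b w z t₁ t₂)
      (fun x => ∫ r, (w r.1 * w r.2) • f (x + (z r.2 - z r.1)) ∂S) := fun φ =>
    ⟨integrable_schwartz_smul_bdd φ hcont (norm_integral_density_le hC hρ hWS),
      convMeasure_sub_convMeasure hb hf hC hg hρ hWS φ⟩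
  rw [(hA t₁ ht₁ t₂ ht₂).unique hrep (hAc t₁ ht₁ t₂ ht₂) hcont, rectIntegral]
  exact (setIntegral_congr_set (Measure.set_prod_ae_eq Ioc_ae_eq_Icc Ioc_ae_eq_Icc)).symm

/-- For a bounded continuous drift the nonlinear Young integral is a Lebesgue integral. -/
lemma hasNonlinearYoungIntegral_of_continuous {A : ℝ → ℝ → Rd d → Rd d}
    (hA : ∀ t₁ ∈ Icc 0 T, ∀ t₂ ∈ Icc 0 T, ∀ x, A t₁ t₂ x =
      rectIntegral (fun r => (w r.1 * w r.2) • f (x + (z r.2 - z r.1))) 0 t₁ 0 t₂)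
    (hz : ContinuousOn z (Icc 0 T)) (hw : MemLp w ⊤ (volume.restrict (Icc 0 T)))
    (hf : Continuous f) (hC : ∀ x, ‖f x‖ ≤ C) {u : ℝ → Rd d} (hu : ContinuousOn u (Icc 0 T))
    {t : ℝ} (ht : t ∈ Icc 0 T) :
    HasNonlinearYoungIntegral A (fun s => u s - z s) t t
      (rectIntegral (fun r => (w r.1 * w r.2) • f (u r.2 - u r.1)) 0 t 0 t) := by
  intro ε hε
  obtain ⟨W, hW0, hW⟩ := exists_weight_bound hw
  set θ : ℝ → Rd d := fun s => u s - z s with hθdef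
  have hθ : ContinuousOn θ (Icc 0 T) := hu.sub hz
  -- The summand 1 keeps the denominator positive when W t² = 0 and makes the final inequality
  -- strict.
  set ε' := ε / (W * (t * t) + 1) with hε'
  have hden : 0 < W * (t * t) + 1 := by
    have := mul_nonneg ht.1 ht.1
    positivity
  have hε'0 : 0 < ε' := div_pos hε hden
  -- The frozen times of θ and the running times of z are independent variables. At (p_i, q_j, r₁,
  -- r₂) this is the factor of the weight in the box increment, and at (r₁, r₂, r₁, r₂) it is
  -- f(u_{r₂} - u_{r₁}), since θ + z = u. On the compact set K it is uniformly continuous even if f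
  -- is not.
  let Ψ : ℝ × ℝ × ℝ × ℝ → Rd d := fun q =>
    f (θ q.2.1 - θ q.1 + (z q.2.2.2 - z q.2.2.1))
  let K : Set (ℝ × ℝ × ℝ × ℝ) := Icc 0 T ×ˢ Icc 0 T ×ˢ Icc 0 T ×ˢ Icc 0 T
  have hK : IsCompact K := isCompact_Icc.prod (isCompact_Icc.prod (isCompact_Icc.prod isCompact_Icc))
  have hΨ : ContinuousOn Ψ K := by
    refine hf.comp_continuousOn (((hθ.comp ?_ fun q hq => hq.2.1).sub
      (hθ.comp ?_ fun q hq => hq.1)).add ((hz.comp ?_ fun q hq => hq.2.2.2).sub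
      (hz.comp ?_ fun q hq => hq.2.2.1))) <;> fun_prop
  obtain ⟨δ, hδ, hδΨ⟩ := Metric.uniformContinuousOn_iff.1
    (hK.uniformContinuousOn_of_continuous hΨ) ε' hε'0
  refine ⟨δ, hδ, fun P Q hP hQ => ?_⟩
  have hku := integrableOn_kernel hw hf hC (continuousOn_difference hu)
  have hkx : ∀ x, IntegrableOn (fun r : ℝ × ℝ => (w r.1 * w r.2) • f (x + (z r.2 - z r.1)))
      (Icc 0 T ×ˢ Icc 0 T) := fun x =>
    integrableOn_kernel hw hf hC (continuousOn_const.add (continuousOn_difference hz))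
  have P0 := P.le_pts
  have Q0 := Q.le_pts
  have P1 : ∀ i < P.n, P.pts (i + 1) ≤ T := fun i hi => (P.pts_succ_le hi).trans ht.2
  have Q1 : ∀ j < Q.n, Q.pts (j + 1) ≤ T := fun j hj => (Q.pts_succ_le hj).trans ht.2
  have cell : ∀ i ∈ Finset.range P.n, ∀ j ∈ Finset.range Q.n,
      ‖boxIncrement A (P.pts i) (Q.pts j) (P.pts (i + 1)) (Q.pts (j + 1))
          (θ (Q.pts j) - θ (P.pts i)) -
        rectIntegral (fun r => (w r.1 * w r.2) • f (u r.2 - u r.1)) (P.pts i) (P.pts (i + 1))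
          (Q.pts j) (Q.pts (j + 1))‖ ≤
      W * ε' * ((P.pts (i + 1) - P.pts i) * (Q.pts (j + 1) - Q.pts j)) := by
    intro i hi j hj
    have hi := Finset.mem_range.1 hi
    have hj := Finset.mem_range.1 hj
    have hpp := P.mono (Nat.le_succ i)
    have hqq := Q.mono (Nat.le_succ j)
    have hsub := Ioc_prod_subset (P0 i) (P1 i hi) (Q0 j) (Q1 j hj)
    rw [boxIncrement_eq_rectIntegral (hkx _) (fun t₁ h₁ t₂ h₂ => hA t₁ h₁ t₂ h₂ _) (P0 i) hpp
      (P1 i hi) (Q0 j) hqq (Q1 j hj), rectIntegral, rectIntegral,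
      ← integral_sub ((hkx _).mono_set hsub) (hku.mono_set hsub)]
    refine norm_rectIntegral_le hpp hqq ?_
    filter_upwards [ae_restrict_of_ae_restrict_of_subset hsub hW,
      ae_restrict_mem (measurableSet_Ioc.prod measurableSet_Ioc)] with r hr hmem
    rw [← smul_sub, norm_smul]
    refine mul_le_mul hr ?_ (norm_nonneg _) hW0
    have hrT := hsub hmem
    have hd := hδΨ (P.pts i, Q.pts j, r.1, r.2)
      ⟨⟨P0 i, hpp.trans (P1 i hi)⟩, ⟨Q0 j, hqq.trans (Q1 j hj)⟩, hrT.1, hrT.2⟩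
      (r.1, r.2, r.1, r.2) ⟨hrT.1, hrT.2, hrT.1, hrT.2⟩ (by
        have h1 : |P.pts i - r.1| < δ := by
          rw [abs_sub_comm, abs_of_pos (sub_pos.2 hmem.1.1)]
          linarith [hP i hi, hmem.1.2]
        have h2 : |Q.pts j - r.2| < δ := by
          rw [abs_sub_comm, abs_of_pos (sub_pos.2 hmem.2.1)]
          linarith [hQ j hj, hmem.2.2]
        simp only [Prod.dist_eq, Real.dist_eq, sub_self, abs_zero, max_self]
        exact max_lt h1 (max_lt h2 hδ))
    rw [dist_eq_norm] at hd
    have e : θ r.2 - θ r.1 + (z r.2 - z r.1) = u r.2 - u r.1 := by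
      simp only [hθdef]
      abel
    simp only [Ψ, e] at hd
    exact hd.le
  have hsum : youngRiemannSum A θ P Q -
      rectIntegral (fun r => (w r.1 * w r.2) • f (u r.2 - u r.1)) 0 t 0 t =
      ∑ i ∈ Finset.range P.n, ∑ j ∈ Finset.range Q.n,
        (boxIncrement A (P.pts i) (Q.pts j) (P.pts (i + 1)) (Q.pts (j + 1))
          (θ (Q.pts j) - θ (P.pts i)) -
        rectIntegral (fun r => (w r.1 * w r.2) • f (u r.2 - u r.1)) (P.pts i) (P.pts (i + 1))
          (Q.pts j) (Q.pts (j + 1))) := by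
    simp only [Finset.sum_sub_distrib]
    rw [sum_rectIntegral hku ht.2 ht.2 P Q, youngRiemannSum]
  have harea : ∑ i ∈ Finset.range P.n, ∑ j ∈ Finset.range Q.n,
      W * ε' * ((P.pts (i + 1) - P.pts i) * (Q.pts (j + 1) - Q.pts j)) = W * ε' * (t * t) := by
    simp only [← Finset.mul_sum]
    rw [← Finset.sum_mul, Finset.sum_range_sub, Finset.sum_range_sub, P.first, P.last, Q.first,
      Q.last, sub_zero]
  rw [hsum]
  refine lt_of_le_of_lt ((norm_sum_le _ _).trans (Finset.sum_le_sum fun i hi =>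
    (norm_sum_le _ _).trans (Finset.sum_le_sum fun j hj => cell i hi j hj))) ?_
  rw [harea, hε', mul_div_assoc', div_mul_eq_mul_div, div_lt_iff₀ hden]
  nlinarith

lemma iteratedIntegral_eq_rectIntegral (hw : MemLp w ⊤ (volume.restrict (Icc 0 T)))
    (hf : Continuous f) (hC : ∀ x, ‖f x‖ ≤ C) {u : ℝ → Rd d} (hu : ContinuousOn u (Icc 0 T))
    {t : ℝ} (ht : t ∈ Icc 0 T) :
    (∫ s in (0 : ℝ)..t, ∫ r in (0 : ℝ)..t, (w s * w r) • f (u s - u r)) =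
      rectIntegral (fun r => (w r.1 * w r.2) • f (u r.2 - u r.1)) 0 t 0 t := by
  have hk := (integrableOn_kernel hw hf hC (continuousOn_difference hu)).mono_set
    (Ioc_prod_subset le_rfl ht.2 le_rfl ht.2)
  simp only [intervalIntegral.integral_of_le ht.1]
  rw [Measure.volume_eq_prod] at hk
  -- The outer variable s is the second coordinate of the kernel, so the coordinates are swapped for
  -- Fubini and swapped back afterwards.
  have hk' : IntegrableOn (fun r : ℝ × ℝ => (w r.1 * w r.2) • f (u r.1 - u r.2))
      (Ioc 0 t ×ˢ Ioc 0 t) (volume.prod volume) := by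
    have h1 := hk.swap
    refine h1.congr_fun (fun r _ => ?_) (measurableSet_Ioc.prod measurableSet_Ioc)
    simp only [Function.comp_apply, Prod.fst_swap, Prod.snd_swap, mul_comm]
  rw [← setIntegral_prod _ hk', rectIntegral, Measure.volume_eq_prod, ← setIntegral_prod_swap]
  simp only [Prod.fst_swap, Prod.snd_swap, mul_comm]

/-- The equation in its classical form, for a bounded continuous drift. -/
lemma solvesClassical_iff {u₀ : Rd d} {A : ℝ → ℝ → Rd d → Rd d}
    (hA : ∀ t₁ ∈ Icc 0 T, ∀ t₂ ∈ Icc 0 T, ∀ x, A t₁ t₂ x =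
      rectIntegral (fun r => (w r.1 * w r.2) • f (x + (z r.2 - z r.1))) 0 t₁ 0 t₂)
    (hz : ContinuousOn z (Icc 0 T)) (hw : MemLp w ⊤ (volume.restrict (Icc 0 T)))
    (hf : Continuous f) (hC : ∀ x, ‖f x‖ ≤ C) {u : ℝ → Rd d} (hu : ContinuousOn u (Icc 0 T)) :
    SolvesClassical T f w z u₀ u ↔ SolvesYoungEquation T A u₀ (fun t => u t - z t) := by
  refine forall₂_congr fun t ht => ?_
  have hI := hasNonlinearYoungIntegral_of_continuous hA hz hw hf hC hu ht
  rw [iteratedIntegral_eq_rectIntegral hw hf hC hu ht]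
  constructor
  · intro e
    exact ⟨_, hI, sub_eq_iff_eq_add.2 e⟩
  · rintro ⟨I, hI', e⟩
    rw [hI'.unique ht.1 ht.1 hI] at e
    exact sub_eq_iff_eq_add.1 e

lemma SolvesClassical.exists_lipschitzOnWith {u₀ : Rd d}
    (hw : MemLp w ⊤ (volume.restrict (Icc 0 T))) (hf : Continuous f) (hC : ∀ x, ‖f x‖ ≤ C)
    {u : ℝ → Rd d} (hu : ContinuousOn u (Icc 0 T)) (h : SolvesClassical T f w z u₀ u) :
    ∃ K, LipschitzOnWith K (fun t => u t - z t) (Icc 0 T) := by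
  obtain ⟨W, hW0, hW⟩ := exists_weight_bound hw
  have hC0 : 0 ≤ C := (norm_nonneg _).trans (hC 0)
  have hk := integrableOn_kernel hw hf hC (continuousOn_difference hu)
  set k : ℝ × ℝ → Rd d := fun r => (w r.1 * w r.2) • f (u r.2 - u r.1) with hkdef
  have hkb : ∀ᵐ r ∂(volume.restrict (Icc 0 T ×ˢ Icc 0 T)), ‖k r‖ ≤ W * C := by
    filter_upwards [hW] with r hr
    rw [hkdef, norm_smul]
    exact mul_le_mul hr (hC _) (norm_nonneg _) hW0
  have heq : ∀ t ∈ Icc 0 T, u t - z t = u₀ + rectIntegral k 0 t 0 t := fun t ht => by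
    rw [h t ht, iteratedIntegral_eq_rectIntegral hw hf hC hu ht, add_sub_cancel_right]
  -- The kernel is bounded by W C, and each of the two strips between [0,s]² and [0,t]² has area at
  -- most T(t - s).
  have key : ∀ s t, 0 ≤ s → s ≤ t → t ≤ T →
      ‖(u t - z t) - (u s - z s)‖ ≤ 2 * (W * C * T) * |t - s| := by
    intro s t h1 h2 h3
    have hs : s ∈ Icc 0 T := ⟨h1, h2.trans h3⟩
    have ht : t ∈ Icc 0 T := ⟨h1.trans h2, h3⟩
    rw [heq t ht, heq s hs, add_sub_add_left_eq_sub, abs_of_nonneg (sub_nonneg.2 h2),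
      ← rectIntegral_add_fst hk le_rfl h1 h2 h3 le_rfl h3,
      ← rectIntegral_add_snd hk le_rfl hs.2 le_rfl h1 h2 h3]
    have b1 := norm_rectIntegral_le (k := k) h1 h2 (ae_restrict_of_ae_restrict_of_subset
      (Ioc_prod_subset le_rfl hs.2 h1 h3) hkb)
    have b2 := norm_rectIntegral_le (k := k) h2 ht.1 (ae_restrict_of_ae_restrict_of_subset
      (Ioc_prod_subset h1 h3 le_rfl h3) hkb)
    have hWC : 0 ≤ W * C := mul_nonneg hW0 hC0
    have hts := sub_nonneg.2 h2
    have c1 : W * C * ((s - 0) * (t - s)) ≤ W * C * T * (t - s) := by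
      rw [sub_zero, mul_assoc (W * C)]
      exact mul_le_mul_of_nonneg_left (mul_le_mul_of_nonneg_right hs.2 hts) hWC
    have c2 : W * C * ((t - s) * (t - 0)) ≤ W * C * T * (t - s) := by
      rw [sub_zero, mul_comm (t - s), mul_assoc (W * C)]
      exact mul_le_mul_of_nonneg_left (mul_le_mul_of_nonneg_right ht.2 hts) hWC
    have e : ∀ a b c : Rd d, a + b + c - a = b + c := fun a b c => by abel
    rw [e]
    refine (norm_add_le _ _).trans ((add_le_add (b1.trans c1) (b2.trans c2)).trans (le_of_eq ?_))
    ring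
  refine ⟨(2 * (W * C * T)).toNNReal, LipschitzOnWith.of_dist_le_mul fun t ht s hs => ?_⟩
  rw [dist_eq_norm, Real.dist_eq]
  refine le_trans ?_ (mul_le_mul_of_nonneg_right (Real.le_coe_toNNReal _) (abs_nonneg _))
  rcases le_total s t with hst | hst
  · exact key s t hs.1 hst ht.2
  · rw [norm_sub_rev, abs_sub_comm]
    exact key t s ht.1 hst hs.2

lemma MemTimeSpaceHolder.continuous {γ κ : ℝ} {k : ℕ} {A : ℝ → ℝ → Rd d → Rd d}
    (hA : MemTimeSpaceHolder T γ k κ A) {t₁ t₂ : ℝ} (ht₁ : t₁ ∈ Icc 0 T) (ht₂ : t₂ ∈ Icc 0 T) :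
    Continuous (A t₁ t₂) := by
  obtain ⟨M, hM⟩ := hA
  exact (hM t₁ ht₁ t₂ ht₂ t₁ ht₁ t₂ ht₂).1.1.continuous

end ContinuousDrift

theorem proposition5p3 (d : ℕ) (T : ℝ) (hT : 0 < T)
    (z : ℝ → Rd d) (hz : ContinuousOn z (Icc 0 T))
    (w : ℝ → ℝ) (hw : MemLp w ⊤ (volume.restrict (Icc 0 T)))
    (b : TemperedRd d) (u₀ : Rd d) :
    -- Part (a)
    (∀ (γ κ : ℝ), 1 / 2 < γ → γ ≤ 1 → 0 < κ → κ < 1 → 1 < γ + κ →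
      ∀ f : Rd d → Rd d, Continuous f → (∃ C : ℝ, ∀ x, ‖f x‖ ≤ C) → TemperedIsFunction b f →
      ∀ A : ℝ → ℝ → Rd d → Rd d, RepresentsAveragedDrift T b w z A →
        MemTimeSpaceHolder T γ 1 κ A →
      ∀ u : ℝ → Rd d, ContinuousOn u (Icc 0 T) →
        (SolvesClassical T f w z u₀ u ↔
          (∃ K, LipschitzOnWith K (fun t => u t - z t) (Icc 0 T)) ∧
            SolvesYoungEquation T A u₀ (fun t => u t - z t))) ∧
    -- Part (b)
    (∀ (γ κ : ℝ), 1 / 2 < γ → γ ≤ 1 → 0 < κ → κ < 1 → 1 < γ * (1 + κ) →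
      ∀ A : ℝ → ℝ → Rd d → Rd d, RepresentsAveragedDrift T b w z A →
        MemTimeSpaceHolder T γ 2 κ A →
      (∃ u : ℝ → Rd d, IsYoungSolution T γ A z u₀ u) ∧
      (∀ u v : ℝ → Rd d, IsYoungSolution T γ A z u₀ u → IsYoungSolution T γ A z u₀ v →
        EqOn u v (Icc 0 T))) := by
  constructor
  · rintro γ κ - - - - - f hf ⟨C, hC⟩ hb A hA hAH u hu
    -- The spatial continuity of `A t₁ t₂` upgrades the equality of distributions to an identity at
    -- every point.
    have hAeq : ∀ t₁ ∈ Icc 0 T, ∀ t₂ ∈ Icc 0 T, ∀ x, A t₁ t₂ x =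
        rectIntegral (fun r => (w r.1 * w r.2) • f (x + (z r.2 - z r.1))) 0 t₁ 0 t₂ :=
      fun t₁ h₁ t₂ h₂ x => hA.eq_rectIntegral (fun _ k₁ _ k₂ => hAH.continuous k₁ k₂) hz hw hb hf hC
        h₁ h₂ x
    have hiff := solvesClassical_iff (u₀ := u₀) hAeq hz hw hf hC hu
    exact ⟨fun h => ⟨h.exists_lipschitzOnWith hw hf hC hu, hiff.1 h⟩, fun h => hiff.2 h.2⟩
  · intro γ κ hγ _ hκ hκ1 hβ A _ hAH
    exact ⟨exists_youngSolution hT hz hγ hκ hκ1 hβ hAH u₀,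
      fun u v hu hv => hu.eqOn hT hγ hκ hκ1 hβ hAH hv⟩
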